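/- Let $n\ge 1$, $0<q<1$, let $\underline p=(p_0,\dots,p_n)$ be pairwise coprime positive integers, put $\ell_i=\prod_{j\ne i}p_j$, $N=p_0p_1\cdots p_n$, and let $\boldsymbol r=(r_0,\dots,r_{n-1})$ be integers with $0\le r_i<p_i$. Algebras. Let $\mathcal O(S_q^{2n+1})$ be the unital complex $*$-algebra generated by $z_0,\dots,z_n$ with relations $z_iz_j=q^{-1}z_jz_i$ ($i<j$), $z_i^*z_j=qz_jz_i^*$ ($i\ne j$), $[z_i^*,z_i]=(1-q^2)\sum_{j>i}z_jz_j^*$ for $0\le i\le n$ (so $z_n$ is normal), and $\sum_i z_iz_i^*=1$. Let $t\in U(1)$ act by $z_i\mapsto t^{\ell_i}z_i$. Let $\mathcal O(\mathbb P_q(\underline\ell))$ be the $*$-subalgebra of $U(1)$-invariant elements, and $\mathcal O(L_q(N;\underline\ell))\supseteq\mathcal O(\mathbb P_q(\underline\ell))$ the $*$-subalgebra of elements invariant under the $N$-th roots of unity. The latter is generated by $x_i=z_iz_i^*$, $\zeta_i=z_i^{p_i}$ and $\zeta_i^*$. Representations. Let $|\vec m\rangle$, $\vec m=(m_1,\dots,m_n)\in\mathbb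 N^n$, be the canonical basis of $\ell^2(\mathbb N^n)$, and $m_0=0$. For $0\le k\le n$ let $\mathcal V_k$ be the closed span of the $|\vec m\rangle$ with $m_1\le\dots\le m_k$ and $m_{k+1}>\dots>m_n$. For such $\vec m$ put $\kappa_{j}=p_{j-1}(m_{j}-m_{j-1})+r_{j-1}$ ($1\le j\le k$) and $\sigma_i=\kappa_1+\dots+\kappa_i$. The $*$-representation $\pi_k$ of $\mathcal O(L_q(N;\underline\ell))$ on $\ell^2(\mathbb N^n)$ vanishes on $\mathcal V_k^\perp$, satisfies $\pi_k(x_i)=\pi_k(\zeta_i)=0$ for $i>k$, and for $|\vec m\rangle\in\mathcal V_k$ is given by $$\pi_k(x_i)|\vec m\rangle=q^{2\sigma_i}(1-q^{2\kappa_{i+1}})|\vec m\rangle,\qquad \pi_k(\zeta_i)|\vec m\rangle=q^{p_i\sigma_i}\Big(\prod_{s=1}^{p_i}(1-q^{2(\kappa_{i+1}+s)})\Big)^{1/2}|\vec m+\vec e_{ik}\rangle\qquad(0\le i<k),$$ $$\pi_k(x_k)|\vec m\rangle=q^{2\sigma_k}|\vec m\rangle,\qquad \pi_k(\zeta_k)|\vec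 m\rangle=q^{p_k\sigma_k}|\vec m\rangle,$$ where $\vec e_{ik}$ has entries $1$ in the positions $i+1,\dots,k$ and $0$ elsewhere. Let $\pi_{n,\boldsymbol r}^+=\sum_{k\ \mathrm{even}}\pi_k$ and $\pi_{n,\boldsymbol r}^-=\sum_{k\ \mathrm{odd}}\pi_k$, let $\pi_{n,\boldsymbol r}=\pi_{n,\boldsymbol r}^+\oplus\pi_{n,\boldsymbol r}^-$ act on $\mathcal H_{n,\boldsymbol r}=\ell^2(\mathbb N^n)\oplus\ell^2(\mathbb N^n)$, and restrict it to $\mathcal O(\mathbb P_q(\underline\ell))$. Put $\gamma(v\oplus w)=v\oplus(-w)$, $F(v\oplus w)=w\oplus v$, and $D=|D|F$, where $|D|$ is the self-adjoint operator with $|D|\,|\vec m\rangle=\|\vec m\|_1|\vec m\rangle$, $\|\vec m\|_1=m_1+\dots+m_n$, on both summands. Claim. $(\mathcal O(\mathbb P_q(\underline\ell)),\mathcal H_{n,\boldsymbol r},\pi_{n,\boldsymbol r},D,\gamma)$ is an even spectral triple of metric dimension $n$. That is: $\pi_{n,\boldsymbol r}$ is a (possibly degenerate) $*$-representation by bounded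 operators; $D$ is densely defined and self-adjoint with compact resolvent; for every $a\in\mathcal O(\mathbb P_q(\underline\ell))$ the operator $\pi_{n,\boldsymbol r}(a)$ preserves the domain of $D$ and $[D,\pi_{n,\boldsymbol r}(a)]$ extends to a bounded operator; $\gamma$ is a self-adjoint unitary that commutes with $\pi_{n,\boldsymbol r}(a)$ for all $a$ and anticommutes with $D$; and for real $s$ the operator $|D|^{-s}$ (taken on $(\ker D)^\perp$ and extended by $0$ to $\ker D$) is bounded and of trace class if and only if $s>n$, so that the infimum of the $s>0$ for which it is of trace class is $n$. -/

import Mathlib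

open scoped ComplexConjugate ENNReal InnerProductSpace

set_option linter.unusedSectionVars false

noncomputable section

namespace QWP

/-! ### The coordinate algebra of the quantum sphere -/

/-- Generators `z_i` and `z_i^*`, for `0 ≤ i ≤ n`. -/
inductive Gen (n : ℕ) : Type
  | z (i : Fin (n + 1)) : Gen n
  | zs (i : Fin (n + 1)) : Gen n

/-- The defining relations of the quantum sphere, for elements `z i`, `zs i` of a complex algebra,
together with the adjoint `zs_zs` of the first one (the other ones are stable under adjunction).
For `i = n` the sum in `comm` is empty, so that `comm` says that `z_n` is normal. -/
structure SphereRels {n : ℕ} (q : ℝ) {B : Type*} [Ring B] [Algebra ℂ B]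
    (z zs : Fin (n + 1) → B) : Prop where
  z_z : ∀ i j, i < j → z i * z j = ((q : ℂ)⁻¹) • (z j * z i)
  zs_zs : ∀ i j, i < j → zs j * zs i = ((q : ℂ)⁻¹) • (zs i * zs j)
  zs_z : ∀ i j, i ≠ j → zs i * z j = (q : ℂ) • (z j * zs i)
  comm : ∀ i, zs i * z i - z i * zs i = (1 - (q : ℂ) ^ 2) • ∑ j ∈ Finset.Ioi i, z j * zs j
  sphere : ∑ i, z i * zs i = 1

/-- The relation generating the ideal of relations in the free algebra. -/
inductive SphereRel (n : ℕ) (q : ℝ) : FreeAlgebra ℂ (Gen n) → FreeAlgebra ℂ (Gen n) → Prop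
  | z_z (i j : Fin (n + 1)) (h : i < j) : SphereRel n q
      (FreeAlgebra.ι ℂ (Gen.z i) * FreeAlgebra.ι ℂ (Gen.z j))
      (((q : ℂ)⁻¹) • (FreeAlgebra.ι ℂ (Gen.z j) * FreeAlgebra.ι ℂ (Gen.z i)))
  | zs_zs (i j : Fin (n + 1)) (h : i < j) : SphereRel n q
      (FreeAlgebra.ι ℂ (Gen.zs j) * FreeAlgebra.ι ℂ (Gen.zs i))
      (((q : ℂ)⁻¹) • (FreeAlgebra.ι ℂ (Gen.zs i) * FreeAlgebra.ι ℂ (Gen.zs j)))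
  | zs_z (i j : Fin (n + 1)) (h : i ≠ j) : SphereRel n q
      (FreeAlgebra.ι ℂ (Gen.zs i) * FreeAlgebra.ι ℂ (Gen.z j))
      ((q : ℂ) • (FreeAlgebra.ι ℂ (Gen.z j) * FreeAlgebra.ι ℂ (Gen.zs i)))
  | comm (i : Fin (n + 1)) : SphereRel n q
      (FreeAlgebra.ι ℂ (Gen.zs i) * FreeAlgebra.ι ℂ (Gen.z i)
        - FreeAlgebra.ι ℂ (Gen.z i) * FreeAlgebra.ι ℂ (Gen.zs i))
      ((1 - (q : ℂ) ^ 2) •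
        ∑ j ∈ Finset.Ioi i, FreeAlgebra.ι ℂ (Gen.z j) * FreeAlgebra.ι ℂ (Gen.zs j))
  | sphere : SphereRel n q
      (∑ i : Fin (n + 1), FreeAlgebra.ι ℂ (Gen.z i) * FreeAlgebra.ι ℂ (Gen.zs i)) 1

/-- The coordinate algebra `O(S_q^{2n+1})`. -/
def QSphere (n : ℕ) (q : ℝ) : Type := RingQuot (SphereRel n q)

instance (n : ℕ) (q : ℝ) : Ring (QSphere n q) := inferInstanceAs (Ring (RingQuot (SphereRel n q)))

instance (n : ℕ) (q : ℝ) : Algebra ℂ (QSphere n q) :=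
  inferInstanceAs (Algebra ℂ (RingQuot (SphereRel n q)))

namespace QSphere

variable {n : ℕ} {q : ℝ}

def mk : FreeAlgebra ℂ (Gen n) →ₐ[ℂ] QSphere n q := RingQuot.mkAlgHom ℂ (SphereRel n q)

def z (i : Fin (n + 1)) : QSphere n q := mk (FreeAlgebra.ι ℂ (Gen.z i))

def zs (i : Fin (n + 1)) : QSphere n q := mk (FreeAlgebra.ι ℂ (Gen.zs i))

theorem rel {x y : FreeAlgebra ℂ (Gen n)} (h : SphereRel n q x y) :
    (mk x : QSphere n q) = mk y :=
  RingQuot.mkAlgHom_rel ℂ h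

theorem rels : SphereRels q (z : Fin (n + 1) → QSphere n q) zs where
  z_z i j h := by simpa [z] using rel (SphereRel.z_z (q := q) i j h)
  zs_zs i j h := by simpa [zs] using rel (SphereRel.zs_zs (q := q) i j h)
  zs_z i j h := by simpa [z, zs, -Complex.coe_smul] using rel (SphereRel.zs_z (q := q) i j h)
  comm i := by simpa [z, zs] using rel (SphereRel.comm (q := q) i)
  sphere := by simpa [z, zs] using rel (SphereRel.sphere (n := n) (q := q))

theorem induction {P : QSphere n q → Prop} (hc : ∀ c : ℂ, P (algebraMap ℂ _ c))
    (hz : ∀ i, P (z i)) (hzs : ∀ i, P (zs i)) (hmul : ∀ a b, P a → P b → P (a * b))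
    (hadd : ∀ a b, P a → P b → P (a + b)) (a : QSphere n q) : P a := by
  obtain ⟨x, rfl⟩ := RingQuot.mkAlgHom_surjective ℂ (SphereRel n q) a
  change P (mk x)
  induction x using FreeAlgebra.induction with
  | grade0 c => rw [AlgHom.commutes]; exact hc c
  | grade1 g => cases g with
    | z i => exact hz i
    | zs i => exact hzs i
  | mul a b ha hb => rw [map_mul]; exact hmul _ _ ha hb
  | add a b ha hb => rw [map_add]; exact hadd _ _ ha hb

def genMap {B : Type*} (Z Zs : Fin (n + 1) → B) : Gen n → B
  | Gen.z i => Z i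
  | Gen.zs i => Zs i

/-- Elements of an algebra satisfying the relations define a representation of `O(S_q^{2n+1})`. -/
def lift {B : Type*} [Ring B] [Algebra ℂ B] (Z Zs : Fin (n + 1) → B)
    (h : SphereRels q Z Zs) : QSphere n q →ₐ[ℂ] B :=
  RingQuot.liftAlgHom ℂ ⟨FreeAlgebra.lift ℂ (genMap Z Zs), by
    intro x y hxy
    cases hxy with
    | z_z i j hij => simpa [genMap] using h.z_z i j hij
    | zs_zs i j hij => simpa [genMap, -Complex.coe_smul] using h.zs_zs i j hij
    | zs_z i j hij => simpa [genMap, -Complex.coe_smul] using h.zs_z i j hij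
    | comm i => simpa [genMap] using h.comm i
    | sphere => simpa [genMap] using h.sphere⟩

section lift
variable {B : Type*} [Ring B] [Algebra ℂ B] (Z Zs : Fin (n + 1) → B) (h : SphereRels q Z Zs)

@[simp] theorem lift_z (i : Fin (n + 1)) : lift Z Zs h (z i) = Z i := by
  refine (RingQuot.liftAlgHom_mkAlgHom_apply ..).trans ?_
  simp [genMap]

@[simp] theorem lift_zs (i : Fin (n + 1)) : lift Z Zs h (zs i) = Zs i := by
  refine (RingQuot.liftAlgHom_mkAlgHom_apply ..).trans ?_
  simp [genMap]

end lift

end QSphere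

/-- The opposite algebra with the conjugate action of the scalars: an algebra homomorphism into it
is an antilinear antihomomorphism. -/
def ConjOp (B : Type*) : Type _ := Bᵐᵒᵖ

instance (B : Type*) [Ring B] : Ring (ConjOp B) := inferInstanceAs (Ring Bᵐᵒᵖ)

instance (B : Type*) [Ring B] [Algebra ℂ B] : Algebra ℂ (ConjOp B) :=
  ((algebraMap ℂ Bᵐᵒᵖ).comp (starRingEnd ℂ)).toAlgebra' fun c x =>
    Algebra.commutes (A := Bᵐᵒᵖ) (conj c) x

namespace ConjOp

variable {B : Type*} [Ring B] [Algebra ℂ B]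

def op (b : B) : ConjOp B := MulOpposite.op b

def unop (x : ConjOp B) : B := MulOpposite.unop x

theorem ext {x y : ConjOp B} (h : unop x = unop y) : x = y := MulOpposite.unop_injective h

@[simp] theorem unop_op (b : B) : unop (op b) = b := rfl

@[simp] theorem unop_mul (x y : ConjOp B) : unop (x * y) = unop y * unop x := rfl

@[simp] theorem unop_one : unop (1 : ConjOp B) = 1 := rfl

@[simp] theorem unop_add (x y : ConjOp B) : unop (x + y) = unop x + unop y := rfl

@[simp] theorem unop_sub (x y : ConjOp B) : unop (x - y) = unop x - unop y := rfl

@[simp] theorem unop_algebraMap (c : ℂ) :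
    unop (algebraMap ℂ (ConjOp B) c) = algebraMap ℂ B (conj c) := rfl

theorem unop_smul (c : ℂ) (x : ConjOp B) : unop (c • x) = conj c • unop x := by
  rw [Algebra.smul_def, Algebra.smul_def, Algebra.commutes, unop_mul, unop_algebraMap]

@[simp] theorem unop_sum {ι : Type*} (s : Finset ι) (f : ι → ConjOp B) :
    unop (∑ i ∈ s, f i) = ∑ i ∈ s, unop (f i) :=
  map_sum (AddMonoidHom.mk' (unop : ConjOp B → B) unop_add) f s

end ConjOp

namespace QSphere

variable {n : ℕ} {q : ℝ}

theorem rels_conjOp : SphereRels (n := n) q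
    (fun i => (ConjOp.op (zs i) : ConjOp (QSphere n q))) (fun i => ConjOp.op (z i)) where
  z_z i j h := by
    apply ConjOp.ext
    simpa [ConjOp.unop_smul] using rels.zs_zs i j h
  zs_zs i j h := by
    apply ConjOp.ext
    simpa [ConjOp.unop_smul] using rels.z_z i j h
  zs_z i j h := by
    apply ConjOp.ext
    simpa [ConjOp.unop_smul, -Complex.coe_smul] using rels.zs_z j i h.symm
  comm i := by
    apply ConjOp.ext
    simpa [ConjOp.unop_smul, -Complex.coe_smul] using rels.comm (n := n) (q := q) i
  sphere := by
    apply ConjOp.ext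
    simpa using rels.sphere (n := n) (q := q)

def starHom : QSphere n q →ₐ[ℂ] ConjOp (QSphere n q) :=
  lift (fun i => ConjOp.op (zs i)) (fun i => ConjOp.op (z i)) rels_conjOp

/-- The antilinear involution of `O(S_q^{2n+1})` exchanging `z_i` and `z_i^*`. -/
instance : StarRing (QSphere n q) where
  star a := ConjOp.unop (starHom a)
  star_involutive a := by
    induction a using induction with
    | hc c => simp [starHom]
    | hz i => simp [starHom]
    | hzs i => simp [starHom]
    | hmul a b ha hb => simp only [map_mul, ConjOp.unop_mul, ha, hb]
    | hadd a b ha hb => simp only [map_add, ConjOp.unop_add, ha, hb]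
  star_mul a b := by simp
  star_add a b := by simp

theorem star_def (a : QSphere n q) : star a = ConjOp.unop (starHom a) := rfl

instance : StarModule ℂ (QSphere n q) where
  star_smul c a := by simp [star_def, ConjOp.unop_smul]

@[simp] theorem star_z (i : Fin (n + 1)) : star (z i : QSphere n q) = zs i := by
  simp [star_def, starHom]

@[simp] theorem star_zs (i : Fin (n + 1)) : star (zs i : QSphere n q) = z i := by
  simp [star_def, starHom]

/-- A `*`-homomorphism out of `O(S_q^{2n+1})` from its values on generators. -/
def starLift {B : Type*} [Ring B] [Algebra ℂ B] [StarRing B] [StarModule ℂ B]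
    (Z : Fin (n + 1) → B) (h : SphereRels q Z (fun i => star (Z i))) :
    QSphere n q →⋆ₐ[ℂ] B where
  toAlgHom := lift Z (fun i => star (Z i)) h
  map_star' a := by
    change lift Z (fun i => star (Z i)) h (star a) = star (lift Z (fun i => star (Z i)) h a)
    induction a using induction with
    | hc c =>
      rw [← algebraMap_star_comm, AlgHom.commutes, AlgHom.commutes, algebraMap_star_comm]
    | hz i => simp
    | hzs i => simp
    | hmul a b ha hb => simp [ha, hb]
    | hadd a b ha hb => simp [ha, hb]

section starLift

variable {B : Type*} [Ring B] [Algebra ℂ B] [StarRing B] [StarModule ℂ B]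
  (Z : Fin (n + 1) → B) (h : SphereRels q Z (fun i => star (Z i)))

@[simp] theorem starLift_z (i : Fin (n + 1)) : starLift Z h (z i) = Z i :=
  lift_z Z _ h i

@[simp] theorem starLift_zs (i : Fin (n + 1)) : starLift Z h (zs i) = star (Z i) :=
  lift_zs Z _ h i

end starLift

/-! ### Weighted circle action and its invariants -/

variable (n q) in
theorem rels_action (ℓ : Fin (n + 1) → ℕ+) (t : Circle) : SphereRels (n := n) q
    (fun i => ((t : ℂ) ^ (ℓ i : ℕ)) • (z i : QSphere n q))
    (fun i => star (((t : ℂ) ^ (ℓ i : ℕ)) • (z i : QSphere n q))) where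
  z_z i j h := by
    simp only [smul_mul_smul_comm, rels.z_z i j h, smul_smul]
    ring_nf
  zs_zs i j h := by
    simp only [star_smul, star_z, smul_mul_smul_comm, rels.zs_zs i j h, smul_smul]
    ring_nf
  zs_z i j h := by
    simp only [star_smul, star_z, smul_mul_smul_comm, rels.zs_z i j h, smul_smul]
    ring_nf
  comm i := by
    have key : ∀ j, (t : ℂ) ^ (ℓ j : ℕ) * star ((t : ℂ) ^ (ℓ j : ℕ)) = 1 := by
      intro j
      rw [star_pow, ← mul_pow]
      simp [Complex.mul_conj]
    have key' : ∀ j, star ((t : ℂ) ^ (ℓ j : ℕ)) * (t : ℂ) ^ (ℓ j : ℕ) = 1 := by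
      intro j
      rw [mul_comm, key]
    simp only [star_smul, star_z, smul_mul_smul_comm, key, key', one_smul, rels.comm i]
  sphere := by
    have key : ∀ j, (t : ℂ) ^ (ℓ j : ℕ) * star ((t : ℂ) ^ (ℓ j : ℕ)) = 1 := by
      intro j
      rw [star_pow, ← mul_pow]
      simp [Complex.mul_conj]
    simp only [star_smul, star_z, smul_mul_smul_comm, key, one_smul, rels.sphere]

/-- The action of `U(1)` by `*`-endomorphisms with `z_i ↦ t ^ ℓ_i z_i`. -/
def action (ℓ : Fin (n + 1) → ℕ+) (t : Circle) : QSphere n q →⋆ₐ[ℂ] QSphere n q :=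
  starLift (fun i => ((t : ℂ) ^ (ℓ i : ℕ)) • z i) (rels_action n q ℓ t)

/-- The `*`-subalgebra of elements that are invariant under a set `T` of elements of `U(1)`. -/
def invariants (ℓ : Fin (n + 1) → ℕ+) (T : Set Circle) : StarSubalgebra ℂ (QSphere n q) where
  carrier := {a | ∀ t ∈ T, action ℓ t a = a}
  mul_mem' ha hb t ht := by rw [map_mul, ha t ht, hb t ht]
  add_mem' ha hb t ht := by rw [map_add, ha t ht, hb t ht]
  algebraMap_mem' c t _ := by rw [AlgHomClass.commutes]
  star_mem' ha t ht := by rw [map_star, ha t ht]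

end QSphere

/-- The coordinate algebra of the quantum weighted projective space with weights `ℓ`. -/
def QProj {n : ℕ} (q : ℝ) (ℓ : Fin (n + 1) → ℕ+) : StarSubalgebra ℂ (QSphere n q) :=
  QSphere.invariants ℓ Set.univ

/-- The coordinate algebra of the quantum lens space `L_q(N; ℓ)`. -/
def QLens {n : ℕ} (q : ℝ) (N : ℕ) (ℓ : Fin (n + 1) → ℕ+) : StarSubalgebra ℂ (QSphere n q) :=
  QSphere.invariants ℓ {t | t ^ N = 1}

theorem QProj_le_QLens {n : ℕ} (q : ℝ) (N : ℕ) (ℓ : Fin (n + 1) → ℕ+) :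
    QProj q ℓ ≤ QLens q N ℓ :=
  fun _ ha t _ => ha t (Set.mem_univ t)

/-- The weight vector whose `i`-th component is the product of the `p_j` with `j ≠ i`. -/
def sharp {n : ℕ} (p : Fin (n + 1) → ℕ+) : Fin (n + 1) → ℕ+ :=
  fun i => ∏ j ∈ Finset.univ.erase i, p j

/-! ### Weighted composition operators on `ℓ²(I)` -/

/-- The Hilbert space `ℓ²(I)`. -/
abbrev L2 (I : Type) : Type := lp (fun _ : I => ℂ) 2

/-- The basis vector `|i⟩` of `ℓ²(I)`. -/
def ket {I : Type} (i : I) : L2 I := by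
  classical exact lp.single 2 i (1 : ℂ)

section wcomp

variable {I : Type}

open Classical in
theorem ket_apply (i j : I) : ket i j = if j = i then (1 : ℂ) else 0 := by
  rw [ket, lp.single_apply, Pi.single_apply]

theorem ext_ket {T S : L2 I →L[ℂ] L2 I} (h : ∀ i, T (ket i) = S (ket i)) : T = S := by
  classical
  refine lp.ext_continuousLinearMap (by norm_num) fun i => ?_
  ext1
  simpa [ket] using! h i

theorem inner_ket_left (i : I) (v : L2 I) : ⟪ket i, v⟫_ℂ = v i := by
  classical
  simp [ket, lp.inner_single_left]

theorem inner_ket_right (i : I) (v : L2 I) : ⟪v, ket i⟫_ℂ = conj (v i) := by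
  rw [← inner_conj_symm, inner_ket_left]

/-- Bounded operators on `ℓ²(I)`. -/
abbrev Op (I : Type) : Type := L2 I →L[ℂ] L2 I

theorem mul_ap (T S : Op I) (v : L2 I) (i : I) : (T * S) v i = T (S v) i := rfl

theorem smul_ap (c : ℂ) (T : Op I) (v : L2 I) (i : I) : (c • T) v i = c * T v i := rfl

theorem sub_ap (T S : Op I) (v : L2 I) (i : I) : (T - S) v i = T v i - S v i := rfl

theorem sum_ap {ι : Type*} (s : Finset ι) (T : ι → Op I) (v : L2 I) (i : I) :
    (∑ j ∈ s, T j) v i = ∑ j ∈ s, T j v i := by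
  classical
  induction s using Finset.induction_on with
  | empty => simp
  | insert a s ha ih => rw [Finset.sum_insert ha, Finset.sum_insert ha, ← ih]; rfl

/-- Conditions under which `v ↦ (i ↦ c i * v (f i))` is a contraction of `ℓ²(I)`. -/
structure IsWeight (f : I → I) (c : I → ℂ) : Prop where
  norm_le : ∀ i, ‖c i‖ ≤ 1
  inj : Set.InjOn f (Function.support c)

theorem IsWeight.sum_le {f : I → I} {c : I → ℂ} (h : IsWeight f c) (v : L2 I) (s : Finset I) :
    ∑ i ∈ s, ‖c i * v (f i)‖ ^ (2 : ℝ≥0∞).toReal ≤ ‖v‖ ^ (2 : ℝ≥0∞).toReal := by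
  classical
  set s' := s.filter fun i => c i ≠ 0 with hs'
  have hinj : Set.InjOn f s' := fun i hi j hj => h.inj (by simpa [hs'] using (Finset.mem_filter.1 hi).2)
    (by simpa [hs'] using (Finset.mem_filter.1 hj).2)
  calc ∑ i ∈ s, ‖c i * v (f i)‖ ^ (2 : ℝ≥0∞).toReal
      = ∑ i ∈ s', ‖c i * v (f i)‖ ^ (2 : ℝ≥0∞).toReal := by
        rw [hs', Finset.sum_filter]
        refine Finset.sum_congr rfl fun i _ => ?_
        split_ifs with hc
        · rfl
        · simp only [ne_eq, not_not] at hc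
          simp [hc]
    _ ≤ ∑ i ∈ s', ‖v (f i)‖ ^ (2 : ℝ≥0∞).toReal := by
        refine Finset.sum_le_sum fun i _ => ?_
        refine Real.rpow_le_rpow (norm_nonneg _) ?_ (by norm_num)
        rw [norm_mul]
        exact mul_le_of_le_one_left (norm_nonneg _) (h.norm_le i)
    _ = ∑ j ∈ s'.image f, ‖v j‖ ^ (2 : ℝ≥0∞).toReal :=
        (Finset.sum_image (f := fun j => ‖v j‖ ^ (2 : ℝ≥0∞).toReal) hinj).symm
    _ ≤ _ := lp.sum_rpow_le_norm_rpow (by norm_num) v _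

/-- The operator `v ↦ (i ↦ c i * v (f i))` on `ℓ²(I)`. -/
def wcomp (f : I → I) (c : I → ℂ) (h : IsWeight f c) : L2 I →L[ℂ] L2 I :=
  LinearMap.mkContinuous
    { toFun := fun v => ⟨fun i => c i * v (f i), memℓp_gen' (h.sum_le v)⟩
      map_add' := fun v w => by ext i; exact mul_add (c i) (v (f i)) (w (f i))
      map_smul' := fun a v => by ext i; simp [mul_left_comm] } 1 fun v => by
    rw [one_mul]
    exact lp.norm_le_of_forall_sum_le (by norm_num) (norm_nonneg _) (h.sum_le v)

@[simp] theorem wcomp_apply (f : I → I) (c : I → ℂ) (h : IsWeight f c) (v : L2 I) (i : I) :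
    wcomp f c h v i = c i * v (f i) := rfl

open Classical in
theorem adjoint_wcomp_ket (f : I → I) (c : I → ℂ) (h : IsWeight f c) (i : I) :
    (wcomp f c h).adjoint (ket i) = conj (c i) • ket (f i) := by
  refine ext_inner_right ℂ fun v => ?_
  rw [ContinuousLinearMap.adjoint_inner_left, inner_ket_left, inner_smul_left, inner_ket_left]
  simp

/-- If `g` inverts `f` where the weights are nonzero, then the adjoint is the weighted composition
operator of `g`. -/
theorem adjoint_wcomp {f g : I → I} {c d : I → ℂ} (h : IsWeight f c) (h' : IsWeight g d)
    (h1 : ∀ i, c i ≠ 0 → g (f i) = i ∧ d (f i) = conj (c i))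
    (h2 : ∀ j, d j ≠ 0 → f (g j) = j ∧ c (g j) = conj (d j)) :
    (wcomp f c h).adjoint = wcomp g d h' := by
  classical
  refine ext_ket fun i => ?_
  rw [adjoint_wcomp_ket]
  ext j
  simp only [lp.coeFn_smul, Pi.smul_apply, smul_eq_mul, ket_apply, wcomp_apply]
  by_cases hj : j = f i
  · subst hj
    by_cases hc : c i = 0
    · simp only [hc, map_zero, zero_mul]
      by_cases hd : d (f i) = 0
      · simp [hd]
      · obtain ⟨h3, h4⟩ := h2 _ hd
        have : g (f i) ≠ i := by
          intro h5
          rw [h5, hc] at h4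
          exact hd (by simpa using h4.symm)
        simp [this]
    · obtain ⟨h3, h4⟩ := h1 _ hc
      simp [h3, h4]
  · by_cases hd : d j = 0
    · simp [hj, hd]
    · have : g j ≠ i := by
        intro h5
        exact hj (by rw [← h5, (h2 _ hd).1])
      simp [hj, this]

end wcomp

/-! ### Representations of the quantum sphere on `ℓ²(ℕⁿ)`

A multi-index `κ = (κ_1, …, κ_n)` is a function on `Fin n`, with `κ_{j+1}` the value at `j`. -/

section sphereRep

variable {n : ℕ}

/-- `coord κ j = κ_{j+1}`. -/
def coord (κ : Fin n → ℕ) (j : ℕ) : ℕ := if h : j < n then κ ⟨j, h⟩ else 0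

/-- `psum κ i = κ_1 + ⋯ + κ_i`. -/
def psum (κ : Fin n → ℕ) (i : ℕ) : ℕ := ∑ j ∈ Finset.range i, coord κ j

/-- For `i < k`, subtract one from `κ_{i+1}` (this is only used if `κ_{i+1} ≠ 0`). -/
def down (k i : ℕ) (κ : Fin n → ℕ) : Fin n → ℕ :=
  fun j => if i < k ∧ j.val = i then κ j - 1 else κ j

/-- For `i < k`, add one to `κ_{i+1}`. -/
def up (k i : ℕ) (κ : Fin n → ℕ) : Fin n → ℕ :=
  fun j => if i < k ∧ j.val = i then κ j + 1 else κ j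

/-- Weights of the operators representing `z_i` on `ℓ²(ℕᵏ)`, indexed by the target. -/
def wt (q : ℝ) (k i : ℕ) (κ : Fin n → ℕ) : ℝ :=
  if i < k then q ^ psum κ i * √(1 - q ^ (2 * coord κ i))
  else if i = k then q ^ psum κ k else 0

theorem coord_down {k i : ℕ} (κ : Fin n → ℕ) (j : ℕ) :
    coord (down k i κ) j = if i < k ∧ j = i then coord κ j - 1 else coord κ j := by
  unfold coord down
  split_ifs <;> simp

theorem coord_up {k i : ℕ} (hk : k ≤ n) (κ : Fin n → ℕ) (j : ℕ) :
    coord (up k i κ) j = if i < k ∧ j = i then coord κ j + 1 else coord κ j := by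
  unfold coord up
  split_ifs <;> first | rfl | omega

theorem psum_succ (κ : Fin n → ℕ) (i : ℕ) : psum κ (i + 1) = psum κ i + coord κ i :=
  Finset.sum_range_succ _ _

theorem psum_down_of_le {k i j : ℕ} (κ : Fin n → ℕ) (h : j ≤ i) :
    psum (down k i κ) j = psum κ j := by
  refine Finset.sum_congr rfl fun l hl => ?_
  rw [Finset.mem_range] at hl
  rw [coord_down, if_neg (by omega)]

theorem psum_down_of_lt {k i j : ℕ} (κ : Fin n → ℕ) (h : i < j) (hk : i < k)
    (h0 : coord κ i ≠ 0) : psum κ j = psum (down k i κ) j + 1 := by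
  induction j with
  | zero => omega
  | succ j ih =>
    rw [psum_succ, psum_succ, coord_down]
    rcases Nat.lt_succ_iff_lt_or_eq.1 h with h | rfl
    · rw [ih h, if_neg (by omega)]; omega
    · rw [psum_down_of_le κ le_rfl, if_pos ⟨hk, rfl⟩]; omega

theorem psum_up_of_le {k i j : ℕ} (hk : k ≤ n) (κ : Fin n → ℕ) (h : j ≤ i) :
    psum (up k i κ) j = psum κ j := by
  refine Finset.sum_congr rfl fun l hl => ?_
  rw [Finset.mem_range] at hl
  rw [coord_up hk, if_neg (by omega)]

theorem psum_up_of_lt {k i j : ℕ} (hk : k ≤ n) (κ : Fin n → ℕ) (h : i < j) (hi : i < k) :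
    psum (up k i κ) j = psum κ j + 1 := by
  induction j with
  | zero => omega
  | succ j ih =>
    rw [psum_succ, psum_succ, coord_up hk]
    rcases Nat.lt_succ_iff_lt_or_eq.1 h with h | rfl
    · rw [ih h, if_neg (by omega)]; omega
    · rw [psum_up_of_le hk κ le_rfl, if_pos ⟨hi, rfl⟩]; omega

theorem wt_ne_zero {q : ℝ} {k i : ℕ} {κ : Fin n → ℕ} (hi : i < k) (h : wt q k i κ ≠ 0) :
    coord κ i ≠ 0 := by
  intro h0
  rw [wt, if_pos hi, h0] at h
  simp at h

theorem down_up {k i : ℕ} (κ : Fin n → ℕ) : down k i (up k i κ) = κ := by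
  funext j
  simp only [down, up]
  split_ifs <;> omega

theorem up_down {k i : ℕ} (κ : Fin n → ℕ) (h : i < k → coord κ i ≠ 0) :
    up k i (down k i κ) = κ := by
  funext j
  simp only [down, up]
  split_ifs with h1
  · have := h h1.1
    obtain ⟨_, rfl⟩ := h1
    rw [coord, dif_pos j.isLt] at this
    simp only [Fin.eta] at this
    omega
  · rfl

theorem up_down_comm {k i j : ℕ} (h : i ≠ j) (κ : Fin n → ℕ) :
    up k i (down k j κ) = down k j (up k i κ) := by
  funext l
  simp only [down, up]
  split_ifs <;> omega

theorem down_down_comm {k i j : ℕ} (κ : Fin n → ℕ) :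
    down k i (down k j κ) = down k j (down k i κ) := by
  funext l
  simp only [down]
  split_ifs <;> omega

theorem up_up_comm {k i j : ℕ} (κ : Fin n → ℕ) :
    up k i (up k j κ) = up k j (up k i κ) := by
  funext l
  simp only [up]
  split_ifs <;> omega

variable {q : ℝ}

theorem wt_down_of_lt {k i j : ℕ} (κ : Fin n → ℕ) (h : i < j) :
    wt q k i (down k j κ) = wt q k i κ := by
  unfold wt
  rw [psum_down_of_le κ h.le, coord_down, if_neg (by omega : ¬ (j < k ∧ i = j))]
  split_ifs with h1 h2
  · rfl
  · rw [psum_down_of_le κ (by omega)]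
  · rfl

theorem wt_up_of_lt {k i j : ℕ} (hk : k ≤ n) (κ : Fin n → ℕ) (h : i < j) :
    wt q k i (up k j κ) = wt q k i κ := by
  unfold wt
  rw [psum_up_of_le hk κ h.le, coord_up hk, if_neg (by omega : ¬ (j < k ∧ i = j))]
  split_ifs with h1 h2
  · rfl
  · rw [psum_up_of_le hk κ (by omega)]
  · rfl

theorem wt_eq_down {k i j : ℕ} (κ : Fin n → ℕ) (h : i < j) (hi : i < k)
    (h0 : coord κ i ≠ 0) : wt q k j κ = q * wt q k j (down k i κ) := by
  unfold wt
  rw [psum_down_of_lt κ h hi h0, coord_down, if_neg (by omega : ¬ (i < k ∧ j = i))]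
  split_ifs with h1 h2
  · ring
  · rw [psum_down_of_lt κ hi hi h0]; ring
  · ring

theorem wt_up_eq {k i j : ℕ} (hk : k ≤ n) (κ : Fin n → ℕ) (h : i < j) (hi : i < k) :
    wt q k j (up k i κ) = q * wt q k j κ := by
  unfold wt
  rw [psum_up_of_lt hk κ h hi, coord_up hk, if_neg (by omega : ¬ (i < k ∧ j = i))]
  split_ifs with h1 h2
  · ring
  · rw [psum_up_of_lt hk κ hi hi]; ring
  · ring

theorem wt_of_gt {k i : ℕ} (κ : Fin n → ℕ) (h : k < i) : wt q k i κ = 0 := by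
  unfold wt
  rw [if_neg (by omega), if_neg (by omega)]

theorem abs_wt_le (hq : q ∈ Set.Ioo (0 : ℝ) 1) (k i : ℕ) (κ : Fin n → ℕ) : |wt q k i κ| ≤ 1 := by
  have h0 : ∀ m, q ^ m ≤ 1 := fun m => pow_le_one₀ hq.1.le hq.2.le
  have h1 : ∀ m, 0 ≤ q ^ m := fun m => pow_nonneg hq.1.le m
  unfold wt
  split_ifs with h2 h3
  · rw [abs_of_nonneg (mul_nonneg (h1 _) (Real.sqrt_nonneg _))]
    refine mul_le_one₀ (h0 _) (Real.sqrt_nonneg _) ?_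
    refine Real.sqrt_le_one.2 ?_
    linarith [h1 (2 * coord κ i)]
  · rw [abs_of_nonneg (h1 _)]
    exact h0 _
  · simp

/-- The squares of the weights are the differences of this sequence. -/
def tel (q : ℝ) (k : ℕ) (κ : Fin n → ℕ) (i : ℕ) : ℝ := if i ≤ k then q ^ (2 * psum κ i) else 0

theorem wt_sq (hq : q ∈ Set.Ioo (0 : ℝ) 1) (k i : ℕ) (κ : Fin n → ℕ) :
    wt q k i κ ^ 2 = tel q k κ i - tel q k κ (i + 1) := by
  unfold wt tel
  rcases lt_trichotomy i k with h | rfl | h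
  · rw [if_pos h, if_pos h.le, if_pos (by omega : i + 1 ≤ k), mul_pow, Real.sq_sqrt, psum_succ]
    · ring
    · linarith [pow_le_one₀ (n := 2 * coord κ i) hq.1.le hq.2.le]
  · simp [← pow_mul, mul_comm]
  · rw [if_neg (by omega), if_neg (by omega), if_neg (by omega), if_neg (by omega)]
    simp

theorem sum_wt_sq (hq : q ∈ Set.Ioo (0 : ℝ) 1) {k : ℕ} (hk : k ≤ n) (κ : Fin n → ℕ)
    (i : Fin (n + 1)) :
    ∑ j ∈ Finset.Ici i, wt q k j κ ^ 2 = tel q k κ i := by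
  have h1 : ∑ j ∈ Finset.Ici i, wt q k j κ ^ 2
      = ∑ j ∈ Finset.Ico i.val (n + 1), wt q k j κ ^ 2 := by
    rw [← Fin.map_valEmbedding_Ici, Finset.sum_map]
    rfl
  rw [h1, Finset.sum_congr rfl fun j _ => wt_sq hq k j κ,
    Finset.sum_Ico_eq_sub _ i.isLt.le, Finset.sum_range_sub', Finset.sum_range_sub']
  have : tel q k κ (n + 1) = 0 := if_neg (by omega)
  rw [this]
  ring

theorem isWeight_down (hq : q ∈ Set.Ioo (0 : ℝ) 1) (k i : ℕ) :
    IsWeight (I := Fin n → ℕ) (down k i) (fun κ => (wt q k i κ : ℂ)) where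
  norm_le κ := by simpa using abs_wt_le hq k i κ
  inj κ hκ κ' hκ' h := by
    simp only [Function.mem_support, ne_eq, Complex.ofReal_eq_zero] at hκ hκ'
    rw [← up_down κ fun hi => wt_ne_zero hi hκ, ← up_down κ' fun hi => wt_ne_zero hi hκ', h]

theorem isWeight_up (hq : q ∈ Set.Ioo (0 : ℝ) 1) (k i : ℕ) :
    IsWeight (I := Fin n → ℕ) (up k i) (fun κ => (wt q k i (up k i κ) : ℂ)) where
  norm_le κ := by simpa using abs_wt_le hq k i _
  inj κ _ κ' _ h := by rw [← down_up (k := k) (i := i) κ, h, down_up]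

/-- The operator on `ℓ²(ℕⁿ)` representing `z_i` in the representation of the quantum sphere of
dimension `2k+1`, acting on the first `k` indices. See `opZ_ket_lt`, `opZ_ket_eq`, `opZ_of_gt`. -/
def opZ (hq : q ∈ Set.Ioo (0 : ℝ) 1) (k i : ℕ) : Op (Fin n → ℕ) :=
  wcomp (down k i) (fun κ => (wt q k i κ : ℂ)) (isWeight_down hq k i)

theorem star_opZ (hq : q ∈ Set.Ioo (0 : ℝ) 1) (k i : ℕ) :
    star (opZ hq k i : Op (Fin n → ℕ)) =
      wcomp (up k i) (fun κ => (wt q k i (up k i κ) : ℂ)) (isWeight_up hq k i) := by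
  rw [ContinuousLinearMap.star_eq_adjoint]
  refine adjoint_wcomp _ _ (fun κ hκ => ?_) (fun κ _ => ?_)
  · have : up k i (down k i κ) = κ := up_down κ fun hi => wt_ne_zero hi (by simpa using hκ)
    simp [this]
  · simp [down_up]

theorem opZ_mul_star_apply (hq : q ∈ Set.Ioo (0 : ℝ) 1) (k i : ℕ) (v : L2 (Fin n → ℕ))
    (κ : Fin n → ℕ) :
    (opZ hq k i * star (opZ hq k i) : Op (Fin n → ℕ)) v κ = ((wt q k i κ ^ 2 : ℝ) : ℂ) * v κ := by
  rw [star_opZ]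
  simp only [opZ, mul_ap, wcomp_apply]
  by_cases h : wt q k i κ = 0
  · simp [h]
  · rw [up_down κ fun hi => wt_ne_zero hi h]
    push_cast
    ring

theorem star_mul_opZ_apply (hq : q ∈ Set.Ioo (0 : ℝ) 1) (k i : ℕ) (v : L2 (Fin n → ℕ))
    (κ : Fin n → ℕ) :
    (star (opZ hq k i) * opZ hq k i : Op (Fin n → ℕ)) v κ = ((wt q k i (up k i κ) ^ 2 : ℝ) : ℂ) * v κ := by
  rw [star_opZ]
  simp only [opZ, mul_ap, wcomp_apply, down_up]
  push_cast
  ring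

theorem opZ_z_z (hq : q ∈ Set.Ioo (0 : ℝ) 1) {k i j : ℕ} (hij : i < j) :
    (opZ hq k i * opZ hq k j : Op (Fin n → ℕ)) =
      ((q : ℂ)⁻¹) • (opZ hq k j * opZ hq k i) := by
  have hq0 : (q : ℂ) ≠ 0 := by simpa using hq.1.ne'
  ext v κ
  simp only [opZ, mul_ap, smul_ap, wcomp_apply]
  rw [down_down_comm, wt_down_of_lt κ hij]
  by_cases hi : i < k
  · by_cases h0 : wt q k i κ = 0
    · simp [h0]
    · rw [wt_eq_down (q := q) κ hij hi (wt_ne_zero hi h0)]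
      push_cast
      field_simp
  · rw [wt_of_gt κ (by omega : k < j), wt_of_gt _ (by omega : k < j)]
    simp

theorem opZ_zs_z (hq : q ∈ Set.Ioo (0 : ℝ) 1) {k i j : ℕ} (hk : k ≤ n) (hij : i ≠ j) :
    (star (opZ hq k i) * opZ hq k j : Op (Fin n → ℕ)) =
      (q : ℂ) • (opZ hq k j * star (opZ hq k i)) := by
  rw [star_opZ]
  ext v κ
  simp only [opZ, mul_ap, smul_ap, wcomp_apply]
  rw [up_down_comm hij]
  rcases lt_or_gt_of_ne hij with h | h
  · rw [wt_down_of_lt _ h]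
    by_cases hi : i < k
    · rw [wt_up_eq hk κ h hi]
      push_cast
      ring
    · rw [wt_of_gt κ (by omega : k < j), wt_of_gt _ (by omega : k < j)]
      simp
  · rw [wt_up_of_lt hk κ h]
    by_cases hj : j < k
    · by_cases h0 : wt q k j κ = 0
      · simp [h0]
      · have h1 : coord (up k i κ) j ≠ 0 := by
          rw [coord_up hk, if_neg (by omega)]
          exact wt_ne_zero hj h0
        rw [wt_eq_down (q := q) (up k i κ) h hj h1]
        push_cast
        ring
    · rw [wt_of_gt _ (by omega : k < i), wt_of_gt _ (by omega : k < i)]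
      simp

theorem sum_opZ_apply (hq : q ∈ Set.Ioo (0 : ℝ) 1) {k : ℕ} (s : Finset (Fin (n + 1)))
    (v : L2 (Fin n → ℕ)) (κ : Fin n → ℕ) :
    (∑ j ∈ s, opZ hq k j * star (opZ hq k j) : Op (Fin n → ℕ)) v κ
      = ((∑ j ∈ s, wt q k j κ ^ 2 : ℝ) : ℂ) * v κ := by
  rw [sum_ap, Finset.sum_congr rfl fun (j : Fin (n + 1)) _ => opZ_mul_star_apply hq k j v κ, ← Finset.sum_mul]
  push_cast
  rfl

theorem rels_opZ (hq : q ∈ Set.Ioo (0 : ℝ) 1) {k : ℕ} (hk : k ≤ n) :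
    SphereRels q (fun i : Fin (n + 1) => (opZ hq k i : Op (Fin n → ℕ)))
      (fun i => star (opZ hq k i)) where
  z_z i j h := opZ_z_z hq h
  zs_zs i j h := by
    have := congrArg star (opZ_z_z (n := n) hq (k := k) (show i.val < j.val from h))
    simpa using this
  zs_z i j h := opZ_zs_z hq hk fun h' => h (Fin.ext h')
  comm i := by
    ext v κ
    rw [sub_ap, opZ_mul_star_apply, star_mul_opZ_apply, smul_ap, sum_opZ_apply]
    have h1 : ∑ j ∈ Finset.Ioi i, wt q k j κ ^ 2 = tel q k κ (i + 1) := by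
      have h2 := sum_wt_sq hq hk κ i
      rw [← Finset.add_sum_Ioi_eq_sum_Ici, wt_sq hq k i κ] at h2
      linarith
    rw [h1, wt_sq hq, wt_sq hq]
    have h3 : tel q k (up k i κ) i = tel q k κ i := by
      unfold tel
      rw [psum_up_of_le hk κ le_rfl]
    have h4 : tel q k (up k i κ) (i + 1) = q ^ 2 * tel q k κ (i + 1) := by
      unfold tel
      split_ifs with h5
      · rw [psum_up_of_lt hk κ (Nat.lt_succ_self _) (by omega)]
        ring
      · ring
    rw [h3, h4]
    push_cast
    ring
  sphere := by
    ext v κ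
    rw [sum_opZ_apply]
    have h2 := sum_wt_sq hq hk κ 0
    have h3 : Finset.Ici (0 : Fin (n + 1)) = Finset.univ := by ext; simp
    rw [h3] at h2
    rw [h2]
    simp [tel, psum]

/-- The representation on `ℓ²(ℕⁿ)` of `O(S_q^{2n+1})` by the operators `opZ`. It is the pullback
of the representation of `O(S_q^{2k+1})` acting on the first `k` indices. -/
def sphereRep (hq : q ∈ Set.Ioo (0 : ℝ) 1) (k : Fin (n + 1)) :
    QSphere n q →⋆ₐ[ℂ] (Op (Fin n → ℕ)) :=
  QSphere.starLift (fun i => opZ hq k i) (rels_opZ hq (Nat.lt_succ_iff.1 k.isLt))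

theorem opZ_of_gt (hq : q ∈ Set.Ioo (0 : ℝ) 1) {k i : ℕ} (h : k < i) :
    (opZ hq k i : Op (Fin n → ℕ)) = 0 := by
  ext v κ
  simp [opZ, wt_of_gt κ h]

theorem opZ_ket (hq : q ∈ Set.Ioo (0 : ℝ) 1) (k i : ℕ) (κ : Fin n → ℕ) :
    opZ hq k i (ket κ) = (wt q k i (up k i κ) : ℂ) • ket (up k i κ) := by
  have := adjoint_wcomp_ket _ _ (isWeight_up (n := n) hq k i) κ
  rw [← star_opZ, ContinuousLinearMap.star_eq_adjoint, ContinuousLinearMap.adjoint_adjoint,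
    Complex.conj_ofReal] at this
  exact this

theorem opZ_ket_lt (hq : q ∈ Set.Ioo (0 : ℝ) 1) {k i : ℕ} (hk : k ≤ n) (h : i < k)
    (κ : Fin n → ℕ) :
    opZ hq k i (ket κ) =
      ((q ^ psum κ i * √(1 - q ^ (2 * (coord κ i + 1))) : ℝ) : ℂ) • ket (up k i κ) := by
  rw [opZ_ket, wt, if_pos h, psum_up_of_le hk κ le_rfl, coord_up hk, if_pos ⟨h, rfl⟩]

theorem opZ_ket_eq (hq : q ∈ Set.Ioo (0 : ℝ) 1) (k : ℕ) (κ : Fin n → ℕ) :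
    opZ hq k k (ket κ) = ((q ^ psum κ k : ℝ) : ℂ) • ket κ := by
  have : up k k κ = κ := by funext j; simp [up]
  rw [opZ_ket, this, wt, if_neg (lt_irrefl k), if_pos rfl]

end sphereRep

/-! ### The representations `π_k` of the lens space algebra -/

section piK

variable {n : ℕ}

/-- The condition `m_1 ≤ ⋯ ≤ m_k` and `m_{k+1} > ⋯ > m_n`: the basis vectors `|m⟩` satisfying it
span the subspace `V_k`. -/
def InV (k : ℕ) (m : Fin n → ℕ) : Prop :=
  (∀ i j : Fin n, i ≤ j → j.val < k → m i ≤ m j) ∧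
    ∀ i j : Fin n, k ≤ i.val → i < j → m j < m i

/-- `prev m j = m_j`, with `m_0 = 0`; recall that `m_{j+1}` is the value at `j`. -/
def prev (m : Fin n → ℕ) (j : ℕ) : ℕ := if j = 0 then 0 else coord m (j - 1)

variable (p : Fin (n + 1) → ℕ+) (r : ∀ i : Fin n, Fin (p i.castSucc))

/-- The relabelling `κ_{j+1} = p_j (m_{j+1} - m_j) + r_j` for `j < k`, and `κ_{j+1} = m_{j+1}`
otherwise. It is only used if `InV k m` holds, so that the differences are nonnegative. -/
def relabel (k : ℕ) (m : Fin n → ℕ) : Fin n → ℕ :=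
  fun j => if j.val < k then p j.castSucc * (m j - prev m j) + r j else m j

theorem prev_le {k : ℕ} {m : Fin n → ℕ} (hm : InV k m) {j : Fin n} (hj : j.val < k) :
    prev m j ≤ m j := by
  unfold prev
  split_ifs with h
  · exact Nat.zero_le _
  · rw [coord, dif_pos (by omega)]
    exact hm.1 _ _ (by rw [Fin.le_def]; simp) hj

theorem relabel_injOn (k : ℕ) {m m' : Fin n → ℕ} (hm : InV k m) (hm' : InV k m')
    (h : relabel p r k m = relabel p r k m') : m = m' := by
  have key : ∀ N : ℕ, ∀ j : Fin n, j.val < N → m j = m' j := by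
    intro N
    induction N with
    | zero => intro j hj; omega
    | succ N ih =>
      intro j hj
      have hj' := congrFun h j
      unfold relabel at hj'
      split_ifs at hj' with hk
      · have h1 : prev m j = prev m' j := by
          unfold prev
          split_ifs with h0
          · rfl
          · rw [coord, coord, dif_pos (by omega), dif_pos (by omega)]
            exact ih _ (by simp only; omega)
        have h2 := prev_le hm hk
        have h3 := prev_le hm' hk
        have h4 : m j - prev m j = m' j - prev m' j :=
          Nat.eq_of_mul_eq_mul_left (p j.castSucc).pos (by omega)
        omega
      · exact hj'
  funext j
  exact key n j j.isLt

/-- The multi-indices obtained by relabelling. -/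
theorem exists_relabel {k : ℕ} {κ : Fin n → ℕ}
    (h1 : ∀ j : Fin n, j.val < k → κ j % p j.castSucc = r j)
    (h2 : ∀ i j : Fin n, k ≤ i.val → i < j → κ j < κ i) :
    ∃ m, InV k m ∧ relabel p r k m = κ := by
  let f : Fin n → ℕ := fun l => κ l / p l.castSucc
  let m : Fin n → ℕ := fun j => if j.val < k then ∑ l ∈ Finset.Iic j, f l else κ j
  have hm1 : ∀ j : Fin n, j.val < k → m j = ∑ l ∈ Finset.Iic j, f l := fun j hj => if_pos hj
  have hm2 : ∀ j : Fin n, ¬ j.val < k → m j = κ j := fun j hj => if_neg hj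
  refine ⟨m, ⟨fun i j hij hj => ?_, fun i j hi hij => ?_⟩, ?_⟩
  · rw [hm1 i (lt_of_le_of_lt hij hj), hm1 j hj]
    exact Finset.sum_le_sum_of_subset (Finset.Iic_subset_Iic.2 hij)
  · have : i.val < j.val := hij
    rw [hm2 i (by omega), hm2 j (by omega)]
    exact h2 i j hi hij
  · funext j
    unfold relabel
    split_ifs with hj
    · have h3 : m j = f j + ∑ l ∈ Finset.Iio j, f l := by
        rw [hm1 j hj, ← Finset.Iio_insert, Finset.sum_insert (by simp)]
      have h4 : prev m j = ∑ l ∈ Finset.Iio j, f l := by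
        unfold prev
        split_ifs with h0
        · rw [eq_comm]
          refine Finset.sum_eq_zero fun l hl => ?_
          have : l.val < j.val := by simpa using hl
          omega
        · rw [coord, dif_pos (by omega), hm1 _ (by simp only; omega)]
          refine Finset.sum_congr ?_ fun _ _ => rfl
          ext l
          simp only [Finset.mem_Iic, Finset.mem_Iio, Fin.le_def, Fin.lt_def]
          omega
      rw [h3, h4, Nat.add_sub_cancel, ← h1 j hj]
      exact Nat.div_add_mod _ _
    · exact hm2 j hj

theorem relabel_mod {k : ℕ} (m : Fin n → ℕ) (j : Fin n) (hj : j.val < k) :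
    relabel p r k m j % p j.castSucc = r j := by
  rw [relabel, if_pos hj, Nat.mul_add_mod]
  exact Nat.mod_eq_of_lt (r j).isLt

open Classical in
/-- The indicator function of `InV k`. -/
def indV (k : ℕ) (m : Fin n → ℕ) : ℂ := if InV k m then 1 else 0

theorem isWeight_relabel (k : ℕ) : IsWeight (relabel p r k) (indV k) where
  norm_le m := by
    unfold indV
    split_ifs <;> simp
  inj m hm m' hm' h := by
    simp only [Function.mem_support, indV, ne_eq, ite_eq_right_iff, one_ne_zero, imp_false,
      not_not] at hm hm'
    exact relabel_injOn p r k hm hm' h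

/-- The partial isometry whose adjoint maps `|m⟩` to `|relabel m⟩` if `InV k m` holds, and to zero
otherwise. -/
def opR (k : ℕ) : Op (Fin n → ℕ) := wcomp (relabel p r k) (indV k) (isWeight_relabel p r k)

theorem star_opR_ket {k : ℕ} {m : Fin n → ℕ} (hm : InV k m) :
    star (opR p r k) (ket m) = ket (relabel p r k m) := by
  rw [ContinuousLinearMap.star_eq_adjoint, opR, adjoint_wcomp_ket]
  simp [indV, hm]

theorem star_opR_ket_of_not {k : ℕ} {m : Fin n → ℕ} (hm : ¬ InV k m) :
    star (opR p r k) (ket m) = 0 := by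
  rw [ContinuousLinearMap.star_eq_adjoint, opR, adjoint_wcomp_ket]
  simp [indV, hm]

theorem opR_ket {k : ℕ} {m : Fin n → ℕ} (hm : InV k m) :
    opR p r k (ket (relabel p r k m)) = ket m := by
  ext m'
  rw [opR, wcomp_apply, ket_apply, ket_apply, indV]
  by_cases h : m' = m
  · subst h; simp [hm]
  · by_cases h' : InV k m'
    · have : relabel p r k m' ≠ relabel p r k m := fun h'' => h (relabel_injOn p r k h' hm h'')
      simp [h, this]
    · simp [h, h']

theorem opR_ket_of_not {k : ℕ} {κ : Fin n → ℕ} (h : ∀ m, InV k m → relabel p r k m ≠ κ) :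
    opR p r k (ket κ) = 0 := by
  ext m'
  rw [opR, wcomp_apply, ket_apply, indV]
  by_cases h' : InV k m'
  · simp [h m' h']
  · simp [h']

theorem star_opR_opR {k : ℕ} {w : L2 (Fin n → ℕ)}
    (hw : ∀ κ, w κ ≠ 0 → ∃ m, InV k m ∧ relabel p r k m = κ) :
    star (opR p r k) (opR p r k w) = w := by
  ext κ
  rw [← inner_ket_left κ, ContinuousLinearMap.star_eq_adjoint,
    ContinuousLinearMap.adjoint_inner_right]
  by_cases h : ∃ m, InV k m ∧ relabel p r k m = κ
  · obtain ⟨m, hm, rfl⟩ := h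
    rw [opR_ket p r hm, inner_ket_left, opR, wcomp_apply, indV, if_pos hm, one_mul]
  · rw [opR_ket_of_not p r fun m hm hκ => h ⟨m, hm, hκ⟩, inner_zero_left]
    by_contra h0
    exact h (hw κ fun h1 => h0 h1.symm)

variable {q : ℝ}

theorem diag_comm (hq : q ∈ Set.Ioo (0 : ℝ) 1) (k : Fin (n + 1)) (ℓ : Fin (n + 1) → ℕ+)
    (s : Circle) (w : (Fin n → ℕ) → ℂ) (hw : IsWeight id w)
    (h : ∀ (i : Fin (n + 1)) (κ : Fin n → ℕ), wt q k i κ ≠ 0 →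
      w κ = (s : ℂ) ^ (ℓ i : ℕ) * w (down k i κ)) (a : QSphere n q) :
    wcomp id w hw * sphereRep hq k a = sphereRep hq k (QSphere.action ℓ s a) * wcomp id w hw := by
  have hk : k.val ≤ n := Nat.lt_succ_iff.1 k.isLt
  induction a using QSphere.induction with
  | hc c =>
    rw [AlgHomClass.commutes (QSphere.action ℓ s) c, AlgHomClass.commutes (sphereRep hq k) c]
    exact (Algebra.commutes c (wcomp id w hw)).symm
  | hz i =>
    rw [QSphere.action, QSphere.starLift_z, map_smul, sphereRep, QSphere.starLift_z]
    ext v κ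
    rw [smul_mul_assoc]
    simp only [opZ, mul_ap, smul_ap, wcomp_apply, id]
    by_cases h0 : wt q k i κ = 0
    · simp [h0]
    · rw [h i κ h0]
      ring
  | hzs i =>
    rw [QSphere.action, QSphere.starLift_zs, star_smul, QSphere.star_z, map_smul, sphereRep,
      QSphere.starLift_zs, star_opZ]
    ext v κ
    rw [smul_mul_assoc]
    simp only [mul_ap, smul_ap, wcomp_apply, id]
    by_cases h0 : wt q k i (up k i κ) = 0
    · simp [h0]
    · rw [h i _ h0, down_up]
      have : star ((s : ℂ) ^ (ℓ i : ℕ)) * (s : ℂ) ^ (ℓ i : ℕ) = 1 := by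
        rw [star_pow, ← mul_pow]
        have : star (s : ℂ) * s = 1 := by
          rw [mul_comm]
          simp [Complex.mul_conj]
        rw [this, one_pow]
      linear_combination (-(w κ) * (wt q k i (up k i κ) : ℂ) * v (up k i κ)) * this
  | hmul a b ha hb =>
    rw [map_mul, map_mul, map_mul, ← mul_assoc, ha, mul_assoc, hb, mul_assoc]
  | hadd a b ha hb =>
    rw [map_add, map_add, map_add, mul_add, add_mul, ha, hb]

theorem diag_support (hq : q ∈ Set.Ioo (0 : ℝ) 1) (k : Fin (n + 1)) (ℓ : Fin (n + 1) → ℕ+)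
    (s : Circle) (w : (Fin n → ℕ) → ℂ) (hw : IsWeight id w)
    (h : ∀ (i : Fin (n + 1)) (κ : Fin n → ℕ), wt q k i κ ≠ 0 →
      w κ = (s : ℂ) ^ (ℓ i : ℕ) * w (down k i κ)) {a : QSphere n q}
    (ha : QSphere.action ℓ s a = a) {κ κ' : Fin n → ℕ}
    (h0 : sphereRep hq k a (ket κ) κ' ≠ 0) : w κ' = w κ := by
  have h1 := diag_comm hq k ℓ s w hw h a
  rw [ha] at h1
  have h2 : wcomp id w hw (ket κ) = w κ • ket κ := by
    ext j
    change w j * ket κ j = w κ * ket κ j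
    rw [ket_apply]
    split_ifs with hj
    · rw [hj]
    · simp
  have h3 : (wcomp id w hw * sphereRep hq k a) (ket κ) κ'
      = (sphereRep hq k a * wcomp id w hw) (ket κ) κ' := by rw [h1]
  rw [mul_ap, mul_ap, h2, map_smul, wcomp_apply] at h3
  exact mul_right_cancel₀ h0 h3

theorem exists_circle_order (N : ℕ+) : ∃ s : Circle, orderOf s = N := by
  have h1 := Complex.isPrimitiveRoot_exp N N.ne_zero
  let s : Circle := ⟨_, mem_sphere_zero_iff_norm.2 (h1.norm'_eq_one N.ne_zero)⟩
  exact ⟨s, (orderOf_injective Circle.coeHom Circle.coe_injective s).symm.trans h1.eq_orderOf.symm⟩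

/-- Invariant elements of the quantum sphere preserve the classes of multi-indices modulo `p`. -/
theorem lens_support (hp : Pairwise fun i j => (p i).Coprime (p j))
    (hq : q ∈ Set.Ioo (0 : ℝ) 1) (k : Fin (n + 1)) {a : QSphere n q}
    (ha : a ∈ QLens q (∏ i, (p i : ℕ)) (sharp p)) {κ κ' : Fin n → ℕ}
    (h0 : sphereRep hq k a (ket κ) κ' ≠ 0) :
    (∀ j : Fin n, j.val < k → κ' j % p j.castSucc = κ j % p j.castSucc) ∧
      ∀ j : Fin n, k.val ≤ j → κ' j = κ j := by
  constructor
  · intro j hj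
    obtain ⟨s, hs⟩ := exists_circle_order (p j.castSucc)
    have hdvd : ∀ i, i ≠ j.castSucc → (p j.castSucc : ℕ) ∣ sharp p i := by
      intro i hi
      rw [sharp, Finset.PNat.coe_prod]
      exact Finset.dvd_prod_of_mem _ (by simp [hi.symm])
    have hcop : (p j.castSucc : ℕ).Coprime (sharp p j.castSucc) := by
      rw [sharp, Finset.PNat.coe_prod]
      refine Nat.Coprime.prod_right fun i hi => ?_
      exact PNat.coprime_coe.2 (hp (Finset.ne_of_mem_erase hi).symm)
    have hsN : s ^ (∏ i, (p i : ℕ)) = 1 := by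
      rw [← orderOf_dvd_iff_pow_eq_one, hs]
      exact Finset.dvd_prod_of_mem _ (Finset.mem_univ _)
    have key := diag_support hq k (sharp p) s
      (fun κ => (s : ℂ) ^ ((sharp p j.castSucc : ℕ) * κ j))
      ⟨fun κ => by rw [norm_pow, Circle.norm_coe, one_pow], fun κ _ κ' _ h => h⟩ ?_ (ha s hsN) h0
    · have h1 : s ^ ((sharp p j.castSucc : ℕ) * κ' j) = s ^ ((sharp p j.castSucc : ℕ) * κ j) := by
        apply Circle.coe_injective
        simpa using key
      rw [pow_eq_pow_iff_modEq, hs] at h1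
      exact Nat.ModEq.cancel_left_of_coprime hcop h1
    · intro i κ hi
      by_cases hij : i = j.castSucc
      · subst hij
        have h2 := wt_ne_zero (κ := κ) (show (j.castSucc).val < k.val from hj) hi
        have h3 : coord κ (j.castSucc).val = κ j := by
          rw [coord, dif_pos (by simp)]
          rfl
        rw [h3] at h2
        have h4 : down (k : ℕ) (j.castSucc : ℕ) κ j = κ j - 1 := if_pos ⟨hj, rfl⟩
        rw [h4, ← pow_add]
        congr 1
        obtain ⟨c, hc⟩ := Nat.exists_eq_succ_of_ne_zero h2
        rw [hc]
        simp only [Nat.succ_eq_add_one, Nat.add_sub_cancel]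
        ring
      · have h5 : down (k : ℕ) (i : ℕ) κ j = κ j := by
          refine if_neg fun h6 => hij ?_
          ext
          exact h6.2.symm
        have h6 : (s : ℂ) ^ (sharp p i : ℕ) = 1 := by
          have : s ^ (sharp p i : ℕ) = 1 := by
            rw [← orderOf_dvd_iff_pow_eq_one, hs]
            exact hdvd i hij
          simpa using congrArg (fun x : Circle => (x : ℂ)) this
        rw [h5, h6, one_mul]
  · intro j hj
    have key := diag_support hq k (sharp p) 1 (fun κ => ((1 / 2 : ℝ) ^ κ j : ℝ))
      ⟨fun κ => by
        rw [Complex.norm_real, Real.norm_of_nonneg (by positivity)]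
        exact pow_le_one₀ (by norm_num) (by norm_num), fun κ _ κ' _ h => h⟩ ?_
      (ha 1 (one_pow _)) h0
    · have h1 : (1 / 2 : ℝ) ^ κ' j = (1 / 2 : ℝ) ^ κ j := by exact_mod_cast key
      exact pow_right_injective₀ (by norm_num) (by norm_num) h1
    · intro i κ _
      have : down (k : ℕ) (i : ℕ) κ j = κ j := if_neg (by omega)
      rw [this]
      simp

theorem star_opR_sphereRep (hp : Pairwise fun i j => (p i).Coprime (p j))
    (hq : q ∈ Set.Ioo (0 : ℝ) 1) (k : Fin (n + 1)) {a : QSphere n q}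
    (ha : a ∈ QLens q (∏ i, (p i : ℕ)) (sharp p)) :
    star (opR p r k) * (opR p r k * (sphereRep hq k a * star (opR p r k)))
      = sphereRep hq k a * star (opR p r k) := by
  refine ext_ket fun m => ?_
  change star (opR p r k) (opR p r k (sphereRep hq k a (star (opR p r k) (ket m))))
    = sphereRep hq k a (star (opR p r k) (ket m))
  by_cases hm : InV k m
  · rw [star_opR_ket p r hm]
    refine star_opR_opR p r fun κ hκ => ?_
    obtain ⟨h1, h2⟩ := lens_support p hp hq k ha hκ
    have h3 : ∀ j : Fin n, k.val ≤ j → relabel p r k m j = m j := fun j hj =>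
      if_neg (by omega)
    refine exists_relabel p r (fun j hj => ?_) fun i j hi hij => ?_
    · rw [h1 j hj, relabel_mod p r m j hj]
    · rw [h2 i hi, h2 j (hi.trans (le_of_lt hij)), h3 i hi, h3 j (hi.trans (le_of_lt hij))]
      exact hm.2 i j hi hij
  · rw [star_opR_ket_of_not p r hm, map_zero, map_zero, map_zero]

/-- The representation `π_k` of the lens space algebra on `ℓ²(ℕⁿ)`: the restriction of `sphereRep`
to the subspace spanned by the `|relabel m⟩` with `InV k m`, transported to `V_k` by the
relabelling, and zero on the orthogonal of `V_k`. Its values on the generators are computed in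
`piK_x_lt`, `piK_x_eq`, `piK_x_gt`, `piK_zeta_lt`, `piK_zeta_eq`, `piK_zeta_gt`
and `piK_ket_of_not`. -/
def piK (hp : Pairwise fun i j => (p i).Coprime (p j)) (hq : q ∈ Set.Ioo (0 : ℝ) 1)
    (k : Fin (n + 1)) : QLens q (∏ i, (p i : ℕ)) (sharp p) →⋆ₙₐ[ℂ] Op (Fin n → ℕ) where
  toFun a := opR p r k * (sphereRep hq k a * star (opR p r k))
  map_smul' c a := by
    change opR p r k * (sphereRep hq k (c • (a : QSphere n q)) * star (opR p r k)) = _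
    rw [map_smul, smul_mul_assoc, mul_smul_comm]
    rfl
  map_zero' := by simp
  map_add' a b := by simp [mul_add, add_mul]
  map_mul' a b := by
    simp only [MulMemClass.coe_mul, map_mul]
    conv_rhs => rw [mul_assoc, mul_assoc, star_opR_sphereRep p r hp hq k b.2]
    simp only [mul_assoc]
  map_star' a := by
    simp only [StarMemClass.coe_star, map_star, star_mul, star_star, mul_assoc]

theorem piK_apply (hp : Pairwise fun i j => (p i).Coprime (p j)) (hq : q ∈ Set.Ioo (0 : ℝ) 1)
    (k : Fin (n + 1)) (a : QLens q (∏ i, (p i : ℕ)) (sharp p)) :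
    piK p r hp hq k a = opR p r k * (sphereRep hq k a * star (opR p r k)) := rfl

end piK

/-! ### Values of `π_k` on the generators of the lens space algebra -/

section generators

variable {n : ℕ} {q : ℝ}

theorem action_z (ℓ : Fin (n + 1) → ℕ+) (t : Circle) (i : Fin (n + 1)) :
    QSphere.action ℓ t (QSphere.z i : QSphere n q) = ((t : ℂ) ^ (ℓ i : ℕ)) • QSphere.z i :=
  QSphere.starLift_z _ _ i

variable (p : Fin (n + 1) → ℕ+)

theorem mul_sharp (i : Fin (n + 1)) : (p i : ℕ) * sharp p i = ∏ j, (p j : ℕ) := by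
  rw [sharp, Finset.PNat.coe_prod, Finset.mul_prod_erase _ (fun j => (p j : ℕ)) (Finset.mem_univ i)]

/-- The element `x_i = z_i z_i^*` of the lens space algebra. -/
def lensX (q : ℝ) (i : Fin (n + 1)) : QLens q (∏ i, (p i : ℕ)) (sharp p) :=
  ⟨QSphere.z i * star (QSphere.z i), fun t _ => by
    have key : (t : ℂ) ^ (sharp p i : ℕ) * star ((t : ℂ) ^ (sharp p i : ℕ)) = 1 := by
      rw [star_pow, ← mul_pow]
      simp [Complex.mul_conj]
    rw [map_mul, map_star, action_z, star_smul, smul_mul_smul_comm, key, one_smul]⟩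

/-- The element `ζ_i = z_i ^ p_i` of the lens space algebra. -/
def lensZeta (q : ℝ) (i : Fin (n + 1)) : QLens q (∏ i, (p i : ℕ)) (sharp p) :=
  ⟨QSphere.z i ^ (p i : ℕ), fun t ht => by
    have key : ((t : ℂ) ^ (sharp p i : ℕ)) ^ (p i : ℕ) = 1 := by
      rw [← pow_mul, mul_comm, mul_sharp]
      simpa using congrArg (fun x : Circle => (x : ℂ)) ht
    rw [map_pow, action_z, smul_pow, key, one_smul]⟩

variable (r : ∀ i : Fin n, Fin (p i.castSucc))
  (hp : Pairwise fun i j => (p i).Coprime (p j)) (hq : q ∈ Set.Ioo (0 : ℝ) 1)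
  (k i : Fin (n + 1)) {m : Fin n → ℕ}

theorem piK_ket_of_not (hm : ¬ InV k m) (a : QLens q (∏ i, (p i : ℕ)) (sharp p)) :
    piK p r hp hq k a (ket m) = 0 := by
  rw [piK_apply]
  change opR p r k (sphereRep hq k a (star (opR p r k) (ket m))) = 0
  rw [star_opR_ket_of_not p r hm, map_zero, map_zero]

theorem piK_ket (hm : InV k m) (a : QLens q (∏ i, (p i : ℕ)) (sharp p)) :
    piK p r hp hq k a (ket m) = opR p r k (sphereRep hq k a (ket (relabel p r k m))) := by
  rw [piK_apply]
  change opR p r k (sphereRep hq k a (star (opR p r k) (ket m))) = _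
  rw [star_opR_ket p r hm]

theorem sphereRep_x (κ : Fin n → ℕ) :
    sphereRep hq k (QSphere.z i * star (QSphere.z i)) (ket κ) =
      ((wt q k i κ ^ 2 : ℝ) : ℂ) • ket κ := by
  rw [map_mul, map_star, sphereRep, QSphere.starLift_z]
  ext κ'
  change (opZ hq k i * star (opZ hq k i) : Op (Fin n → ℕ)) (ket κ) κ' = _ * ket κ κ'
  rw [opZ_mul_star_apply, ket_apply]
  split_ifs with h
  · rw [h]
  · simp

theorem piK_x_lt (hm : InV k m) (hi : i < k) :
    piK p r hp hq k (lensX p q i) (ket m) =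
      ((q ^ (2 * psum (relabel p r k m) i) *
        (1 - q ^ (2 * coord (relabel p r k m) i)) : ℝ) : ℂ) • ket m := by
  rw [piK_ket p r hp hq k hm, lensX, sphereRep_x, map_smul, opR_ket p r hm, wt,
    if_pos (show i.val < k.val from hi), mul_pow, Real.sq_sqrt, ← pow_mul, mul_comm _ 2]
  linarith [pow_le_one₀ (n := 2 * coord (relabel p r k m) i) hq.1.le hq.2.le]

theorem piK_x_eq (hm : InV k m) :
    piK p r hp hq k (lensX p q k) (ket m) =
      ((q ^ (2 * psum (relabel p r k m) k) : ℝ) : ℂ) • ket m := by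
  rw [piK_ket p r hp hq k hm, lensX, sphereRep_x, map_smul, opR_ket p r hm, wt,
    if_neg (lt_irrefl _), if_pos rfl, ← pow_mul, mul_comm _ 2]

theorem piK_x_gt (hi : k < i) : piK p r hp hq k (lensX p q i) = 0 := by
  refine ext_ket fun m => ?_
  by_cases hm : InV k m
  · rw [piK_ket p r hp hq k hm, lensX, sphereRep_x, wt_of_gt _ hi]
    simp
  · rw [piK_ket_of_not p r hp hq k hm]
    rfl

theorem piK_zeta_gt (hi : k < i) : piK p r hp hq k (lensZeta p q i) = 0 := by
  rw [piK_apply, lensZeta, map_pow, sphereRep, QSphere.starLift_z, opZ_of_gt hq hi,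
    zero_pow (p i).ne_zero, zero_mul, mul_zero]

theorem opZ_pow_ket {k i : ℕ} (hk : k ≤ n) (hi : i < k) (κ : Fin n → ℕ) (s : ℕ) :
    (opZ hq k i ^ s) (ket κ) =
      ((q ^ (s * psum κ i) *
        √(∏ t ∈ Finset.Icc 1 s, (1 - q ^ (2 * (coord κ i + t)))) : ℝ) : ℂ) •
        ket (fun j : Fin n => if j.val = i then κ j + s else κ j) := by
  induction s with
  | zero => simp
  | succ s ih =>
    have h1 : (opZ hq k i ^ (s + 1)) (ket κ) = opZ hq k i ((opZ hq k i ^ s) (ket κ)) := by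
      rw [pow_succ']
      rfl
    have h2 : ∀ j, coord (fun j : Fin n => if j.val = i then κ j + s else κ j) j
        = if j = i then coord κ j + s else coord κ j := by
      intro j
      unfold coord
      by_cases hj : j < n
      · rw [dif_pos hj, dif_pos hj]
      · rw [dif_neg hj, dif_neg hj, if_neg (by omega)]
    have h3 : psum (fun j : Fin n => if j.val = i then κ j + s else κ j) i = psum κ i := by
      refine Finset.sum_congr rfl fun j hj => ?_
      rw [h2, if_neg (Finset.mem_range.1 hj).ne]
    have h4 : up k i (fun j : Fin n => if j.val = i then κ j + s else κ j)
        = fun j => if j.val = i then κ j + (s + 1) else κ j := by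
      funext j
      simp only [up]
      split_ifs <;> omega
    have h5 : ∀ t, 0 ≤ 1 - q ^ t := fun t => by
      linarith [pow_le_one₀ (n := t) hq.1.le hq.2.le]
    rw [h1, ih, map_smul, opZ_ket_lt hq hk hi, h3, h2, if_pos rfl, h4, smul_smul,
      ← Complex.ofReal_mul, Finset.prod_Icc_succ_top (by omega),
      Real.sqrt_mul (Finset.prod_nonneg fun t _ => h5 _), add_assoc (coord κ i)]
    congr 2
    ring

theorem piK_zeta_eq (hm : InV k m) :
    piK p r hp hq k (lensZeta p q k) (ket m) =
      ((q ^ ((p k : ℕ) * psum (relabel p r k m) k) : ℝ) : ℂ) • ket m := by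
  have h : ∀ s : ℕ, (opZ hq k k ^ s) (ket (relabel p r k m))
      = ((q ^ (s * psum (relabel p r k m) k) : ℝ) : ℂ) • ket (relabel p r k m) := by
    intro s
    induction s with
    | zero => simp
    | succ s ih =>
      have h1 : (opZ hq k k ^ (s + 1)) (ket (relabel p r k m))
          = opZ hq k k ((opZ hq k k ^ s) (ket (relabel p r k m))) := by
        rw [pow_succ']
        rfl
      rw [h1, ih, map_smul, opZ_ket_eq, smul_smul, ← Complex.ofReal_mul, add_mul, one_mul, pow_add]
  rw [piK_ket p r hp hq k hm, lensZeta, map_pow, sphereRep, QSphere.starLift_z, h, map_smul,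
    opR_ket p r hm]

/-- Addition of the vector with entries one in the positions `i + 1, …, k` and zero elsewhere. -/
def addE (i k : ℕ) (m : Fin n → ℕ) : Fin n → ℕ :=
  fun j => m j + if i ≤ j.val ∧ j.val < k then 1 else 0

theorem InV.addE {k : ℕ} {m : Fin n → ℕ} (hm : InV k m) (i : ℕ) : InV k (addE i k m) := by
  refine ⟨fun a b hab hb => ?_, fun a b ha hab => ?_⟩
  · have h1 := hm.1 a b hab hb
    have h2 : a.val ≤ b.val := hab
    simp only [QWP.addE]
    split_ifs <;> omega
  · have h1 := hm.2 a b ha hab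
    have h2 : a.val < b.val := hab
    simp only [QWP.addE]
    split_ifs <;> omega

theorem relabel_addE {k : ℕ} (i : Fin (n + 1)) {m : Fin n → ℕ} (hm : InV k m) (hi : i.val < k) :
    relabel p r k (addE i k m) =
      fun j => if j.val = i.val then relabel p r k m j + p i else relabel p r k m j := by
  funext j
  unfold relabel
  by_cases hj : j.val < k
  · rw [if_pos hj, if_pos hj]
    have h1 := prev_le hm hj
    have h2 : prev (addE i k m) j = prev m j + if i.val + 1 ≤ j.val then 1 else 0 := by
      unfold prev
      split_ifs with h3 h4 h5 <;> try omega
      · rw [coord, coord, dif_pos (by omega), dif_pos (by omega)]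
        simp only [addE]
        rw [if_pos (by omega)]
      · rw [coord, coord, dif_pos (by omega), dif_pos (by omega)]
        simp only [addE]
        rw [if_neg (by omega)]
    have h3 : addE i k m j = m j + if i.val ≤ j.val then 1 else 0 := by
      simp only [addE, hj, and_true]
    rw [h2, h3]
    split_ifs with h4 h5 h6 <;> try omega
    · rw [Nat.add_sub_add_right]
    · have h7 : i = j.castSucc := by
        ext
        simp only [Fin.val_castSucc]
        omega
      subst h7
      rw [add_zero, Nat.sub_add_comm h1, Nat.mul_add, mul_one]
      omega
    · simp
  · rw [if_neg hj, if_neg hj, if_neg (by omega)]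
    simp [addE, hj]

theorem piK_zeta_lt (hm : InV k m) (hi : i < k) :
    piK p r hp hq k (lensZeta p q i) (ket m) =
      ((q ^ ((p i : ℕ) * psum (relabel p r k m) i) *
        √(∏ t ∈ Finset.Icc 1 (p i : ℕ),
          (1 - q ^ (2 * (coord (relabel p r k m) i + t)))) : ℝ) : ℂ) •
        ket (addE i k m) := by
  rw [piK_ket p r hp hq k hm, lensZeta, map_pow, sphereRep, QSphere.starLift_z,
    opZ_pow_ket hq (Nat.lt_succ_iff.1 k.isLt) hi, map_smul, ← relabel_addE p r i hm hi,
    opR_ket p r (hm.addE i)]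

end generators

/-! ### The representations `π_±` and `π` -/

section piTotal

variable {n : ℕ} {q : ℝ}

theorem InV.not_of_add_two_le {j k : ℕ} (hk : k ≤ n) (h : j + 2 ≤ k) {m : Fin n → ℕ}
    (hm : InV k m) : ¬ InV j m := by
  intro hm'
  have h1 := hm.1 ⟨j, by omega⟩ ⟨j + 1, by omega⟩ (by simp) (by simp only; omega)
  have h2 := hm'.2 ⟨j, by omega⟩ ⟨j + 1, by omega⟩ le_rfl (by simp)
  omega

variable (p : Fin (n + 1) → ℕ+) (r : ∀ i : Fin n, Fin (p i.castSucc))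
  (hp : Pairwise fun i j => (p i).Coprime (p j)) (hq : q ∈ Set.Ioo (0 : ℝ) 1)

theorem star_opR_mul_opR {j k : ℕ} (h : ∀ m : Fin n → ℕ, InV j m → ¬ InV k m) :
    star (opR p r j) * opR p r k = 0 := by
  ext w κ
  rw [mul_ap, ← inner_ket_left κ, ContinuousLinearMap.star_eq_adjoint,
    ContinuousLinearMap.adjoint_inner_right]
  by_cases h' : ∃ m, InV j m ∧ relabel p r j m = κ
  · obtain ⟨m, hm, rfl⟩ := h'
    rw [opR_ket p r hm, inner_ket_left, opR, wcomp_apply, indV, if_neg (h m hm), zero_mul]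
    rfl
  · rw [opR_ket_of_not p r fun m hm hκ => h' ⟨m, hm, hκ⟩, inner_zero_left]
    rfl

theorem piK_mul_piK {j k : Fin (n + 1)} (hjk : j ≠ k) (h : j.val % 2 = k.val % 2)
    (a b : QLens q (∏ i, (p i : ℕ)) (sharp p)) :
    piK p r hp hq j a * piK p r hp hq k b = 0 := by
  have h0 : j.val ≠ k.val := fun h' => hjk (Fin.ext h')
  have h1 : ∀ m : Fin n → ℕ, InV j m → ¬ InV k m := by
    intro m hm hm'
    rcases lt_or_gt_of_ne h0 with h2 | h2
    · exact hm'.not_of_add_two_le (Nat.lt_succ_iff.1 k.isLt) (by omega) hm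
    · exact hm.not_of_add_two_le (Nat.lt_succ_iff.1 j.isLt) (by omega) hm'
  rw [piK_apply, piK_apply]
  calc _ = opR p r j * (sphereRep hq j a * ((star (opR p r j) * opR p r k) *
        (sphereRep hq k b * star (opR p r k)))) := by simp only [mul_assoc]
    _ = 0 := by rw [star_opR_mul_opR p r h1, zero_mul, mul_zero, mul_zero]

/-- The sum of the representations `π_k` with `k` congruent to `s` modulo two. -/
def piPar (s : ℕ) : QLens q (∏ i, (p i : ℕ)) (sharp p) →⋆ₙₐ[ℂ] Op (Fin n → ℕ) where
  toFun a := ∑ k : Fin (n + 1) with k.val % 2 = s, piK p r hp hq k a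
  map_smul' c a := by simp only [map_smul, Finset.smul_sum]; rfl
  map_zero' := by simp
  map_add' a b := by simp [Finset.sum_add_distrib]
  map_mul' a b := by
    rw [Finset.sum_mul]
    refine Finset.sum_congr rfl fun j hj => ?_
    rw [Finset.mul_sum, Finset.sum_eq_single_of_mem j hj, map_mul]
    intro k hk hkj
    rw [Finset.mem_filter] at hj hk
    exact piK_mul_piK p r hp hq hkj.symm (hj.2.trans hk.2.symm) a b
  map_star' a := by simp [map_star]

/-- The representation `π_+`, the sum of the `π_k` with `k` even. -/
def piPlus : QLens q (∏ i, (p i : ℕ)) (sharp p) →⋆ₙₐ[ℂ] Op (Fin n → ℕ) := piPar p r hp hq 0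

/-- The representation `π_-`, the sum of the `π_k` with `k` odd. -/
def piMinus : QLens q (∏ i, (p i : ℕ)) (sharp p) →⋆ₙₐ[ℂ] Op (Fin n → ℕ) := piPar p r hp hq 1

end piTotal

section double

variable {E : Type*} [NormedAddCommGroup E] [InnerProductSpace ℂ E]

/-- The orthogonal direct sum of two copies of a Hilbert space. -/
abbrev Double (E : Type*) : Type _ := WithLp 2 (E × E)

/-- The operator `S ⊕ T` on `E ⊕ E`. -/
def blockDiag (S T : E →L[ℂ] E) : Double E →L[ℂ] Double E :=
  (WithLp.prodContinuousLinearEquiv 2 ℂ E E).symm.toContinuousLinearMap ∘L S.prodMap T ∘L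
    (WithLp.prodContinuousLinearEquiv 2 ℂ E E).toContinuousLinearMap

@[simp] theorem blockDiag_fst (S T : E →L[ℂ] E) (v : Double E) :
    (blockDiag S T v).fst = S v.fst := rfl

@[simp] theorem blockDiag_snd (S T : E →L[ℂ] E) (v : Double E) :
    (blockDiag S T v).snd = T v.snd := rfl

theorem double_ext {v w : Double E} (h1 : v.fst = w.fst) (h2 : v.snd = w.snd) : v = w :=
  WithLp.ofLp_injective 2 (Prod.ext h1 h2)

theorem star_blockDiag [CompleteSpace E] (S T : E →L[ℂ] E) :
    star (blockDiag S T) = blockDiag (star S) (star T) := by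
  rw [ContinuousLinearMap.star_eq_adjoint, eq_comm, ContinuousLinearMap.eq_adjoint_iff]
  intro v w
  simp [WithLp.prod_inner_apply, ContinuousLinearMap.star_eq_adjoint,
    ContinuousLinearMap.adjoint_inner_left]

/-- The flip `F (v ⊕ w) = w ⊕ v`. -/
def flipOp : Double E →L[ℂ] Double E :=
  (WithLp.prodContinuousLinearEquiv 2 ℂ E E).symm.toContinuousLinearMap ∘L
    (ContinuousLinearMap.snd ℂ E E).prod (ContinuousLinearMap.fst ℂ E E) ∘L
    (WithLp.prodContinuousLinearEquiv 2 ℂ E E).toContinuousLinearMap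

@[simp] theorem flipOp_fst (v : Double E) : (flipOp v).fst = v.snd := rfl

@[simp] theorem flipOp_snd (v : Double E) : (flipOp v).snd = v.fst := rfl

/-- The grading `γ (v ⊕ w) = v ⊕ (-w)`. -/
def grading : Double E →L[ℂ] Double E := blockDiag 1 (-1)

end double

section triple

variable {n : ℕ} {q : ℝ}
variable (p : Fin (n + 1) → ℕ+) (r : ∀ i : Fin n, Fin (p i.castSucc))
  (hp : Pairwise fun i j => (p i).Coprime (p j)) (hq : q ∈ Set.Ioo (0 : ℝ) 1)

/-- The representation `π = π_+ ⊕ π_-` of the lens space algebra. -/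
def piLens : QLens q (∏ i, (p i : ℕ)) (sharp p) →⋆ₙₐ[ℂ]
    (Double (L2 (Fin n → ℕ)) →L[ℂ] Double (L2 (Fin n → ℕ))) where
  toFun a := blockDiag (piPlus p r hp hq a) (piMinus p r hp hq a)
  map_smul' c a := by rw [map_smul, map_smul]; rfl
  map_zero' := by rw [map_zero, map_zero]; rfl
  map_add' a b := by rw [map_add, map_add]; rfl
  map_mul' a b := by rw [map_mul, map_mul]; rfl
  map_star' a := by rw [map_star, map_star, star_blockDiag]

/-- The restriction of `π = π_+ ⊕ π_-` to the coordinate algebra of the quantum weighted projective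
space. -/
def piProj : QProj q (sharp p) →⋆ₙₐ[ℂ]
    (Double (L2 (Fin n → ℕ)) →L[ℂ] Double (L2 (Fin n → ℕ))) :=
  (piLens p r hp hq).comp
    (StarSubalgebra.inclusion (QProj_le_QLens q (∏ i, (p i : ℕ)) (sharp p)) :
      QProj q (sharp p) →⋆ₙₐ[ℂ] QLens q (∏ i, (p i : ℕ)) (sharp p))

/-! ### The operators `|D|` and `D` -/

/-- The operator `|m⟩ ↦ ‖m‖₁ |m⟩` on `ℓ²(ℕⁿ)`, with its maximal domain. -/
def numberOp (n : ℕ) : L2 (Fin n → ℕ) →ₗ.[ℂ] L2 (Fin n → ℕ) where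
  domain :=
    { carrier := {v | Memℓp (fun m : Fin n → ℕ => ((∑ i, m i : ℕ) : ℂ) * v m) 2}
      add_mem' := fun {v w} hv hw => by
        have h := Memℓp.add hv hw
        refine (iff_of_eq ?_).1 h
        congr 1
        funext m
        exact (mul_add _ (v m) (w m)).symm
      zero_mem' := by
        have h : (fun m : Fin n → ℕ => ((∑ i, m i : ℕ) : ℂ) * (0 : L2 (Fin n → ℕ)) m) = 0 := by
          funext m
          exact mul_zero _
        change Memℓp _ 2
        rw [h]
        exact zero_memℓp
      smul_mem' := fun c v hv => by
        have h := Memℓp.const_smul hv c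
        refine (iff_of_eq ?_).1 h
        congr 1
        funext m
        exact mul_left_comm c _ (v m) }
  toFun :=
    { toFun := fun v => ⟨fun m => ((∑ i, m i : ℕ) : ℂ) * v.1 m, v.2⟩
      map_add' := fun v w => by
        ext m
        exact mul_add _ (v.1 m) (w.1 m)
      map_smul' := fun c v => by
        ext m
        exact mul_left_comm _ c (v.1 m) }

/-- The operator `|D|` on `ℓ²(ℕⁿ) ⊕ ℓ²(ℕⁿ)`: the direct sum of two copies of `numberOp`. -/
def absDirac (n : ℕ) : Double (L2 (Fin n → ℕ)) →ₗ.[ℂ] Double (L2 (Fin n → ℕ)) where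
  domain :=
    (numberOp n).domain.comap (WithLp.fstₗ 2 ℂ (L2 (Fin n → ℕ)) (L2 (Fin n → ℕ))) ⊓
      (numberOp n).domain.comap (WithLp.sndₗ 2 ℂ (L2 (Fin n → ℕ)) (L2 (Fin n → ℕ)))
  toFun :=
    { toFun := fun v =>
        WithLp.toLp 2 (numberOp n ⟨v.1.fst, v.2.1⟩, numberOp n ⟨v.1.snd, v.2.2⟩)
      map_add' := fun v w => by
        refine double_ext ?_ ?_
        · exact map_add (numberOp n).toFun ⟨v.1.fst, v.2.1⟩ ⟨w.1.fst, w.2.1⟩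
        · exact map_add (numberOp n).toFun ⟨v.1.snd, v.2.2⟩ ⟨w.1.snd, w.2.2⟩
      map_smul' := fun c v => by
        refine double_ext ?_ ?_
        · exact map_smul (numberOp n).toFun c ⟨v.1.fst, v.2.1⟩
        · exact map_smul (numberOp n).toFun c ⟨v.1.snd, v.2.2⟩ }

/-- The operator `D = |D| F`. -/
def dirac (n : ℕ) : Double (L2 (Fin n → ℕ)) →ₗ.[ℂ] Double (L2 (Fin n → ℕ)) where
  domain := (absDirac n).domain.comap (flipOp : _ →L[ℂ] Double (L2 (Fin n → ℕ))).toLinearMap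
  toFun :=
    { toFun := fun v => absDirac n ⟨flipOp v.1, v.2⟩
      map_add' := fun v w => by
        exact map_add (absDirac n).toFun ⟨flipOp v.1, v.2⟩ ⟨flipOp w.1, w.2⟩
      map_smul' := fun c v => by
        exact map_smul (absDirac n).toFun c ⟨flipOp v.1, v.2⟩ }

end triple

/-! ### Spectral triples and their metric dimension -/

section spectralTriple

variable {H : Type*} [NormedAddCommGroup H] [InnerProductSpace ℂ H]

/-- The bounded operator `R` is the inverse of `D - μ`. -/
def IsResolvent (D : H →ₗ.[ℂ] H) (μ : ℂ) (R : H →L[ℂ] H) : Prop :=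
  (∀ v : H, ∃ h : R v ∈ D.domain, D ⟨R v, h⟩ - μ • R v = v) ∧
    ∀ v : D.domain, R (D v - μ • (v : H)) = v

variable [CompleteSpace H]

/-- An even spectral triple: a `*`-representation `π` of a complex `*`-algebra by bounded operators
on a Hilbert space, a (densely defined) self-adjoint operator `D` with compact resolvent whose
commutators with the `π a` are defined on the domain of `D` and extend to bounded operators,
and a self-adjoint unitary `γ` commuting with the `π a` and anticommuting with `D`. -/
structure IsEvenSpectralTriple {A : Type*} [Ring A] [StarRing A] [Algebra ℂ A]
    (π : A →⋆ₙₐ[ℂ] (H →L[ℂ] H)) (D : H →ₗ.[ℂ] H) (γ : H →L[ℂ] H) : Prop where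
  dense_domain : Dense (D.domain : Set H)
  selfAdjoint : IsSelfAdjoint D
  compact_resolvent : ∀ μ : ℂ, μ.im ≠ 0 → ∃ R : H →L[ℂ] H, IsResolvent D μ R ∧ IsCompactOperator R
  bounded_commutator : ∀ a : A, ∃ B : H →L[ℂ] H, ∀ v : D.domain,
    ∃ h : π a v ∈ D.domain, D ⟨π a v, h⟩ - π a (D v) = B v
  grading_selfAdjoint : IsSelfAdjoint γ
  grading_sq : γ * γ = 1
  grading_comm : ∀ a : A, γ * π a = π a * γ
  grading_anticomm : ∀ v : D.domain, ∃ h : γ v ∈ D.domain, D ⟨γ v, h⟩ = -γ (D v)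

/-- A bounded operator `T` is of trace class if `∑ ⟨e_i, |T| e_i⟩ < ∞` for an orthonormal basis
(the sum does not depend on the basis). -/
def IsTraceClass (T : H →L[ℂ] H) : Prop :=
  ∃ (w : Set H) (b : HilbertBasis w ℂ H),
    Summable fun i => (⟪b i, CFC.abs T (b i)⟫_ℂ).re

/-- For a self-adjoint operator `D` with compact resolvent (so that the eigenvectors span a dense
subspace): the bounded operator `T` is `|D|^{-s}` on the orthogonal of the kernel of `D`, and zero
on the kernel. -/
def IsAbsPowNeg (D : H →ₗ.[ℂ] H) (s : ℝ) (T : H →L[ℂ] H) : Prop :=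
  ∀ (v : D.domain) (c : ℝ), D v = (c : ℂ) • (v : H) →
    T v = if c = 0 then 0 else ((|c| ^ (-s) : ℝ) : ℂ) • (v : H)

/-- `|D|^{-s}` (on the orthogonal of the kernel of `D`) is a bounded operator of trace class. -/
def AbsPowNegTraceClass (D : H →ₗ.[ℂ] H) (s : ℝ) : Prop :=
  ∃ T : H →L[ℂ] H, IsAbsPowNeg D s T ∧ IsTraceClass T

/-- The metric dimension is the infimum of the `s > 0` for which `|D|^{-s}` is of trace class. -/
def HasMetricDimension (D : H →ₗ.[ℂ] H) (d : ℝ) : Prop :=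
  {s : ℝ | 0 < s ∧ AbsPowNegTraceClass D s}.Nonempty ∧
    IsGLB {s : ℝ | 0 < s ∧ AbsPowNegTraceClass D s} d

end spectralTriple

end QWP

end

noncomputable section

namespace QWP

/-! ### Bounded diagonal operators and their compactness. -/

section diag

variable {I : Type}

/-! Axioms about `D` alone. `D` is diagonalised by the vectors `|m⟩ ⊕ ±|m⟩`, with eigenvalues
`±‖m‖₁`. Self-adjointness and compactness of the resolvent follow by looking at matrix entries,
since only finitely many `m` have `‖m‖₁` below a given bound. The operator `|D|^{-s}` is diagonal,
and the number of `m` with `‖m‖₁ = M` is the binomial coefficient `(n+M-1).choose M`, of order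
`M^(n-1)`. So the trace behaves like the sum of `M^(n-1-s)`, finite if and only if `s > n`
(`summable_negPow_iff`, `isTraceClass_iff_of_diag`).

Bounded commutators. `D` exchanges the summands, so the entries of `[D, S ⊕ T]` are combinations of
`[|D|, S]`, `[|D|, T]` and `(S - T)|D|` (`exists_commutator_dirac`). By averaging over roots of
unity, an invariant element is a linear combination of words in the `z_i`, `z_i^*` of weighted
degree zero (`mem_span_word_of_mem_QProj`), so it suffices to treat such a word.

In each `π_k` a word maps `|m⟩` to a multiple of a single `|m'⟩`, with `m' - m` depending only on
the word and on `k` (`displacement`). Hence the word is homogeneous for the total degree, and its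
commutator with `|D|` is a scalar multiple of itself.

For `(π_+ - π_-)|D|`, a basis vector that lies in some `V_j` lies in two consecutive spaces `V_k`,
`V_{k+1}` (`exists_InV_succ`) and in no others, so on it the difference is `±(π_{k+1} - π_k)`. If
the word has a letter of index larger than `k`, then `π_k` kills it, and `π_{k+1}` either kills it
too or contributes a small factor from a letter of index `k+1`. Otherwise the two representations
differ only in the weights of `z_k`, where `q^σ` is compared with `q^σ √(1 - q^(2κ))`, and degree
zero forces both to move `|m⟩` to the same vector. Either way the difference is `O(q^(κ_1 + ⋯ +
κ_{k+1}))`, hence `O(q^(m_{k+1}))`. Since `m_{k+1}` is the largest entry of `m`, this is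
`O(q^(‖m‖₁/n))` (`norm_cornerRep_succ_sub_le`, `tot_le_mul`), and such geometric decay beats the
factor `‖m‖₁` (`isBoundedMulNumberOp_of_decay`). -/

theorem isWeight_div {c : I → ℂ} {C : ℝ} (hC : 0 < C) (h : ∀ i, ‖c i‖ ≤ C) :
    IsWeight id fun i => c i / C where
  norm_le i := by
    rw [norm_div, Complex.norm_real, Real.norm_of_nonneg hC.le]
    exact div_le_one_of_le₀ (h i) hC.le
  inj _ _ _ _ h := h

/-- The bounded diagonal operator with entries `c i`. -/
def diagOp (c : I → ℂ) {C : ℝ} (hC : 0 < C) (h : ∀ i, ‖c i‖ ≤ C) : Op I :=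
  -- `wcomp` only admits weights of modulus at most one, hence the division by `C` and the factor
  -- that undoes it.
  (C : ℂ) • wcomp id _ (isWeight_div hC h)

@[simp] theorem diagOp_apply (c : I → ℂ) {C : ℝ} (hC : 0 < C) (h : ∀ i, ‖c i‖ ≤ C) (v : L2 I)
    (i : I) : diagOp c hC h v i = c i * v i := by
  have : (C : ℂ) ≠ 0 := by exact_mod_cast hC.ne'
  rw [diagOp, smul_ap, wcomp_apply, id]
  field_simp

theorem norm_diagOp_le (c : I → ℂ) {C : ℝ} (hC : 0 < C) (h : ∀ i, ‖c i‖ ≤ C) :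
    ‖diagOp c hC h‖ ≤ C := by
  rw [diagOp, norm_smul, Complex.norm_real, Real.norm_of_nonneg hC.le]
  exact mul_le_of_le_one_right hC.le (LinearMap.mkContinuous_norm_le _ zero_le_one _)

/-- The rank one operator `v ↦ ⟨i|v⟩ w`. -/
def rankOne (w : L2 I) (i : I) : Op I :=
  (ContinuousLinearMap.toSpanSingleton ℂ w) ∘L (innerSL ℂ (ket i))

@[simp] theorem rankOne_apply (w : L2 I) (i : I) (v : L2 I) : rankOne w i v = v i • w := by
  simp [rankOne, inner_ket_left]

theorem isCompactOperator_rankOne (w : L2 I) (i : I) : IsCompactOperator (rankOne w i) :=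
  (isCompactOperator_of_locallyCompactSpace_dom (innerSL ℂ (ket i))).clm_comp
    (ContinuousLinearMap.toSpanSingleton ℂ w)

/-- The truncations to finite sets of indices have finite rank and converge in norm, because the
entries outside a large finite set are uniformly small. -/
theorem isCompactOperator_diagOp (c : I → ℂ) {C : ℝ} (hC : 0 < C) (h : ∀ i, ‖c i‖ ≤ C)
    (h0 : Filter.Tendsto c Filter.cofinite (nhds 0)) : IsCompactOperator (diagOp c hC h) := by
  classical
  refine isCompactOperator_of_tendsto (l := Filter.atTop)
    (F := fun s : Finset I => ∑ i ∈ s, rankOne (c i • ket i) i) ?_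
    (Filter.Eventually.of_forall fun s => ?_)
  · rw [Metric.tendsto_atTop]
    intro ε hε
    have h1 := (Metric.tendsto_nhds.1 h0) (ε / 2) (half_pos hε)
    rw [Filter.eventually_cofinite] at h1
    refine ⟨h1.toFinset, fun s hs => ?_⟩
    -- The entries of the truncation minus those of the full operator.
    let d : I → ℂ := fun i => if i ∈ s then 0 else - c i
    have hd : ∀ i, ‖d i‖ ≤ ε / 2 := by
      intro i
      by_cases hi : i ∈ s
      · simpa [d, hi] using (half_pos hε).le
      · have h2 : i ∉ h1.toFinset := fun h3 => hi (hs h3)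
        simp only [Set.Finite.mem_toFinset, Set.mem_ofPred_eq, not_not, dist_zero_right] at h2
        simpa [d, hi] using h2.le
    have key : (∑ i ∈ s, rankOne (c i • ket i) i) - diagOp c hC h
        = diagOp d (half_pos hε) hd := by
      ext v j
      rw [sub_ap, sum_ap]
      simp only [rankOne_apply, diagOp_apply, lp.coeFn_smul, Pi.smul_apply, smul_eq_mul, ket_apply]
      simp only [mul_ite, mul_one, mul_zero, Finset.sum_ite_eq, d]
      split_ifs <;> ring
    rw [dist_eq_norm, key]
    linarith [norm_diagOp_le d (half_pos hε) hd]
  · have : ∀ s : Finset I, IsCompactOperator (∑ i ∈ s, rankOne (c i • ket i) i : Op I) := by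
      intro s
      induction s using Finset.induction_on with
      | empty => simpa using isCompactOperator_zero
      | insert a s ha ih =>
        rw [Finset.sum_insert ha]
        exact (isCompactOperator_rankOne _ _).add ih
    exact this s

end diag

/-! ### Operators on the orthogonal sum of two copies of a Hilbert space. -/

section double

variable {E : Type*} [NormedAddCommGroup E] [InnerProductSpace ℂ E]

/-- The first projection of `E ⊕ E`. -/
def fstD : Double E →L[ℂ] E :=
  ContinuousLinearMap.fst ℂ E E ∘L
    (WithLp.prodContinuousLinearEquiv 2 ℂ E E).toContinuousLinearMap

/-- The second projection of `E ⊕ E`. -/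
def sndD : Double E →L[ℂ] E :=
  ContinuousLinearMap.snd ℂ E E ∘L
    (WithLp.prodContinuousLinearEquiv 2 ℂ E E).toContinuousLinearMap

/-- The first inclusion into `E ⊕ E`. -/
def inlD : E →L[ℂ] Double E :=
  (WithLp.prodContinuousLinearEquiv 2 ℂ E E).symm.toContinuousLinearMap ∘L
    ContinuousLinearMap.inl ℂ E E

/-- The second inclusion into `E ⊕ E`. -/
def inrD : E →L[ℂ] Double E :=
  (WithLp.prodContinuousLinearEquiv 2 ℂ E E).symm.toContinuousLinearMap ∘L
    ContinuousLinearMap.inr ℂ E E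

@[simp] theorem fstD_apply (v : Double E) : fstD v = v.fst := rfl
@[simp] theorem sndD_apply (v : Double E) : sndD v = v.snd := rfl
@[simp] theorem inlD_fst (v : E) : (inlD v).fst = v := rfl
@[simp] theorem inlD_snd (v : E) : (inlD v).snd = 0 := rfl
@[simp] theorem inrD_fst (v : E) : (inrD v).fst = 0 := rfl
@[simp] theorem inrD_snd (v : E) : (inrD v).snd = v := rfl

theorem isCompactOperator_blockDiag {S T : E →L[ℂ] E} (hS : IsCompactOperator S)
    (hT : IsCompactOperator T) : IsCompactOperator (blockDiag S T) := by
  have h : blockDiag S T = inlD ∘L (S ∘L fstD) + inrD ∘L (T ∘L sndD) := by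
    ext v
    refine double_ext ?_ ?_
    · simp
    · simp
  rw [h]
  exact ((hS.comp_clm fstD).clm_comp inlD).add ((hT.comp_clm sndD).clm_comp inrD)

theorem isSelfAdjoint_grading [CompleteSpace E] :
    IsSelfAdjoint (grading : Double E →L[ℂ] Double E) := by
  rw [IsSelfAdjoint, grading, star_blockDiag]
  simp

theorem grading_mul_grading : (grading : Double E →L[ℂ] Double E) * grading = 1 := by
  ext v
  exact double_ext (by simp [grading]) (by simp [grading])

theorem grading_mul_blockDiag (S T : E →L[ℂ] E) :
    grading * blockDiag S T = blockDiag S T * grading := by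
  ext v
  exact double_ext (by simp [grading]) (by simp [grading])

end double

/-! ### The operator `D`: density of the domain, self-adjointness, compact resolvent. -/

section dirac

variable {n : ℕ}

/-- The total degree of a multi-index. -/
def tot (m : Fin n → ℕ) : ℕ := ∑ i, m i

theorem mem_numberOp (v : L2 (Fin n → ℕ)) :
    v ∈ (numberOp n).domain ↔ Memℓp (fun m : Fin n → ℕ => (tot m : ℂ) * v m) 2 := Iff.rfl

theorem numberOp_apply (v : (numberOp n).domain) (m : Fin n → ℕ) :
    numberOp n v m = (tot m : ℂ) * (v : L2 (Fin n → ℕ)) m := rfl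

/-- The domain is maximal: membership and the value are both obtained by exhibiting a square
summable candidate for the image. All later domain questions go through this lemma or
`mem_dirac_of`. -/
theorem mem_numberOp_of {v w : L2 (Fin n → ℕ)} (h : ∀ m, w m = (tot m : ℂ) * v m) :
    ∃ hv : v ∈ (numberOp n).domain, numberOp n ⟨v, hv⟩ = w := by
  have h1 : (fun m : Fin n → ℕ => (tot m : ℂ) * v m) = w := funext fun m => (h m).symm
  refine ⟨?_, ?_⟩
  · rw [mem_numberOp, h1]
    exact w.2
  · ext m
    rw [numberOp_apply, h]

theorem tot_smul_ket (m m' : Fin n → ℕ) :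
    ((tot m : ℂ) • ket m : L2 (Fin n → ℕ)) m' = (tot m' : ℂ) * ket m m' := by
  simp only [lp.coeFn_smul, Pi.smul_apply, smul_eq_mul, ket_apply]
  split_ifs with h
  · rw [h]
  · simp

theorem mem_dirac (v : Double (L2 (Fin n → ℕ))) :
    v ∈ (dirac n).domain ↔ v.fst ∈ (numberOp n).domain ∧ v.snd ∈ (numberOp n).domain :=
  and_comm

theorem dirac_fst (v : (dirac n).domain) (m : Fin n → ℕ) :
    (dirac n v).fst m = (tot m : ℂ) * (v : Double (L2 (Fin n → ℕ))).snd m := rfl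

theorem dirac_snd (v : (dirac n).domain) (m : Fin n → ℕ) :
    (dirac n v).snd m = (tot m : ℂ) * (v : Double (L2 (Fin n → ℕ))).fst m := rfl

theorem mem_dirac_of {v w : Double (L2 (Fin n → ℕ))} (h1 : ∀ m, w.fst m = (tot m : ℂ) * v.snd m)
    (h2 : ∀ m, w.snd m = (tot m : ℂ) * v.fst m) :
    ∃ hv : v ∈ (dirac n).domain, dirac n ⟨v, hv⟩ = w := by
  obtain ⟨h3, h4⟩ := mem_numberOp_of h1
  obtain ⟨h5, h6⟩ := mem_numberOp_of h2
  exact ⟨(mem_dirac v).2 ⟨h5, h3⟩, double_ext h4 h6⟩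

theorem inlD_ket_mem (m : Fin n → ℕ) : ∃ h : inlD (ket m) ∈ (dirac n).domain,
    dirac n ⟨inlD (ket m), h⟩ = (tot m : ℂ) • inrD (ket m) := by
  refine mem_dirac_of (fun m' => ?_) fun m' => ?_
  · simp
  · exact tot_smul_ket m m'

theorem inrD_ket_mem (m : Fin n → ℕ) : ∃ h : inrD (ket m) ∈ (dirac n).domain,
    dirac n ⟨inrD (ket m), h⟩ = (tot m : ℂ) • inlD (ket m) := by
  refine mem_dirac_of (fun m' => ?_) fun m' => ?_
  · exact tot_smul_ket m m'
  · simp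

theorem inner_inlD_left (v : L2 (Fin n → ℕ)) (w : Double (L2 (Fin n → ℕ))) :
    ⟪inlD v, w⟫_ℂ = ⟪v, w.fst⟫_ℂ := by
  simp [WithLp.prod_inner_apply]

theorem inner_inrD_left (v : L2 (Fin n → ℕ)) (w : Double (L2 (Fin n → ℕ))) :
    ⟪inrD v, w⟫_ℂ = ⟪v, w.snd⟫_ℂ := by
  simp [WithLp.prod_inner_apply]

/-- Totality of the vectors `|m⟩ ⊕ 0` and `0 ⊕ |m⟩`; it gives both the density of the domain and the
Hilbert basis of `exists_doubleBasis`. -/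
theorem orthonormal_ket_aux (w : Double (L2 (Fin n → ℕ)))
    (h1 : ∀ m, ⟪inlD (ket m), w⟫_ℂ = 0) (h2 : ∀ m, ⟪inrD (ket m), w⟫_ℂ = 0) : w = 0 := by
  refine double_ext ?_ ?_
  · ext m
    simpa [inner_inlD_left, inner_ket_left] using h1 m
  · ext m
    simpa [inner_inrD_left, inner_ket_left] using h2 m

theorem dense_dirac : Dense ((dirac n).domain : Set (Double (L2 (Fin n → ℕ)))) := by
  rw [Submodule.dense_iff_topologicalClosure_eq_top, Submodule.topologicalClosure_eq_top_iff,
    Submodule.eq_bot_iff]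
  intro w hw
  rw [Submodule.mem_orthogonal] at hw
  exact orthonormal_ket_aux w (fun m => hw _ (inlD_ket_mem m).1) fun m => hw _ (inrD_ket_mem m).1

theorem inner_numberOp (v w : (numberOp n).domain) :
    ⟪numberOp n v, (w : L2 (Fin n → ℕ))⟫_ℂ = ⟪(v : L2 (Fin n → ℕ)), numberOp n w⟫_ℂ := by
  rw [lp.inner_eq_tsum, lp.inner_eq_tsum]
  refine tsum_congr fun m => ?_
  rw [numberOp_apply, numberOp_apply]
  simp [mul_left_comm, mul_assoc]

theorem isSelfAdjoint_dirac : IsSelfAdjoint (dirac n) := by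
  rw [LinearPMap.isSelfAdjoint_def]
  have h1 : (dirac n).IsFormalAdjoint (dirac n) := by
    intro v w
    obtain ⟨hv1, hv2⟩ := (mem_dirac _).1 v.2
    obtain ⟨hw1, hw2⟩ := (mem_dirac _).1 w.2
    rw [WithLp.prod_inner_apply, WithLp.prod_inner_apply, add_comm]
    exact congrArg₂ (· + ·) (inner_numberOp ⟨_, hv1⟩ ⟨_, hw2⟩) (inner_numberOp ⟨_, hv2⟩ ⟨_, hw1⟩)
  -- Testing the adjoint on the basis vectors, which lie in the domain, determines its entries. They
  -- are those of `D y`, and maximality of the domain then puts `y` in it.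
  have h2 : ∀ y : (dirac n).adjoint.domain, ∃ hy : (y : Double (L2 (Fin n → ℕ))) ∈ (dirac n).domain,
      dirac n ⟨y, hy⟩ = (dirac n).adjoint y := by
    intro y
    have h3 : ∀ x : (dirac n).domain, ⟪(x : Double (L2 (Fin n → ℕ))), (dirac n).adjoint y⟫_ℂ
        = ⟪dirac n x, (y : Double (L2 (Fin n → ℕ)))⟫_ℂ := by
      intro x
      rw [← inner_conj_symm, LinearPMap.adjoint_isFormalAdjoint dense_dirac y x, inner_conj_symm]
    refine mem_dirac_of (fun m => ?_) fun m => ?_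
    · obtain ⟨h, h'⟩ := inlD_ket_mem m
      have h4 := h3 ⟨_, h⟩
      rw [h'] at h4
      simpa [inner_inlD_left, inner_inrD_left, inner_ket_left, inner_smul_left, mul_comm] using h4
    · obtain ⟨h, h'⟩ := inrD_ket_mem m
      have h4 := h3 ⟨_, h⟩
      rw [h'] at h4
      simpa [inner_inlD_left, inner_inrD_left, inner_ket_left, inner_smul_left, mul_comm] using h4
  refine le_antisymm ?_ (h1.le_adjoint dense_dirac)
  refine ⟨fun y hy => (h2 ⟨y, hy⟩).1, fun x y hxy => ?_⟩
  obtain ⟨h, h'⟩ := h2 x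
  rw [← h']
  congr 1
  exact Subtype.ext hxy

theorem grading_anticomm_dirac (v : (dirac n).domain) :
    ∃ h : grading (v : Double (L2 (Fin n → ℕ))) ∈ (dirac n).domain,
      dirac n ⟨grading v, h⟩ = -grading (dirac n v) := by
  refine mem_dirac_of (fun m => ?_) fun m => ?_
  · simp [grading, dirac_fst]
  · simp [grading, dirac_snd]

theorem finite_tot_lt (n : ℕ) (N : ℝ) : {m : Fin n → ℕ | (tot m : ℝ) ≤ N}.Finite := by
  refine (Set.finite_Iic (fun _ : Fin n => ⌊N⌋₊)).subset fun m hm i => ?_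
  refine Nat.le_floor (le_trans ?_ hm)
  exact_mod_cast Finset.single_le_sum (f := m) (fun _ _ => Nat.zero_le _) (Finset.mem_univ i)

theorem abs_im_le_norm_sub (μ : ℂ) (N : ℕ) : |μ.im| ≤ ‖(N : ℂ) - μ‖ := by
  have := Complex.abs_im_le_norm ((N : ℂ) - μ)
  simpa using this

theorem abs_im_le_norm_add (μ : ℂ) (N : ℕ) : |μ.im| ≤ ‖(N : ℂ) + μ‖ := by
  have := Complex.abs_im_le_norm ((N : ℂ) + μ)
  simpa using this

/-- Coefficients decaying like `1 / (|m| + 1)` tend to zero. -/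
theorem tendsto_cofinite_of_tot {c : (Fin n → ℕ) → ℂ} {C : ℝ}
    (h : ∀ m, ‖c m‖ * tot m ≤ C) : Filter.Tendsto c Filter.cofinite (nhds 0) := by
  rw [Metric.tendsto_nhds]
  intro ε hε
  rw [Filter.eventually_cofinite]
  refine (finite_tot_lt n (C / ε)).subset fun m hm => ?_
  simp only [dist_zero_right, Set.mem_ofPred_eq, not_lt] at hm ⊢
  rw [le_div_iff₀ hε]
  nlinarith [h m, Nat.cast_nonneg (α := ℝ) (tot m)]

/-- With `A = (|D| - μ)⁻¹` and `B = (|D| + μ)⁻¹`, the resolvent is `A` on the eigenspace `F = 1` and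
`-B` on `F = -1`, that is `((A - B) + (A + B)F)/2`. The entries of `A` and `B` are bounded by `1/|im
μ|` and tend to zero. -/
theorem compact_resolvent_dirac {μ : ℂ} (hμ : μ.im ≠ 0) :
    ∃ R : Double (L2 (Fin n → ℕ)) →L[ℂ] Double (L2 (Fin n → ℕ)),
      IsResolvent (dirac n) μ R ∧ IsCompactOperator R := by
  have hμ0 : 0 < |μ.im| := abs_pos.2 hμ
  have hm0 : ∀ N : ℕ, (N : ℂ) - μ ≠ 0 := fun N => norm_pos_iff.1
    (hμ0.trans_le (abs_im_le_norm_sub μ N))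
  have hp0 : ∀ N : ℕ, (N : ℂ) + μ ≠ 0 := fun N => norm_pos_iff.1
    (hμ0.trans_le (abs_im_le_norm_add μ N))
  let a : (Fin n → ℕ) → ℂ := fun m => ((tot m : ℂ) - μ)⁻¹
  let b : (Fin n → ℕ) → ℂ := fun m => ((tot m : ℂ) + μ)⁻¹
  have ha : ∀ m, ‖a m‖ ≤ |μ.im|⁻¹ := fun m => by
    rw [norm_inv]
    exact inv_anti₀ hμ0 (abs_im_le_norm_sub μ _)
  have hb : ∀ m, ‖b m‖ ≤ |μ.im|⁻¹ := fun m => by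
    rw [norm_inv]
    exact inv_anti₀ hμ0 (abs_im_le_norm_add μ _)
  -- The identity `‖m‖₁ a = 1 + μ a` turns boundedness of the entries into decay.
  have hat : ∀ m, ‖a m‖ * tot m ≤ 1 + |μ.im|⁻¹ * ‖μ‖ := fun m => by
    have h1 : a m * tot m = 1 + a m * μ := by
      simp only [a]
      field_simp [hm0]
      ring
    have h2 : ‖a m‖ * tot m = ‖a m * tot m‖ := by rw [norm_mul, Complex.norm_natCast]
    rw [h2, h1]
    refine (norm_add_le _ _).trans ?_
    rw [norm_one, norm_mul]
    gcongr
    exact ha m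
  have hbt : ∀ m, ‖b m‖ * tot m ≤ 1 + |μ.im|⁻¹ * ‖μ‖ := fun m => by
    have h1 : b m * tot m = 1 - b m * μ := by
      simp only [b]
      field_simp [hp0]
      ring
    have h2 : ‖b m‖ * tot m = ‖b m * tot m‖ := by rw [norm_mul, Complex.norm_natCast]
    rw [h2, h1]
    refine (norm_sub_le _ _).trans ?_
    rw [norm_one, norm_mul]
    gcongr
    exact hb m
  have hC : 0 < |μ.im|⁻¹ := inv_pos.2 hμ0
  have ca := isCompactOperator_diagOp a hC ha (tendsto_cofinite_of_tot hat)
  have cb := isCompactOperator_diagOp b hC hb (tendsto_cofinite_of_tot hbt)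
  set A := diagOp a hC ha
  set B := diagOp b hC hb
  have cS : IsCompactOperator (blockDiag (A - B) (A - B)) :=
    isCompactOperator_blockDiag (ca.sub cb) (ca.sub cb)
  have cT : IsCompactOperator (blockDiag (A + B) (A + B)) :=
    isCompactOperator_blockDiag (ca.add cb) (ca.add cb)
  let R : Double (L2 (Fin n → ℕ)) →L[ℂ] Double (L2 (Fin n → ℕ)) :=
    (1 / 2 : ℂ) • (blockDiag (A - B) (A - B) + blockDiag (A + B) (A + B) * flipOp)
  have hR1 : ∀ v m, (R v).fst m
      = (1 / 2) * ((a m - b m) * v.fst m + (a m + b m) * v.snd m) := by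
    intro v m
    change (1 / 2 : ℂ) * ((A v.fst m - B v.fst m) + (A v.snd m + B v.snd m)) = _
    simp only [A, B, diagOp_apply]
    ring
  have hR2 : ∀ v m, (R v).snd m
      = (1 / 2) * ((a m - b m) * v.snd m + (a m + b m) * v.fst m) := by
    intro v m
    change (1 / 2 : ℂ) * ((A v.snd m - B v.snd m) + (A v.fst m + B v.fst m)) = _
    simp only [A, B, diagOp_apply]
    ring
  refine ⟨R, ⟨fun v => ?_, fun v => ?_⟩, ?_⟩
  · have h1 := hR1 v
    have h2 := hR2 v
    set w := R v
    have h3 : ∀ m, (tot m : ℂ) * a m = 1 + μ * a m := fun m => by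
      simp only [a]
      field_simp [hm0]
      ring
    have h4 : ∀ m, (tot m : ℂ) * b m = 1 - μ * b m := fun m => by
      simp only [b]
      field_simp [hp0]
      ring
    -- The image of `R v` under `D` has to be `v + μ R v`.
    obtain ⟨h, h'⟩ := mem_dirac_of (v := w) (w := v + μ • w) (fun m => by
        change v.fst m + μ * w.fst m = _
        rw [h1, h2]
        linear_combination (-(1 / 2) * (v.snd m + v.fst m)) * h3 m
          + ((1 / 2) * (v.snd m - v.fst m)) * h4 m) (fun m => by
        change v.snd m + μ * w.snd m = _
        rw [h1, h2]
        linear_combination (-(1 / 2) * (v.snd m + v.fst m)) * h3 m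
          + ((1 / 2) * (v.fst m - v.snd m)) * h4 m)
    exact ⟨h, by rw [h']; abel⟩
  · have h3 : ∀ m, ((tot m : ℂ) - μ) * a m = 1 := fun m => mul_inv_cancel₀ (hm0 _)
    have h4 : ∀ m, ((tot m : ℂ) + μ) * b m = 1 := fun m => mul_inv_cancel₀ (hp0 _)
    refine double_ext ?_ ?_
    · ext m
      rw [hR1]
      change (1 / 2 : ℂ) * ((a m - b m) * ((dirac n v).fst m - μ * (v : Double (L2 (Fin n → ℕ))).fst m)
        + (a m + b m) * ((dirac n v).snd m - μ * (v : Double (L2 (Fin n → ℕ))).snd m)) = _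
      rw [dirac_fst, dirac_snd]
      linear_combination ((1 / 2) * ((v : Double (L2 (Fin n → ℕ))).snd m
        + (v : Double (L2 (Fin n → ℕ))).fst m)) * h3 m
        + ((1 / 2) * ((v : Double (L2 (Fin n → ℕ))).fst m
        - (v : Double (L2 (Fin n → ℕ))).snd m)) * h4 m
    · ext m
      rw [hR2]
      change (1 / 2 : ℂ) * ((a m - b m) * ((dirac n v).snd m - μ * (v : Double (L2 (Fin n → ℕ))).snd m)
        + (a m + b m) * ((dirac n v).fst m - μ * (v : Double (L2 (Fin n → ℕ))).fst m)) = _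
      rw [dirac_fst, dirac_snd]
      linear_combination ((1 / 2) * ((v : Double (L2 (Fin n → ℕ))).snd m
        + (v : Double (L2 (Fin n → ℕ))).fst m)) * h3 m
        + ((1 / 2) * ((v : Double (L2 (Fin n → ℕ))).snd m
        - (v : Double (L2 (Fin n → ℕ))).fst m)) * h4 m
  · exact (cS.add (cT.comp_clm flipOp)).smul (1 / 2 : ℂ)

end dirac

/-! ### Trace class operators that are diagonal in an orthonormal basis. -/

section traceClass

variable {H : Type*} [NormedAddCommGroup H] [InnerProductSpace ℂ H]
variable {ι κ : Type*}

theorem hilbertBasis_ext (b : HilbertBasis ι ℂ H) {x y : H}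
    (h : ∀ i, ⟪b i, x⟫_ℂ = ⟪b i, y⟫_ℂ) : x = y := by
  apply b.repr.injective
  ext i
  rw [b.repr_apply_apply, b.repr_apply_apply, h]

theorem hasSum_norm_inner_sq (b : HilbertBasis ι ℂ H) (x : H) :
    HasSum (fun i => ‖⟪b i, x⟫_ℂ‖ ^ 2) (‖x‖ ^ 2) := by
  have h := Complex.hasSum_re (b.hasSum_inner_mul_inner x x)
  have h1 : (⟪x, x⟫_ℂ).re = ‖x‖ ^ 2 := inner_self_eq_norm_sq (𝕜 := ℂ) x
  rw [h1] at h
  convert h using 2 with i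
  rw [← inner_conj_symm x, ← Complex.normSq_eq_conj_mul_self, Complex.ofReal_re,
    Complex.normSq_eq_norm_sq]

variable [CompleteSpace H]

/-- The sum of the diagonal entries of a positive operator does not depend on the basis. -/
theorem summable_diag_of_nonneg {A : H →L[ℂ] H} (hA : 0 ≤ A) (b : HilbertBasis ι ℂ H)
    (c : HilbertBasis κ ℂ H) (h : Summable fun i => (⟪b i, A (b i)⟫_ℂ).re) :
    Summable fun j => (⟪c j, A (c j)⟫_ℂ).re := by
  -- With `S` the square root of `A`, the diagonal entry at `v` is `‖S v‖²`, to which Parseval's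
  -- identity applies.
  set S := CFC.sqrt A with hS
  have hS1 : S * S = A := CFC.sqrt_mul_sqrt_self A hA
  have hS2 : star S = S := (IsSelfAdjoint.of_nonneg (CFC.sqrt_nonneg A)).star_eq
  have hS3 : ∀ v w : H, ⟪S v, w⟫_ℂ = ⟪v, S w⟫_ℂ := fun v w => by
    conv_lhs => rw [← hS2, ContinuousLinearMap.star_eq_adjoint,
      ContinuousLinearMap.adjoint_inner_left]
  have key : ∀ v : H, (⟪v, A v⟫_ℂ).re = ‖S v‖ ^ 2 := fun v => by
    have h1 : A v = S (S v) := by rw [← hS1]; rfl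
    rw [h1, ← hS3]
    exact inner_self_eq_norm_sq (𝕜 := ℂ) (S v)
  simp only [key] at h ⊢
  have h1 : ∀ i, HasSum (fun j => ‖⟪c j, S (b i)⟫_ℂ‖ ^ 2) (‖S (b i)‖ ^ 2) := fun i =>
    hasSum_norm_inner_sq c _
  have h2 : ∀ j, HasSum (fun i => ‖⟪c j, S (b i)⟫_ℂ‖ ^ 2) (‖S (c j)‖ ^ 2) := fun j => by
    have h3 := hasSum_norm_inner_sq b (S (c j))
    convert h3 using 2 with i
    rw [← hS3, ← inner_conj_symm, RCLike.norm_conj]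
  -- The family of all `|⟨c_j, S b_i⟩|²` is nonnegative. Summing over `j` first gives the trace in
  -- the basis `b`, summing over `i` first the trace in the basis `c`.
  have h3 : Summable fun x : ι × κ => ‖⟪c x.2, S (b x.1)⟫_ℂ‖ ^ 2 := by
    refine (summable_prod_of_nonneg fun x => sq_nonneg _).2 ⟨fun i => (h1 i).summable, ?_⟩
    simpa only [(h1 _).tsum_eq] using h
  have h4 := ((summable_prod_of_nonneg fun x => sq_nonneg _).1 h3.prod_symm).2
  convert h4 using 2 with j
  exact (h2 j).tsum_eq.symm

theorem adjoint_apply_of_diag (b : HilbertBasis ι ℂ H) {T : H →L[ℂ] H} {c : ι → ℝ}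
    (h : ∀ i, T (b i) = (c i : ℂ) • b i) (i : ι) : T.adjoint (b i) = (c i : ℂ) • b i := by
  classical
  refine hilbertBasis_ext b fun j => ?_
  rw [ContinuousLinearMap.adjoint_inner_right, h, inner_smul_left, inner_smul_right,
    orthonormal_iff_ite.1 b.orthonormal]
  split_ifs with hij
  · rw [hij, Complex.conj_ofReal]
  · simp

/-- In the basis, `⟨v, T v⟩` is the sum of the `c_i |⟨b_i, v⟩|²`. -/
theorem nonneg_of_diag (b : HilbertBasis ι ℂ H) {T : H →L[ℂ] H} {c : ι → ℝ}
    (h : ∀ i, T (b i) = (c i : ℂ) • b i) (hc : ∀ i, 0 ≤ c i) : 0 ≤ T := by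
  have h1 : ∀ i v, ⟪b i, T v⟫_ℂ = c i * ⟪b i, v⟫_ℂ := fun i v => by
    rw [← ContinuousLinearMap.adjoint_inner_left, adjoint_apply_of_diag b h, inner_smul_left,
      Complex.conj_ofReal]
  have h2 : T.adjoint = T := by
    ext v
    refine hilbertBasis_ext b fun i => ?_
    rw [ContinuousLinearMap.adjoint_inner_right, h1, h, inner_smul_left, Complex.conj_ofReal]
  rw [ContinuousLinearMap.nonneg_iff_isPositive, ContinuousLinearMap.isPositive_def']
  refine ⟨h2, fun v => ?_⟩
  rw [ContinuousLinearMap.reApplyInnerSelf_apply, ← inner_re_symm]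
  have h3 := Complex.hasSum_re (b.hasSum_inner_mul_inner v (T v))
  refine h3.nonneg fun i => ?_
  rw [h1, ← inner_conj_symm v, mul_left_comm, ← Complex.normSq_eq_conj_mul_self,
    ← Complex.ofReal_mul, Complex.ofReal_re]
  exact mul_nonneg (hc i) (Complex.normSq_nonneg _)

/-- `IsTraceClass` refers to some unspecified basis, indexed by a subset of `H`. Since `T` is
nonnegative it is its own absolute value, and independence of the basis allows passing to and from
`b`. -/
theorem isTraceClass_iff_of_diag (b : HilbertBasis ι ℂ H) {T : H →L[ℂ] H} {c : ι → ℝ}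
    (h : ∀ i, T (b i) = (c i : ℂ) • b i) (hc : ∀ i, 0 ≤ c i) : IsTraceClass T ↔ Summable c := by
  have hT := nonneg_of_diag b h hc
  have h1 : ∀ i, (⟪b i, T (b i)⟫_ℂ).re = c i := fun i => by
    rw [h, inner_smul_right, inner_self_eq_norm_sq_to_K, b.orthonormal.1 i]
    simp
  unfold IsTraceClass
  rw [CFC.abs_of_nonneg T hT]
  constructor
  · rintro ⟨w, b', h'⟩
    simpa only [h1] using summable_diag_of_nonneg hT b' b h'
  · intro h'
    obtain ⟨w, b', -⟩ := exists_hilbertBasis ℂ H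
    refine ⟨w, b', summable_diag_of_nonneg hT b b' ?_⟩
    simpa only [h1] using h'

end traceClass

/-! ### Counting multi-indices of given total degree, and the resulting series. -/

section counting

variable {n : ℕ}

theorem card_fiber_tot (n M : ℕ) : Nat.card {m : Fin n → ℕ // tot m = M} = (n + M - 1).choose M := by
  have h := Nat.card_congr (Sym.equivNatSumOfFintype (Fin n) M)
  rw [Nat.card_eq_fintype_card, Sym.card_sym_eq_choose, Fintype.card_fin] at h
  exact h.symm

theorem finite_fiber_tot (n M : ℕ) : Finite {m : Fin n → ℕ // tot m = M} :=
  Finite.of_equiv _ (Sym.equivNatSumOfFintype (Fin n) M)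

/-- The terms are nonnegative, so they can be grouped along the finite fibres of `tot`. -/
theorem summable_tot_iff {g : ℕ → ℝ} (hg : ∀ M, 0 ≤ g M) :
    (Summable fun m : Fin n → ℕ => g (tot m)) ↔
      Summable fun M : ℕ => ((n + M - 1).choose M : ℝ) * g M := by
  have hfin := finite_fiber_tot n
  have h1 : ∀ (M : ℕ) (x : {m : Fin n → ℕ // tot m = M}), g (tot x.1) = g M := fun M x => by
    rw [x.2]
  rw [← (Equiv.sigmaFiberEquiv (tot : (Fin n → ℕ) → ℕ)).summable_iff]
  have h2 : ((fun m : Fin n → ℕ => g (tot m)) ∘ (Equiv.sigmaFiberEquiv (tot : (Fin n → ℕ) → ℕ)))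
      = fun x => g x.1 := by
    funext x
    exact h1 x.1 x.2
  rw [h2, summable_sigma_of_nonneg fun x => hg _]
  simp only [tsum_const, card_fiber_tot, nsmul_eq_mul]
  exact ⟨fun h => h.2, fun h => ⟨fun M => Summable.of_finite, h⟩⟩

/-- For `d = n - 1` the binomial coefficient is `(M+d).choose d ≤ (M+d)^d`, and `M + d ≤ (d+1) M` as
`M ≥ 1`. Together with `pow_le_choose_mul`, it is of order `M^(n-1)`. -/
theorem choose_le_pow_mul (hn : 1 ≤ n) {M : ℕ} (hM : 1 ≤ M) :
    ((n + M - 1).choose M : ℝ) ≤ (n : ℝ) ^ (n - 1) * (M : ℝ) ^ (n - 1) := by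
  obtain ⟨d, rfl⟩ := Nat.exists_eq_add_of_le' hn
  have h1 : (d + 1 + M - 1).choose M = (M + d).choose d := by
    rw [show d + 1 + M - 1 = M + d by omega, Nat.choose_symm_add]
  have h2 : M + d ≤ (d + 1) * M := by nlinarith
  rw [h1, ← mul_pow]
  calc ((M + d).choose d : ℝ) ≤ ((M + d : ℕ) : ℝ) ^ d := by exact_mod_cast Nat.choose_le_pow _ _
    _ ≤ _ := by
      simp only [Nat.add_sub_cancel]
      gcongr
      exact_mod_cast h2

theorem pow_le_choose_mul (hn : 1 ≤ n) (M : ℕ) :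
    (M : ℝ) ^ (n - 1) ≤ (n - 1).factorial * ((n + M - 1).choose M : ℝ) := by
  obtain ⟨d, rfl⟩ := Nat.exists_eq_add_of_le' hn
  have h1 : (d + 1 + M - 1).choose M = (M + d).choose d := by
    rw [show d + 1 + M - 1 = M + d by omega, Nat.choose_symm_add]
  rw [h1]
  simp only [Nat.add_sub_cancel]
  have h2 := Nat.pow_sub_le_descFactorial (M + d) d
  rw [Nat.descFactorial_eq_factorial_mul_choose, show M + d + 1 - d = M + 1 by omega] at h2
  have h3 : M ^ d ≤ (M + 1) ^ d := Nat.pow_le_pow_left (Nat.le_succ M) d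
  exact_mod_cast h3.trans h2

/-- The eigenvalues of `|D|^{-s}`. -/
def negPow (s : ℝ) (M : ℕ) : ℝ := if M = 0 then 0 else (M : ℝ) ^ (-s)

theorem negPow_nonneg (s : ℝ) (M : ℕ) : 0 ≤ negPow s M := by
  unfold negPow
  split_ifs
  · exact le_rfl
  · exact Real.rpow_nonneg (Nat.cast_nonneg M) _

theorem summable_negPow_iff (hn : 1 ≤ n) (s : ℝ) :
    (Summable fun m : Fin n → ℕ => negPow s (tot m)) ↔ (n : ℝ) < s := by
  -- The shift by one drops the degree zero, where `negPow` is zero by convention and the upper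
  -- bound for the binomial coefficient is not available.
  rw [summable_tot_iff (negPow_nonneg s), ← summable_nat_add_iff 1]
  have h1 : (n : ℝ) < s ↔ ((n - 1 : ℕ) : ℝ) + -s < -1 := by
    rw [Nat.cast_sub hn]
    push_cast
    constructor <;> intro h <;> linarith
  rw [h1, ← Real.summable_nat_rpow,
    ← summable_nat_add_iff (f := fun M : ℕ => (M : ℝ) ^ (((n - 1 : ℕ) : ℝ) + -s)) 1]
  have h2 : ∀ M : ℕ, ((M + 1 : ℕ) : ℝ) ^ (((n - 1 : ℕ) : ℝ) + -s)
      = ((M + 1 : ℕ) : ℝ) ^ (n - 1) * negPow s (M + 1) := fun M => by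
    rw [Real.rpow_add (by positivity), Real.rpow_natCast, negPow, if_neg (Nat.succ_ne_zero M)]
  rw [show (fun M : ℕ => ((M + 1 : ℕ) : ℝ) ^ (((n - 1 : ℕ) : ℝ) + -s))
      = fun M => ((M + 1 : ℕ) : ℝ) ^ (n - 1) * negPow s (M + 1) from funext h2]
  constructor
  · intro h
    refine Summable.of_nonneg_of_le (fun M => ?_) (fun M => ?_)
      (h.mul_left ((n - 1).factorial : ℝ))
    · exact mul_nonneg (by positivity) (negPow_nonneg s _)
    · rw [← mul_assoc]
      exact mul_le_mul_of_nonneg_right (pow_le_choose_mul hn _) (negPow_nonneg s _)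
  · intro h
    refine Summable.of_nonneg_of_le (fun M => ?_) (fun M => ?_)
      (h.mul_left ((n : ℝ) ^ (n - 1)))
    · exact mul_nonneg (by positivity) (negPow_nonneg s _)
    · rw [← mul_assoc]
      exact mul_le_mul_of_nonneg_right (choose_le_pow_mul hn (Nat.succ_pos M)) (negPow_nonneg s _)

theorem summable_tot_mul_pow (hn : 1 ≤ n) {t : ℝ} (ht0 : 0 ≤ t) (ht1 : t < 1) :
    Summable fun m : Fin n → ℕ => (tot m : ℝ) * t ^ tot m := by
  rw [summable_tot_iff (g := fun M => (M : ℝ) * t ^ M) fun M => by positivity]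
  have h := (summable_pow_mul_geometric_of_norm_lt_one n
    (r := t) (by rwa [Real.norm_of_nonneg ht0])).mul_left ((n : ℝ) ^ (n - 1))
  refine Summable.of_nonneg_of_le (fun M => by positivity) (fun M => ?_) h
  rcases Nat.eq_zero_or_pos M with rfl | hM
  · simp only [Nat.cast_zero, zero_mul, mul_zero]
    positivity
  · have h1 : (M : ℝ) ^ n = (M : ℝ) ^ (n - 1) * M := by
      rw [← pow_succ, Nat.sub_add_cancel hn]
    rw [h1]
    have := mul_le_mul_of_nonneg_right (choose_le_pow_mul hn hM)
      (show (0 : ℝ) ≤ (M : ℝ) * t ^ M by positivity)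
    linarith

end counting

/-! ### The powers of `|D|` and the metric dimension. -/

section metricDimension

variable {n : ℕ}

/-- The basis of `ℓ²(ℕⁿ) ⊕ ℓ²(ℕⁿ)` that consists of the vectors `|m⟩ ⊕ 0` and `0 ⊕ |m⟩`. -/
theorem exists_doubleBasis (n : ℕ) :
    ∃ b : HilbertBasis ((Fin n → ℕ) ⊕ (Fin n → ℕ)) ℂ (Double (L2 (Fin n → ℕ))),
      (∀ m, b (Sum.inl m) = inlD (ket m)) ∧ ∀ m, b (Sum.inr m) = inrD (ket m) := by
  classical
  let f : (Fin n → ℕ) ⊕ (Fin n → ℕ) → Double (L2 (Fin n → ℕ)) :=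
    Sum.elim (fun m => inlD (ket m)) fun m => inrD (ket m)
  have hf : Orthonormal ℂ f := by
    rw [orthonormal_iff_ite]
    rintro (m | m) (m' | m')
    · simp [f, inner_ket_left, ket_apply]
    · simp [f]
    · simp [f]
    · simp [f, inner_ket_left, ket_apply]
  have hf' : (Submodule.span ℂ (Set.range f))ᗮ = ⊥ := by
    rw [Submodule.eq_bot_iff]
    intro w hw
    rw [Submodule.mem_orthogonal] at hw
    exact orthonormal_ket_aux w
      (fun m => hw _ (Submodule.subset_span ⟨Sum.inl m, rfl⟩))
      fun m => hw _ (Submodule.subset_span ⟨Sum.inr m, rfl⟩)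
  refine ⟨HilbertBasis.mkOfOrthogonalEqBot hf hf', fun m => ?_, fun m => ?_⟩ <;>
  · rw [HilbertBasis.coe_mkOfOrthogonalEqBot]
    rfl

/-- `IsAbsPowNeg` only speaks of eigenvectors of `D`. These are the sum and the difference of `|m⟩ ⊕
0` and `0 ⊕ |m⟩`, with opposite eigenvalues, and `|D|^{-s}` has the same value on both, so it can be
read off on the summands. -/
theorem IsAbsPowNeg.apply_ket {s : ℝ} {T : Double (L2 (Fin n → ℕ)) →L[ℂ] Double (L2 (Fin n → ℕ))}
    (hT : IsAbsPowNeg (dirac n) s T) (m : Fin n → ℕ) :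
    T (inlD (ket m)) = (negPow s (tot m) : ℂ) • inlD (ket m) ∧
      T (inrD (ket m)) = (negPow s (tot m) : ℂ) • inrD (ket m) := by
  obtain ⟨h1, h1'⟩ := inlD_ket_mem m
  obtain ⟨h2, h2'⟩ := inrD_ket_mem m
  have hadd := hT (⟨_, h1⟩ + ⟨_, h2⟩) (tot m) (by
    rw [LinearPMap.map_add, h1', h2']
    simp [add_comm])
  have hsub := hT (⟨_, h1⟩ - ⟨_, h2⟩) (-(tot m : ℝ)) (by
    rw [LinearPMap.map_sub, h1', h2']
    simp [add_comm, sub_eq_add_neg])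
  have key : ∀ c : ℝ, |c| = tot m → ∀ v : Double (L2 (Fin n → ℕ)),
      (if c = 0 then 0 else ((|c| ^ (-s) : ℝ) : ℂ) • v) = (negPow s (tot m) : ℂ) • v := by
    intro c hc v
    have h3 : c = 0 ↔ tot m = 0 := by
      rw [← abs_eq_zero, hc, Nat.cast_eq_zero]
    simp only [h3, negPow, hc]
    split_ifs <;> simp
  rw [key _ (by simp)] at hadd hsub
  simp only [Submodule.coe_add, Submodule.coe_sub, map_add, map_sub, smul_add, smul_sub]
    at hadd hsub
  constructor
  · have := congrArg₂ (· + ·) hadd hsub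
    simp only [add_add_sub_cancel] at this
    rw [← two_smul ℂ, ← two_smul ℂ] at this
    exact smul_right_injective _ two_ne_zero this
  · have := congrArg₂ (· - ·) hadd hsub
    simp only [add_sub_sub_cancel] at this
    rw [← two_smul ℂ, ← two_smul ℂ] at this
    exact smul_right_injective _ two_ne_zero this

theorem norm_negPow_le {s : ℝ} (hs : 0 ≤ s) (M : ℕ) : ‖(negPow s M : ℂ)‖ ≤ 1 := by
  rw [Complex.norm_real, Real.norm_of_nonneg (negPow_nonneg s M), negPow]
  split_ifs with h
  · exact zero_le_one
  · exact Real.rpow_le_one_of_one_le_of_nonpos (by exact_mod_cast Nat.one_le_iff_ne_zero.2 h)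
      (by linarith)

/-- An eigenvector of `D` with eigenvalue `c` is an eigenvector of `D² = |D|²` with eigenvalue `c²`,
so it is supported on the `m` with `‖m‖₁ = |c|`. There the diagonal operator acts as the required
scalar. It is bounded because `s ≥ 0`. -/
theorem exists_isAbsPowNeg {s : ℝ} (hs : 0 ≤ s) : ∃ T, IsAbsPowNeg (dirac n) s T := by
  let A : Op (Fin n → ℕ) := diagOp (fun m => (negPow s (tot m) : ℂ)) one_pos
    fun m => norm_negPow_le hs _
  refine ⟨blockDiag A A, fun v c hv => ?_⟩
  have h1 : ∀ m, (tot m : ℂ) * (v : Double (L2 (Fin n → ℕ))).snd m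
      = c * (v : Double (L2 (Fin n → ℕ))).fst m := fun m => by
    rw [← dirac_fst, hv]
    rfl
  have h2 : ∀ m, (tot m : ℂ) * (v : Double (L2 (Fin n → ℕ))).fst m
      = c * (v : Double (L2 (Fin n → ℕ))).snd m := fun m => by
    rw [← dirac_snd, hv]
    rfl
  generalize (v : Double (L2 (Fin n → ℕ))) = w at h1 h2 ⊢
  have h3 : ∀ m, (w.fst m = 0 ∧ w.snd m = 0) ∨ (tot m : ℝ) = |c| := fun m => by
    by_cases h : (tot m : ℝ) = |c|
    · exact Or.inr h
    · refine Or.inl ?_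
      have h4 : (tot m : ℝ) ^ 2 - c ^ 2 ≠ 0 := by
        rw [sub_ne_zero, ← sq_abs c]
        exact fun h5 => h ((sq_eq_sq₀ (Nat.cast_nonneg _) (abs_nonneg c)).1 h5)
      have h5 : (tot m : ℂ) ^ 2 - (c : ℂ) ^ 2 ≠ 0 := by exact_mod_cast h4
      constructor <;> refine (mul_eq_zero.1 ?_).resolve_left h5
      · linear_combination (tot m : ℂ) * h2 m + (c : ℂ) * h1 m
      · linear_combination (tot m : ℂ) * h1 m + (c : ℂ) * h2 m
  have h4 : ∀ m : Fin n → ℕ, (tot m : ℝ) = |c| →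
      negPow s (tot m) = if c = 0 then 0 else |c| ^ (-s) := fun m hm => by
    have : tot m = 0 ↔ c = 0 := by rw [← abs_eq_zero, ← hm, Nat.cast_eq_zero]
    simp only [negPow, this, hm]
  have h5 : (if c = 0 then 0 else ((|c| ^ (-s) : ℝ) : ℂ) • w)
      = (((if c = 0 then 0 else |c| ^ (-s) : ℝ) : ℝ) : ℂ) • w := by
    split_ifs <;> simp
  rw [h5]
  refine double_ext ?_ ?_
  · ext m
    rw [blockDiag_fst]
    simp only [A, diagOp_apply]
    change _ = _ * w.fst m
    rcases h3 m with h | h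
    · rw [h.1, mul_zero, mul_zero]
    · rw [h4 m h]
  · ext m
    rw [blockDiag_snd]
    simp only [A, diagOp_apply]
    change _ = _ * w.snd m
    rcases h3 m with h | h
    · rw [h.2, mul_zero, mul_zero]
    · rw [h4 m h]

theorem summable_elim_self_iff {I : Type*} {f : I → ℝ} : Summable (Sum.elim f f) ↔ Summable f := by
  refine ⟨fun h => ?_, fun h => Summable.sum _ ?_ ?_⟩
  · simpa [Function.comp_def] using h.comp_injective Sum.inl_injective
  · simpa [Function.comp_def] using h
  · simpa [Function.comp_def] using h

/-- Every candidate for `|D|^{-s}` has the same values on the basis, so the trace class condition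
can be decided without knowing that one exists. Existence is needed only for `s > n`, where the
exponent is nonnegative. -/
theorem absPowNegTraceClass_dirac_iff (hn : 1 ≤ n) (s : ℝ) :
    AbsPowNegTraceClass (dirac n) s ↔ (n : ℝ) < s := by
  obtain ⟨b, hb1, hb2⟩ := exists_doubleBasis n
  have key : ∀ T, IsAbsPowNeg (dirac n) s T → (IsTraceClass T ↔ (n : ℝ) < s) := by
    intro T hT
    rw [isTraceClass_iff_of_diag b (c := Sum.elim (fun m => negPow s (tot m))
      fun m => negPow s (tot m)), summable_elim_self_iff, summable_negPow_iff hn s]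
    · rintro (m | m)
      · rw [hb1]
        exact (hT.apply_ket m).1
      · rw [hb2]
        exact (hT.apply_ket m).2
    · rintro (m | m) <;> exact negPow_nonneg s _
  constructor
  · rintro ⟨T, hT, hT'⟩
    exact (key T hT).1 hT'
  · intro h
    obtain ⟨T, hT⟩ := exists_isAbsPowNeg (n := n) ((Nat.cast_nonneg n).trans h.le)
    exact ⟨T, hT, (key T hT).2 h⟩

theorem hasMetricDimension_dirac (hn : 1 ≤ n) : HasMetricDimension (dirac n) n := by
  have : {s : ℝ | 0 < s ∧ AbsPowNegTraceClass (dirac n) s} = Set.Ioi (n : ℝ) := by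
    ext s
    simp only [absPowNegTraceClass_dirac_iff hn, Set.mem_ofPred_eq, Set.mem_Ioi, and_iff_right_iff_imp]
    exact fun h => (Nat.cast_nonneg n).trans_lt h
  rw [HasMetricDimension, this]
  exact ⟨Set.nonempty_Ioi, isGLB_Ioi⟩

end metricDimension

/-! ### Words in the generators: degree, action of the circle, matrix coefficients. -/

section words

variable {n : ℕ} {q : ℝ}

/-- The index of a generator. -/
def Gen.idx : Gen n → ℕ
  | Gen.z i => i
  | Gen.zs i => i

/-- The exponent of `z_l` in a generator, where `z_l^*` counts as `-1`. -/
def Gen.expo (l : ℕ) : Gen n → ℤ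
  | Gen.z i => if i.val = l then 1 else 0
  | Gen.zs i => if i.val = l then -1 else 0

/-- The exponent of `z_l` in a word. -/
def expo (w : List (Gen n)) (l : ℕ) : ℤ := (w.map (Gen.expo l)).sum

theorem expo_cons (g : Gen n) (w : List (Gen n)) (l : ℕ) :
    expo (g :: w) l = g.expo l + expo w l := rfl

/-- The weighted degree of a word. -/
def wdeg (ℓ : Fin (n + 1) → ℕ+) (w : List (Gen n)) : ℤ := ∑ i : Fin (n + 1), (ℓ i : ℤ) * expo w i

/-- A generator as an element of the quantum sphere. -/
def Gen.toSphere (q : ℝ) : Gen n → QSphere n q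
  | Gen.z i => QSphere.z i
  | Gen.zs i => QSphere.zs i

/-- The product of the generators in a word. -/
def word (q : ℝ) (w : List (Gen n)) : QSphere n q := (w.map (Gen.toSphere q)).prod

theorem word_cons (g : Gen n) (w : List (Gen n)) : word q (g :: w) = g.toSphere q * word q w := rfl

theorem word_append (v w : List (Gen n)) : word q (v ++ w) = word q v * word q w := by
  simp [word]

theorem mem_span_word (a : QSphere n q) : a ∈ Submodule.span ℂ (Set.range (word (n := n) q)) := by
  induction a using QSphere.induction with
  | hc c =>
    rw [Algebra.algebraMap_eq_smul_one]
    exact Submodule.smul_mem _ _ (Submodule.subset_span ⟨[], rfl⟩)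
  | hz i => exact Submodule.subset_span ⟨[Gen.z i], by simp [word, Gen.toSphere]⟩
  | hzs i => exact Submodule.subset_span ⟨[Gen.zs i], by simp [word, Gen.toSphere]⟩
  | hmul a b ha hb =>
    have h := Submodule.mul_mem_mul ha hb
    rw [Submodule.span_mul_span] at h
    refine Submodule.span_mono ?_ h
    rintro _ ⟨_, ⟨v, rfl⟩, _, ⟨w, rfl⟩, rfl⟩
    exact ⟨v ++ w, word_append v w⟩
  | hadd a b ha hb => exact Submodule.add_mem _ ha hb

theorem wdeg_nil (ℓ : Fin (n + 1) → ℕ+) : wdeg ℓ [] = 0 := by simp [wdeg, expo]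

theorem wdeg_cons_z (ℓ : Fin (n + 1) → ℕ+) (i : Fin (n + 1)) (w : List (Gen n)) :
    wdeg ℓ (Gen.z i :: w) = ℓ i + wdeg ℓ w := by
  simp [wdeg, expo_cons, mul_add, Finset.sum_add_distrib, Gen.expo, ← Fin.ext_iff]

theorem wdeg_cons_zs (ℓ : Fin (n + 1) → ℕ+) (i : Fin (n + 1)) (w : List (Gen n)) :
    wdeg ℓ (Gen.zs i :: w) = -ℓ i + wdeg ℓ w := by
  simp [wdeg, expo_cons, mul_add, Finset.sum_add_distrib, Gen.expo, ← Fin.ext_iff]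

theorem action_word (ℓ : Fin (n + 1) → ℕ+) (t : Circle) (w : List (Gen n)) :
    QSphere.action ℓ t (word q w) = ((t : ℂ) ^ wdeg ℓ w) • word q w := by
  have ht : (t : ℂ) ≠ 0 := Circle.coe_ne_zero t
  induction w with
  | nil => simp [word, wdeg_nil]
  | cons g w ih =>
    rw [word_cons, map_mul, ih]
    cases g with
    | z i =>
      rw [Gen.toSphere, action_z, smul_mul_smul_comm, wdeg_cons_z, zpow_add₀ ht]
      simp
    | zs i =>
      rw [Gen.toSphere, ← QSphere.star_z, map_star, action_z, star_smul, smul_mul_smul_comm,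
        wdeg_cons_zs, zpow_add₀ ht, zpow_neg]
      congr 2
      rw [star_pow, zpow_natCast, ← inv_pow]
      congr 1
      rw [← Circle.coe_inv, Circle.coe_inv_eq_conj]
      rfl

theorem word_mem_QLens {ℓ : Fin (n + 1) → ℕ+} {w : List (Gen n)} (hw : wdeg ℓ w = 0) (N : ℕ) :
    word q w ∈ QLens q N ℓ := fun t _ => by rw [action_word, hw, zpow_zero, one_smul]

/-- A geometric sum whose ratio `t^d` differs from one, since the order `M` does not divide `d`,
while its `M`-th power is one. -/
theorem sum_pow_zpow_eq_zero {t : Circle} {M : ℕ} (ht : orderOf t = M) {d : ℤ} (hd : d ≠ 0)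
    (hM : d.natAbs < M) : ∑ j ∈ Finset.range M, ((t ^ j : Circle) : ℂ) ^ d = 0 := by
  have h1 : (t : ℂ) ^ d ≠ 1 := by
    intro h
    have h2 : t ^ d = 1 := Circle.coe_injective (by simpa using h)
    rw [← orderOf_dvd_iff_zpow_eq_one, ht] at h2
    have h3 := Int.natAbs_dvd_natAbs.2 h2
    rw [Int.natAbs_natCast] at h3
    exact absurd (Nat.le_of_dvd (Int.natAbs_pos.2 hd) h3) (by omega)
  have h4 : ((t : ℂ) ^ d) ^ M = 1 := by
    have h5 : t ^ M = 1 := ht ▸ pow_orderOf_eq_one t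
    have h6 : (t : ℂ) ^ M = 1 := by simpa using congrArg (fun x : Circle => (x : ℂ)) h5
    rw [← zpow_natCast, zpow_comm, zpow_natCast, h6, one_zpow]
  have h7 : ∀ j ∈ Finset.range M, ((t ^ j : Circle) : ℂ) ^ d = ((t : ℂ) ^ d) ^ j := fun j _ => by
    rw [Circle.coe_pow, ← zpow_natCast, ← zpow_natCast, zpow_comm]
  rw [Finset.sum_congr rfl h7, geom_sum_eq h1, h4, sub_self, zero_div]

/-- Invariant elements are linear combinations of words of degree zero. -/
theorem mem_span_word_of_mem_QProj {ℓ : Fin (n + 1) → ℕ+} {a : QSphere n q} (ha : a ∈ QProj q ℓ) :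
    a ∈ Submodule.span ℂ (word q '' {w : List (Gen n) | wdeg ℓ w = 0}) := by
  set W := Submodule.span ℂ (word q '' {w : List (Gen n) | wdeg ℓ w = 0}) with hW
  -- Integration over the circle is replaced by summation over a cyclic subgroup whose order exceeds
  -- the absolute degrees of the finitely many words involved; this kills every word of nonzero
  -- degree.
  have key : ∃ M₀ : ℕ, ∀ M : ℕ, M₀ < M → ∀ t : Circle, orderOf t = M →
      ∑ j ∈ Finset.range M, QSphere.action ℓ (t ^ j) a ∈ W := by
    have h1 := mem_span_word a
    -- Invariance is not inherited by the terms of a linear combination, so it must not enter the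
    -- induction.
    clear ha
    induction h1 using Submodule.span_induction with
    | mem x hx =>
      obtain ⟨w, rfl⟩ := hx
      refine ⟨(wdeg ℓ w).natAbs, fun M hM t ht => ?_⟩
      simp only [action_word, ← Finset.sum_smul]
      by_cases h : wdeg ℓ w = 0
      · exact W.smul_mem _ (Submodule.subset_span ⟨w, h, rfl⟩)
      · rw [sum_pow_zpow_eq_zero ht h hM, zero_smul]
        exact W.zero_mem
    | zero => exact ⟨0, fun M _ t _ => by simp⟩
    | add x y _ _ hx hy =>
      obtain ⟨M₁, h1⟩ := hx
      obtain ⟨M₂, h2⟩ := hy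
      refine ⟨max M₁ M₂, fun M hM t ht => ?_⟩
      simp only [map_add, Finset.sum_add_distrib]
      exact W.add_mem (h1 M (lt_of_le_of_lt (le_max_left _ _) hM) t ht)
        (h2 M (lt_of_le_of_lt (le_max_right _ _) hM) t ht)
    | smul c x _ hx =>
      obtain ⟨M₁, h1⟩ := hx
      refine ⟨M₁, fun M hM t ht => ?_⟩
      simp only [map_smul, ← Finset.smul_sum]
      exact W.smul_mem _ (h1 M hM t ht)
  obtain ⟨M₀, h1⟩ := key
  obtain ⟨t, ht⟩ := exists_circle_order ⟨M₀ + 1, Nat.succ_pos _⟩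
  have h2 := h1 (M₀ + 1) (Nat.lt_succ_self _) t ht
  -- For the invariant `a` the sum is `(M₀ + 1) a`, and one divides by `M₀ + 1`.
  have h3 : ∀ j, QSphere.action ℓ (t ^ j) a = a := fun j => ha _ (Set.mem_univ _)
  simp only [h3, Finset.sum_const, Finset.card_range] at h2
  rw [← Nat.cast_smul_eq_nsmul ℂ] at h2
  exact (W.smul_mem_iff (Nat.cast_ne_zero.2 (Nat.succ_ne_zero M₀))).1 h2

/-! ### Words in the representations of the quantum sphere -/

/-- The multi-index to which a word moves `κ`. -/
def endpt (k : ℕ) : List (Gen n) → (Fin n → ℕ) → Fin n → ℕ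
  | [], κ => κ
  | Gen.z i :: w, κ => up k i (endpt k w κ)
  | Gen.zs i :: w, κ => down k i (endpt k w κ)

/-- The coefficient with which a word moves `κ`. -/
def coef (q : ℝ) (k : ℕ) : List (Gen n) → (Fin n → ℕ) → ℝ
  | [], _ => 1
  | Gen.z i :: w, κ => wt q k i (up k i (endpt k w κ)) * coef q k w κ
  | Gen.zs i :: w, κ => wt q k i (endpt k w κ) * coef q k w κ

theorem star_opZ_ket (hq : q ∈ Set.Ioo (0 : ℝ) 1) (k i : ℕ) (κ : Fin n → ℕ) :
    star (opZ hq k i) (ket κ) = (wt q k i κ : ℂ) • ket (down k i κ) := by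
  rw [ContinuousLinearMap.star_eq_adjoint, opZ, adjoint_wcomp_ket, Complex.conj_ofReal]

theorem sphereRep_word_ket (hq : q ∈ Set.Ioo (0 : ℝ) 1) (k : Fin (n + 1)) (w : List (Gen n))
    (κ : Fin n → ℕ) :
    sphereRep hq k (word q w) (ket κ) = (coef q k w κ : ℂ) • ket (endpt k w κ) := by
  induction w with
  | nil => simp [word, coef, endpt]
  | cons g w ih =>
    rw [word_cons, map_mul, mul_apply_eq_comp, ih, map_smul]
    cases g with
    | z i =>
      rw [Gen.toSphere, sphereRep, QSphere.starLift_z, opZ_ket, smul_smul, coef, endpt, mul_comm]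
      push_cast
      rfl
    | zs i =>
      rw [Gen.toSphere, sphereRep, QSphere.starLift_zs, star_opZ_ket, smul_smul, coef, endpt,
        mul_comm]
      push_cast
      rfl

theorem abs_coef_le (hq : q ∈ Set.Ioo (0 : ℝ) 1) (k : ℕ) (w : List (Gen n)) (κ : Fin n → ℕ) :
    |coef q k w κ| ≤ 1 := by
  induction w with
  | nil => simp [coef]
  | cons g w ih =>
    cases g with
    | z i =>
      rw [coef, abs_mul]
      exact mul_le_one₀ (abs_wt_le hq _ _ _) (abs_nonneg _) ih
    | zs i =>
      rw [coef, abs_mul]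
      exact mul_le_one₀ (abs_wt_le hq _ _ _) (abs_nonneg _) ih

/-- A nonzero coefficient guarantees that no letter `z_i^*` was applied where `κ_{i+1} = 0`, so the
truncated subtraction in `down` is a true one all along the word. -/
theorem endpt_of_lt {k : ℕ} {w : List (Gen n)} {κ : Fin n → ℕ} (h : coef q k w κ ≠ 0)
    (j : Fin n) (hj : j.val < k) : (endpt k w κ j : ℤ) = κ j + expo w j := by
  induction w with
  | nil => simp [endpt, expo]
  | cons g w ih =>
    cases g with
    | z i =>
      have ih := ih (right_ne_zero_of_mul h)
      rw [endpt, expo_cons, Gen.expo]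
      unfold up
      split_ifs <;> push_cast <;> omega
    | zs i =>
      have ih := ih (right_ne_zero_of_mul h)
      rw [endpt, expo_cons, Gen.expo]
      unfold down
      split_ifs with h1 h2 h2
      · have h3 := wt_ne_zero h1.1 (left_ne_zero_of_mul h)
        rw [← h1.2, coord, dif_pos j.isLt] at h3
        simp only [Fin.eta] at h3
        omega
      all_goals omega

theorem endpt_of_ge {k : ℕ} (w : List (Gen n)) (κ : Fin n → ℕ) (j : Fin n) (hj : k ≤ j.val) :
    endpt k w κ j = κ j := by
  induction w with
  | nil => rfl
  | cons g w ih =>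
    cases g with
    | z i => rw [endpt, up, if_neg (by omega), ih]
    | zs i => rw [endpt, down, if_neg (by omega), ih]

/-- Passing from `k` to `k + 1` only lets the letters `z_k`, `z_k^*` move the entry `κ_{k+1}`; the
earlier entries are moved alike, whether or not the coefficients vanish. -/
theorem endpt_congr {k : ℕ} (w : List (Gen n)) {κ κ' : Fin n → ℕ}
    (h : ∀ j : Fin n, j.val < k → κ j = κ' j) (j : Fin n) (hj : j.val < k) :
    endpt (k + 1) w κ j = endpt k w κ' j := by
  induction w with
  | nil => exact h j hj
  | cons g w ih =>
    cases g with
    | z i =>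
      rw [endpt, endpt, up, up, ih]
      split_ifs <;> omega
    | zs i =>
      rw [endpt, endpt, down, down, ih]
      split_ifs <;> omega

theorem psum_le_psum {κ κ' : Fin n → ℕ} (h : ∀ j, κ j ≤ κ' j) (j : ℕ) : psum κ j ≤ psum κ' j := by
  refine Finset.sum_le_sum fun l _ => ?_
  unfold coord
  split_ifs
  · exact h _
  · exact le_rfl

theorem psum_congr {k : ℕ} {κ κ' : Fin n → ℕ} (h : ∀ j : Fin n, j.val < k → κ j = κ' j) {j : ℕ}
    (hj : j ≤ k) : psum κ j = psum κ' j := by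
  refine Finset.sum_congr rfl fun l hl => ?_
  rw [Finset.mem_range] at hl
  unfold coord
  split_ifs
  · exact h _ (by simp only; omega)
  · rfl

theorem psum_le_psum_down (k i : ℕ) (κ : Fin n → ℕ) (j : ℕ) :
    psum κ j ≤ psum (down k i κ) j + 1 := by
  rcases le_or_gt j i with h | h
  · rw [psum_down_of_le κ h]
    exact Nat.le_succ _
  · by_cases h1 : i < k ∧ coord κ i ≠ 0
    · rw [psum_down_of_lt κ h h1.1 h1.2]
    · have h2 : down k i κ = κ := by
        funext l
        unfold down
        split_ifs with h3
        · have h4 : coord κ i = κ l := by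
            rw [← h3.2, coord, dif_pos l.isLt]
          omega
        · rfl
      rw [h2]
      exact Nat.le_succ _

/-- A letter lowers a partial sum by at most one. This is why the bounds below carry the factor `q ^
w.length`: weights are evaluated at intermediate multi-indices, and the bounds are stated at the
starting one. -/
theorem psum_le_psum_endpt (k : ℕ) (w : List (Gen n)) (κ : Fin n → ℕ) (j : ℕ) :
    psum κ j ≤ psum (endpt k w κ) j + w.length := by
  induction w with
  | nil => exact le_rfl
  | cons g w ih =>
    rw [List.length_cons]
    cases g with
    | z i =>
      have := psum_le_psum (κ := endpt k w κ) (κ' := up k i (endpt k w κ))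
        (fun l => by unfold up; split_ifs <;> omega) j
      rw [endpt]
      omega
    | zs i =>
      have := psum_le_psum_down k i (endpt k w κ) j
      rw [endpt]
      omega

theorem coef_eq_zero {k : ℕ} {w : List (Gen n)} (h : ∃ g ∈ w, k < g.idx) (κ : Fin n → ℕ) :
    coef q k w κ = 0 := by
  induction w with
  | nil => simp at h
  | cons g w ih =>
    obtain ⟨g', hg', hk⟩ := h
    rw [List.mem_cons] at hg'
    rcases hg' with rfl | hg'
    · cases g' with
      | z i => rw [coef, wt_of_gt _ (show k < i.val from hk), zero_mul]
      | zs i => rw [coef, wt_of_gt _ (show k < i.val from hk), zero_mul]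
    · cases g with
      | z i => rw [coef, ih ⟨g', hg', hk⟩, mul_zero]
      | zs i => rw [coef, ih ⟨g', hg', hk⟩, mul_zero]

theorem pow_mul_pow_psum_le (hq : q ∈ Set.Ioo (0 : ℝ) 1) (k : ℕ) (w : List (Gen n))
    (κ : Fin n → ℕ) (j : ℕ) : q ^ w.length * q ^ psum (endpt k w κ) j ≤ q ^ psum κ j := by
  rw [← pow_add]
  refine pow_le_pow_of_le_one hq.1.le hq.2.le ?_
  have := psum_le_psum_endpt k w κ j
  omega

theorem wt_self (k : ℕ) (κ : Fin n → ℕ) : wt q k k κ = q ^ psum κ k := by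
  rw [wt, if_neg (lt_irrefl k), if_pos rfl]

/-- The coefficient of a word that contains `z_k` or `z_k^*` decays. -/
theorem pow_mul_coef_le (hq : q ∈ Set.Ioo (0 : ℝ) 1) {k : ℕ} {w : List (Gen n)}
    (h : ∃ g ∈ w, g.idx = k) (κ : Fin n → ℕ) : q ^ w.length * |coef q k w κ| ≤ q ^ psum κ k := by
  have hq0 : ∀ m, 0 ≤ q ^ m := fun m => pow_nonneg hq.1.le m
  induction w with
  | nil => simp at h
  | cons g w ih =>
    -- If the letter of index `k` occurs later in the list, the leading factor is only bounded by
    -- one.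
    have step : ∀ x : Fin n → ℕ, ∀ i, (∃ g' ∈ w, g'.idx = k) →
        q ^ (g :: w).length * |wt q k i x * coef q k w κ| ≤ q ^ psum κ k := by
      intro x i hw
      refine le_trans ?_ (ih hw)
      rw [abs_mul, List.length_cons, pow_succ, mul_assoc]
      refine mul_le_mul_of_nonneg_left ?_ (hq0 _)
      have h1 := abs_wt_le hq k i x
      have h2 := abs_nonneg (coef q k w κ)
      exact (mul_le_of_le_one_left (by positivity) hq.2.le).trans (mul_le_of_le_one_left h2 h1)
    obtain ⟨g', hg', hk⟩ := h
    rw [List.mem_cons] at hg'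
    rcases hg' with rfl | hg'
    · have h1 := abs_coef_le hq k w κ
      cases g' with
      | z i =>
        have hi : i.val = k := hk
        -- In the representation number `k` the letter `z_k` is diagonal, with weight `q^(κ_1 + ⋯ +
        -- κ_k)` at the point reached so far.
        have h2 : up k i (endpt k w κ) = endpt k w κ := by
          funext j
          rw [up, if_neg (by omega)]
        have h3 := pow_mul_pow_psum_le hq k w κ k
        rw [coef, h2, hi, wt_self, abs_mul, abs_of_nonneg (hq0 _), List.length_cons, pow_succ]
        refine le_trans ?_ h3
        rw [mul_assoc]
        refine mul_le_mul_of_nonneg_left ?_ (hq0 _)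
        exact (mul_le_of_le_one_left (mul_nonneg (hq0 _) (abs_nonneg _)) hq.2.le).trans
          (mul_le_of_le_one_right (hq0 _) h1)
      | zs i =>
        have hi : i.val = k := hk
        have h3 := pow_mul_pow_psum_le hq k w κ k
        rw [coef, hi, wt_self, abs_mul, abs_of_nonneg (hq0 _), List.length_cons, pow_succ]
        refine le_trans ?_ h3
        rw [mul_assoc]
        refine mul_le_mul_of_nonneg_left ?_ (hq0 _)
        exact (mul_le_of_le_one_left (mul_nonneg (hq0 _) (abs_nonneg _)) hq.2.le).trans
          (mul_le_of_le_one_right (hq0 _) h1)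
    · cases g with
      | z i => exact step _ _ ⟨g', hg', hk⟩
      | zs i => exact step _ _ ⟨g', hg', hk⟩

/-- Because `(1 - x)² ≤ 1 - x²` on the unit interval. It is used with `x = q^κ_{k+1}`. -/
theorem one_sub_sqrt_le {x : ℝ} (h0 : 0 ≤ x) (h1 : x ≤ 1) : 1 - √(1 - x ^ 2) ≤ x := by
  have : 1 - x ≤ √(1 - x ^ 2) := by
    refine Real.le_sqrt_of_sq_le ?_
    nlinarith
  linarith

/-- For `i < k` the two weights coincide. For `i = k` they are `q^σ √(1 - x²)` and `q^σ` with `x =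
q^κ_{k+1}`, and they differ by at most `q^σ x`. -/
theorem abs_wt_succ_sub_wt_le (hq : q ∈ Set.Ioo (0 : ℝ) 1) {k i : ℕ} (hi : i ≤ k)
    {κ κ' : Fin n → ℕ} (h : ∀ j : Fin n, j.val < k → κ j = κ' j) :
    |wt q (k + 1) i κ - wt q k i κ'| ≤ q ^ psum κ (k + 1) := by
  have hq0 : ∀ m, 0 ≤ q ^ m := fun m => pow_nonneg hq.1.le m
  have hq1 : ∀ m, q ^ m ≤ 1 := fun m => pow_le_one₀ hq.1.le hq.2.le
  rcases hi.lt_or_eq with hi | rfl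
  · have h1 : coord κ i = coord κ' i := by
      unfold coord
      split_ifs
      · exact h _ hi
      · rfl
    rw [wt, wt, if_pos (by omega), if_pos hi, psum_congr h hi.le, h1, sub_self, abs_zero]
    exact hq0 _
  · rw [wt_self, wt, if_pos (Nat.lt_succ_self _), psum_congr h le_rfl, psum_succ,
      psum_congr h le_rfl, pow_add, mul_comm 2, pow_mul]
    have h1 := one_sub_sqrt_le (hq0 (coord κ i)) (hq1 _)
    have h2 : √(1 - (q ^ coord κ i) ^ 2) ≤ 1 := Real.sqrt_le_one.2 (by nlinarith [hq0 (coord κ i)])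
    rw [abs_sub_comm, abs_of_nonneg]
    · nlinarith [hq0 (psum κ' i)]
    · nlinarith [hq0 (psum κ' i)]

/-- The coefficients of a word without letters of index larger than `k` in the representations
with numbers `k + 1` and `k` are close to each other. -/
theorem pow_mul_coef_sub_le (hq : q ∈ Set.Ioo (0 : ℝ) 1) {k : ℕ} {w : List (Gen n)}
    (hw : ∀ g ∈ w, g.idx ≤ k) {κ κ' : Fin n → ℕ} (h : ∀ j : Fin n, j.val < k → κ j = κ' j) :
    q ^ w.length * |coef q (k + 1) w κ - coef q k w κ'| ≤ w.length * q ^ psum κ (k + 1) := by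
  have hq0 : ∀ m, 0 ≤ q ^ m := fun m => pow_nonneg hq.1.le m
  induction w with
  | nil => simp [coef]
  | cons g w ih =>
    have ih := ih fun g' hg' => hw g' (List.mem_cons_of_mem _ hg')
    have hg : g.idx ≤ k := hw g List.mem_cons_self
    -- The product rule for differences, with all factors bounded by one. Each letter contributes
    -- one error term, hence the factor `w.length`.
    have step : ∀ x y : Fin n → ℕ, (∀ j : Fin n, j.val < k → x j = y j) →
        q ^ (w.length + 1) * q ^ psum x (k + 1) ≤ q ^ psum κ (k + 1) →
        q ^ (w.length + 1) * |wt q (k + 1) g.idx x * coef q (k + 1) w κ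
          - wt q k g.idx y * coef q k w κ'| ≤ (w.length + 1) * q ^ psum κ (k + 1) := by
      intro x y hxy hx
      have h1 := abs_wt_succ_sub_wt_le hq hg hxy
      have h2 := abs_coef_le hq (k + 1) w κ
      have h3 := abs_wt_le hq k g.idx y
      have h4 : wt q (k + 1) g.idx x * coef q (k + 1) w κ - wt q k g.idx y * coef q k w κ'
          = (wt q (k + 1) g.idx x - wt q k g.idx y) * coef q (k + 1) w κ
            + wt q k g.idx y * (coef q (k + 1) w κ - coef q k w κ') := by ring
      have h5 : |wt q (k + 1) g.idx x * coef q (k + 1) w κ - wt q k g.idx y * coef q k w κ'|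
          ≤ q ^ psum x (k + 1) + |coef q (k + 1) w κ - coef q k w κ'| := by
        rw [h4]
        refine (abs_add_le _ _).trans ?_
        rw [abs_mul, abs_mul]
        exact add_le_add ((mul_le_of_le_one_right (abs_nonneg _) h2).trans h1)
          (mul_le_of_le_one_left (abs_nonneg _) h3)
      have h6 : q ^ (w.length + 1) * |coef q (k + 1) w κ - coef q k w κ'|
          ≤ w.length * q ^ psum κ (k + 1) := by
        refine le_trans ?_ ih
        refine mul_le_mul_of_nonneg_right ?_ (abs_nonneg _)
        exact pow_le_pow_of_le_one hq.1.le hq.2.le (Nat.le_succ _)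
      have h7 := mul_le_mul_of_nonneg_left h5 (hq0 (w.length + 1))
      linarith
    rw [List.length_cons]
    push_cast
    cases g with
    | z i =>
      -- The weight of `z_i` is taken at the point after the letter has acted, that of `z_i^*` at
      -- the point before.
      refine step _ _ (endpt_congr (Gen.z i :: w) h) ?_
      exact pow_mul_pow_psum_le hq (k + 1) (Gen.z i :: w) κ (k + 1)
    | zs i =>
      refine step _ _ (endpt_congr w h) ?_
      refine le_trans ?_ (pow_mul_pow_psum_le hq (k + 1) w κ (k + 1))
      refine mul_le_mul_of_nonneg_right ?_ (hq0 _)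
      exact pow_le_pow_of_le_one hq.1.le hq.2.le (Nat.le_succ _)

end words

/-! ### Bounded operators on `ℓ²(I)` in terms of their columns. -/

section columns

variable {I : Type}

theorem norm_ket (i : I) : ‖(ket i : L2 I)‖ = 1 := by
  classical
  rw [ket, lp.norm_single (by norm_num), norm_one]

theorem hasSum_ket (v : L2 I) : HasSum (fun i => v i • ket i) v := by
  classical
  have h := lp.hasSum_single (E := fun _ : I => ℂ) (p := 2) (by norm_num) v
  convert h using 2 with i
  ext j
  rw [lp.coeFn_smul, Pi.smul_apply, ket_apply, lp.single_apply, Pi.single_apply]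
  split_ifs with hj
  · subst hj
    exact mul_one _
  · exact mul_zero _

theorem hasSum_apply_ket (T : Op I) (v : L2 I) : HasSum (fun i => v i • T (ket i)) (T v) := by
  simpa using (hasSum_ket v).mapL T

theorem hasSum_apply_ket_apply (T : Op I) (v : L2 I) (j : I) :
    HasSum (fun i => v i * T (ket i) j) (T v j) := by
  have h := (hasSum_apply_ket T v).mapL (innerSL ℂ (ket j))
  simpa [inner_ket_left, inner_smul_right] using h

theorem norm_rankOne_le (w : L2 I) (i : I) : ‖rankOne w i‖ ≤ ‖w‖ := by
  refine ContinuousLinearMap.opNorm_le_bound _ (norm_nonneg _) fun v => ?_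
  rw [rankOne_apply, norm_smul, mul_comm]
  exact mul_le_mul_of_nonneg_left (lp.norm_apply_le_norm (by norm_num) v i) (norm_nonneg _)

end columns

/-! ### Bounded commutators with `|D|` and with `D`. -/

section commutators

variable {n : ℕ}

/-- The commutator of `|D|` and `T` is defined on the domain of `|D|` and bounded. -/
def HasBoundedCommutator (T : Op (Fin n → ℕ)) : Prop :=
  ∃ B : Op (Fin n → ℕ), ∀ v : (numberOp n).domain, ∃ h : T v ∈ (numberOp n).domain,
    numberOp n ⟨T v, h⟩ - T (numberOp n v) = B v

/-- The operator `T |D|` is bounded. -/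
def IsBoundedMulNumberOp (T : Op (Fin n → ℕ)) : Prop :=
  ∃ B : Op (Fin n → ℕ), ∀ v : (numberOp n).domain, T (numberOp n v) = B v

theorem HasBoundedCommutator.zero : HasBoundedCommutator (0 : Op (Fin n → ℕ)) :=
  ⟨0, fun _ => ⟨(numberOp n).domain.zero_mem, by
    have : numberOp n ⟨0, (numberOp n).domain.zero_mem⟩ = 0 := map_zero (numberOp n).toFun
    simpa using this⟩⟩

theorem HasBoundedCommutator.add {S T : Op (Fin n → ℕ)} (hS : HasBoundedCommutator S)
    (hT : HasBoundedCommutator T) : HasBoundedCommutator (S + T) := by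
  obtain ⟨A, hA⟩ := hS
  obtain ⟨B, hB⟩ := hT
  refine ⟨A + B, fun v => ?_⟩
  obtain ⟨h1, h2⟩ := hA v
  obtain ⟨h3, h4⟩ := hB v
  refine ⟨(numberOp n).domain.add_mem h1 h3, ?_⟩
  have h5 : numberOp n ⟨(S + T) v, (numberOp n).domain.add_mem h1 h3⟩
      = numberOp n ⟨S v, h1⟩ + numberOp n ⟨T v, h3⟩ :=
    map_add (numberOp n).toFun ⟨S v, h1⟩ ⟨T v, h3⟩
  rw [h5, add_apply, add_apply, ← h2, ← h4]
  abel

theorem HasBoundedCommutator.smul {S : Op (Fin n → ℕ)} (hS : HasBoundedCommutator S) (c : ℂ) :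
    HasBoundedCommutator (c • S) := by
  obtain ⟨A, hA⟩ := hS
  refine ⟨c • A, fun v => ?_⟩
  obtain ⟨h1, h2⟩ := hA v
  refine ⟨(numberOp n).domain.smul_mem c h1, ?_⟩
  have h5 : numberOp n ⟨(c • S) v, (numberOp n).domain.smul_mem c h1⟩
      = c • numberOp n ⟨S v, h1⟩ := map_smul (numberOp n).toFun c ⟨S v, h1⟩
  rw [h5, smul_apply, smul_apply, ← h2, smul_sub]

theorem IsBoundedMulNumberOp.zero : IsBoundedMulNumberOp (0 : Op (Fin n → ℕ)) :=
  ⟨0, fun _ => rfl⟩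

theorem IsBoundedMulNumberOp.add {S T : Op (Fin n → ℕ)} (hS : IsBoundedMulNumberOp S)
    (hT : IsBoundedMulNumberOp T) : IsBoundedMulNumberOp (S + T) := by
  obtain ⟨A, hA⟩ := hS
  obtain ⟨B, hB⟩ := hT
  exact ⟨A + B, fun v => by
    rw [add_apply, add_apply, hA, hB]⟩

theorem IsBoundedMulNumberOp.smul {S : Op (Fin n → ℕ)} (hS : IsBoundedMulNumberOp S) (c : ℂ) :
    IsBoundedMulNumberOp (c • S) := by
  obtain ⟨A, hA⟩ := hS
  exact ⟨c • A, fun v => by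
    rw [smul_apply, smul_apply, hA]⟩

/-- An operator that raises the total degree by `δ` satisfies `[|D|, T] = δ T`. -/
theorem hasBoundedCommutator_of_shift {T : Op (Fin n → ℕ)} {δ : ℝ}
    (h : ∀ m m' : Fin n → ℕ, T (ket m) m' ≠ 0 → (tot m' : ℝ) = tot m + δ) :
    HasBoundedCommutator T := by
  refine ⟨(δ : ℂ) • T, fun v => ?_⟩
  -- The candidate for `|D| T v` is `T |D| v + δ T v`; its entries are compared column by column.
  obtain ⟨h1, h2⟩ := mem_numberOp_of (v := T v) (w := T (numberOp n v) + (δ : ℂ) • T v) fun m' => by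
    have h3 := hasSum_apply_ket_apply T (numberOp n v) m'
    have h4 := hasSum_apply_ket_apply T v m'
    have h5 := h3.add (h4.mul_left (δ : ℂ))
    have h6 := h4.mul_left (tot m' : ℂ)
    have key : ∀ m, numberOp n v m * T (ket m) m'
        + (δ : ℂ) * ((v : L2 (Fin n → ℕ)) m * T (ket m) m')
        = (tot m' : ℂ) * ((v : L2 (Fin n → ℕ)) m * T (ket m) m') := fun m => ?_
    · rw [funext key] at h5
      exact h5.unique h6
    rw [numberOp_apply]
    by_cases h0 : T (ket m) m' = 0
    · rw [h0]; simp
    · have h7 : (tot m' : ℂ) = tot m + δ := by exact_mod_cast congrArg Complex.ofReal (h m m' h0)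
      rw [h7]
      ring
  exact ⟨h1, by rw [h2, add_sub_cancel_left]; rfl⟩

/-- An operator with geometrically decaying columns has a bounded product with `|D|`. -/
theorem isBoundedMulNumberOp_of_decay (hn : 1 ≤ n) {T : Op (Fin n → ℕ)} {C t : ℝ} (ht0 : 0 ≤ t)
    (ht1 : t < 1) (h : ∀ m : Fin n → ℕ, ‖T (ket m)‖ ≤ C * t ^ tot m) :
    IsBoundedMulNumberOp T := by
  -- The columns of `T |D|` as rank one operators. Their norms are at most `C ‖m‖₁ t^‖m‖₁`, so the
  -- series converges absolutely in norm.
  let F : (Fin n → ℕ) → Op (Fin n → ℕ) := fun m => (tot m : ℂ) • rankOne (T (ket m)) m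
  have hF : Summable F := by
    refine Summable.of_norm_bounded ((summable_tot_mul_pow hn ht0 ht1).mul_left C) fun m => ?_
    rw [norm_smul, Complex.norm_natCast]
    have h1 := mul_le_mul_of_nonneg_left ((norm_rankOne_le (T (ket m)) m).trans (h m))
      (Nat.cast_nonneg (α := ℝ) (tot m))
    linarith
  refine ⟨∑' m, F m, fun v => ?_⟩
  have h1 : HasSum (fun m => F m v) ((∑' m, F m) v) :=
    hF.hasSum.mapL (ContinuousLinearMap.apply ℂ (L2 (Fin n → ℕ)) (v : L2 (Fin n → ℕ)))
  refine HasSum.unique (hasSum_apply_ket T (numberOp n v)) ?_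
  convert h1 using 2 with m
  rw [smul_apply, rankOne_apply, numberOp_apply, smul_smul]

/-- The commutator of `D` and `S ⊕ T`. -/
theorem exists_commutator_dirac {S T : Op (Fin n → ℕ)} (hS : HasBoundedCommutator S)
    (hT : HasBoundedCommutator T) (hST : IsBoundedMulNumberOp (S - T)) :
    ∃ B : Double (L2 (Fin n → ℕ)) →L[ℂ] Double (L2 (Fin n → ℕ)), ∀ v : (dirac n).domain,
      ∃ h : blockDiag S T v ∈ (dirac n).domain,
        dirac n ⟨blockDiag S T v, h⟩ - blockDiag S T (dirac n v) = B v := by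
  obtain ⟨A, hA⟩ := hS
  obtain ⟨B, hB⟩ := hT
  obtain ⟨R, hR⟩ := hST
  -- On `v ⊕ w` the commutator is `(|D|T - S|D|)w ⊕ (|D|S - T|D|)v`, where `|D|T - S|D| = [|D|, T] -
  -- (S - T)|D|` and `|D|S - T|D| = [|D|, S] + (S - T)|D|`.
  refine ⟨blockDiag (B - R) (A + R) * flipOp, fun v => ?_⟩
  obtain ⟨hv1, hv2⟩ := (mem_dirac _).1 v.2
  obtain ⟨h1, h1'⟩ := hA ⟨_, hv1⟩
  obtain ⟨h2, h2'⟩ := hB ⟨_, hv2⟩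
  have h3 := hR ⟨_, hv1⟩
  have h4 := hR ⟨_, hv2⟩
  rw [sub_apply] at h3 h4
  refine ⟨(mem_dirac _).2 ⟨h1, h2⟩, ?_⟩
  refine double_ext ?_ ?_
  · change numberOp n ⟨T _, h2⟩ - S (numberOp n ⟨_, hv2⟩) = B (v : Double (L2 (Fin n → ℕ))).snd - R (v : Double (L2 (Fin n → ℕ))).snd
    rw [← h2', ← h4]
    abel
  · change numberOp n ⟨S _, h1⟩ - T (numberOp n ⟨_, hv1⟩) = A (v : Double (L2 (Fin n → ℕ))).fst + R (v : Double (L2 (Fin n → ℕ))).fst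
    rw [← h1', ← h3]
    abel

end commutators

/-! ### Words of degree zero in the representations `π_k`, and the difference of `π_+` and `π_-`. -/

section wordsPiK

variable {n : ℕ} {q : ℝ}
variable (p : Fin (n + 1) → ℕ+) (r : ∀ i : Fin n, Fin (p i.castSucc))

/-- The linear extension of `piK` to the coordinate algebra of the quantum sphere. -/
def cornerRep (hq : q ∈ Set.Ioo (0 : ℝ) 1) (k : Fin (n + 1)) : QSphere n q →ₗ[ℂ] Op (Fin n → ℕ) where
  toFun a := opR p r k * (sphereRep hq k a * star (opR p r k))
  map_add' a b := by rw [map_add, add_mul, mul_add]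
  map_smul' c a := by rw [map_smul, smul_mul_assoc, mul_smul_comm]; rfl

theorem cornerRep_ket_of_not (hq : q ∈ Set.Ioo (0 : ℝ) 1) (k : Fin (n + 1)) {m : Fin n → ℕ}
    (hm : ¬ InV k m) (a : QSphere n q) : cornerRep p r hq k a (ket m) = 0 := by
  change opR p r k (sphereRep hq k a (star (opR p r k) (ket m))) = 0
  rw [star_opR_ket_of_not p r hm, map_zero, map_zero]

theorem cornerRep_word_ket (hq : q ∈ Set.Ioo (0 : ℝ) 1) (k : Fin (n + 1)) {m : Fin n → ℕ}
    (hm : InV k m) (w : List (Gen n)) : cornerRep p r hq k (word q w) (ket m)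
      = (coef q k w (relabel p r k m) : ℂ) • opR p r k (ket (endpt k w (relabel p r k m))) := by
  change opR p r k (sphereRep hq k (word q w) (star (opR p r k) (ket m))) = _
  rw [star_opR_ket p r hm, sphereRep_word_ket, map_smul]

/-- Words of degree zero belong to the lens space algebra, so by `lens_support` they preserve the
residues modulo `p` that characterise relabelled multi-indices. -/
theorem exists_relabel_endpt (hp : Pairwise fun i j => (p i).Coprime (p j))
    (hq : q ∈ Set.Ioo (0 : ℝ) 1) (k : Fin (n + 1)) {m : Fin n → ℕ} (hm : InV k m)
    {w : List (Gen n)} (hw : wdeg (sharp p) w = 0) (h0 : coef q k w (relabel p r k m) ≠ 0) :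
    ∃ m', InV k m' ∧ relabel p r k m' = endpt k w (relabel p r k m) := by
  obtain ⟨h1, h2⟩ := lens_support p hp hq k (word_mem_QLens hw _)
    (κ := relabel p r k m) (κ' := endpt k w (relabel p r k m)) (by
      rw [sphereRep_word_ket, lp.coeFn_smul, Pi.smul_apply, ket_apply, if_pos rfl]
      simpa using h0)
  have h3 : ∀ j : Fin n, k.val ≤ j → relabel p r k m j = m j := fun j hj => if_neg (by omega)
  refine exists_relabel p r (fun j hj => ?_) fun i j hi hij => ?_
  · rw [h1 j hj, relabel_mod p r m j hj]
  · rw [h2 i hi, h2 j (hi.trans (le_of_lt hij)), h3 i hi, h3 j (hi.trans (le_of_lt hij))]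
    exact hm.2 i j hi hij

/-- The exponent of `z_l` in a word, divided by `p_l`. -/
def fexpo (w : List (Gen n)) (l : ℕ) : ℝ :=
  if h : l < n + 1 then (expo w l : ℝ) / (p ⟨l, h⟩ : ℕ) else 0

/-- As `ℓ_l = N / p_l`, the weighted degree is `N` times this sum. -/
theorem sum_fexpo {w : List (Gen n)} (hw : wdeg (sharp p) w = 0) :
    ∑ l ∈ Finset.range (n + 1), fexpo p w l = 0 := by
  have h1 : ((∏ j, (p j : ℕ) : ℕ) : ℝ) * ∑ l ∈ Finset.range (n + 1), fexpo p w l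
      = (wdeg (sharp p) w : ℝ) := by
    rw [← Fin.sum_univ_eq_sum_range, Finset.mul_sum, wdeg]
    push_cast
    refine Finset.sum_congr rfl fun i _ => ?_
    have h2 := mul_sharp p i
    have h3 : ((p i : ℕ) : ℝ) ≠ 0 := by exact_mod_cast (p i).ne_zero
    rw [fexpo, dif_pos i.isLt]
    simp only [Fin.eta]
    have h4 : ((p i : ℕ) : ℝ) * ((sharp p i : ℕ) : ℝ) = ∏ j, ((p j : ℕ) : ℝ) := by exact_mod_cast h2
    rw [← h4]
    field_simp
  rw [hw, Int.cast_zero] at h1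
  refine (mul_eq_zero.1 h1).resolve_left ?_
  refine Nat.cast_ne_zero.2 ?_
  exact Finset.prod_ne_zero_iff.2 fun i _ => (p i).ne_zero

theorem expo_eq_zero {k : ℕ} {w : List (Gen n)} (hw : ∀ g ∈ w, g.idx ≤ k) {l : ℕ} (hl : k < l) :
    expo w l = 0 := by
  induction w with
  | nil => rfl
  | cons g w ih =>
    have hg : g.idx ≤ k := hw g List.mem_cons_self
    rw [expo_cons, ih fun g' hg' => hw g' (List.mem_cons_of_mem _ hg'), add_zero]
    cases g with
    | z i => exact if_neg (by have : i.val ≤ k := hg; omega)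
    | zs i => exact if_neg (by have : i.val ≤ k := hg; omega)

/-- The exponents beyond `k` vanish. By `displacement`, this says that `π_{k+1}` does not move the
entry `m_{k+1}`, just as `π_k` does not. -/
theorem sum_fexpo_of_idx_le {k : ℕ} (hk : k ≤ n) {w : List (Gen n)} (hw : wdeg (sharp p) w = 0)
    (hk' : ∀ g ∈ w, g.idx ≤ k) : ∑ l ∈ Finset.range (k + 1), fexpo p w l = 0 := by
  rw [← sum_fexpo p hw]
  refine Finset.sum_subset (Finset.range_subset_range.2 (by omega)) fun l _ hl => ?_
  rw [Finset.mem_range] at hl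
  rw [fexpo, expo_eq_zero hk' (by omega)]
  simp

/-- The displacement of multi-indices by a word. -/
theorem displacement {k : ℕ} {m m' : Fin n → ℕ} (hm : InV k m) (hm' : InV k m')
    {w : List (Gen n)} (h0 : coef q k w (relabel p r k m) ≠ 0)
    (h : relabel p r k m' = endpt k w (relabel p r k m)) (j : Fin n) :
    (m' j : ℝ) = m j + if j.val < k then ∑ l ∈ Finset.range (j.val + 1), fexpo p w l else 0 := by
  have key : ∀ N : ℕ, ∀ j : Fin n, j.val < N → j.val < k →
      (m' j : ℝ) = m j + ∑ l ∈ Finset.range (j.val + 1), fexpo p w l := by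
    intro N
    induction N with
    | zero => intro j hj; omega
    | succ N ih =>
      intro j hj hk
      -- The word adds its exponent of `z_j` to `κ_{j+1} = p_j (m_{j+1} - m_j) + r_j`, so `m_{j+1} -
      -- m_j` grows by that exponent divided by `p_j`; the increments then telescope.
      have h1 := endpt_of_lt h0 j hk
      rw [← h, relabel, relabel, if_pos hk, if_pos hk] at h1
      have h2 := prev_le hm hk
      have h3 := prev_le hm' hk
      have h4 : (prev m' j : ℝ) = prev m j + ∑ l ∈ Finset.range j.val, fexpo p w l := by
        unfold prev
        split_ifs with hj0
        · rw [hj0]; simp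
        · rw [coord, coord, dif_pos (by omega), dif_pos (by omega),
            ih _ (by simp only; omega) (by simp only; omega)]
          simp only
          rw [Nat.sub_add_cancel (by omega)]
      have hp0 : ((p j.castSucc : ℕ) : ℝ) ≠ 0 := by exact_mod_cast (p j.castSucc).ne_zero
      have h5 : fexpo p w j.val = (expo w j.val : ℝ) / (p j.castSucc : ℕ) := by
        rw [fexpo, dif_pos (by omega)]
        rfl
      have h6 : ((p j.castSucc : ℕ) : ℝ) * ((m' j : ℝ) - prev m' j)
          = (p j.castSucc : ℕ) * ((m j : ℝ) - prev m j) + expo w j.val := by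
        have h7 := congrArg (Int.cast (R := ℝ)) h1
        push_cast at h7
        rw [Nat.cast_sub h2, Nat.cast_sub h3] at h7
        linarith
      rw [Finset.sum_range_succ, h5]
      have h8 : (m' j : ℝ) - prev m' j = m j - prev m j + expo w j.val / (p j.castSucc : ℕ) := by
        field_simp
        linarith
      linarith
  split_ifs with hj
  · exact key n j j.isLt hj
  · have h1 := congrFun h j
    rw [endpt_of_ge w _ j (by omega), relabel, relabel, if_neg hj, if_neg hj] at h1
    rw [h1, add_zero]

theorem hasBoundedCommutator_cornerRep_word (hp : Pairwise fun i j => (p i).Coprime (p j))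
    (hq : q ∈ Set.Ioo (0 : ℝ) 1) (k : Fin (n + 1)) {w : List (Gen n)}
    (hw : wdeg (sharp p) w = 0) : HasBoundedCommutator (cornerRep p r hq k (word q w)) := by
  refine hasBoundedCommutator_of_shift (δ := ∑ j : Fin n,
    if j.val < k.val then ∑ l ∈ Finset.range (j.val + 1), fexpo p w l else 0) fun m m' h => ?_
  by_cases hm : InV k m
  · rw [cornerRep_word_ket p r hq k hm, lp.coeFn_smul, Pi.smul_apply] at h
    have h0 : coef q k w (relabel p r k m) ≠ 0 := by
      intro h1
      rw [h1] at h
      simp at h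
    obtain ⟨m'', hm'', h2⟩ := exists_relabel_endpt p r hp hq k hm hw h0
    rw [← h2, opR_ket p r hm'', ket_apply] at h
    have h3 : m' = m'' := by
      by_contra h3
      simp [h3] at h
    rw [h3, tot, tot]
    push_cast
    rw [← Finset.sum_add_distrib]
    exact Finset.sum_congr rfl fun j _ => displacement p r hm hm'' h0 h2 j
  · rw [cornerRep_ket_of_not p r hq k hm] at h
    exact absurd rfl h

/-- Since every `p_j` is at least one, `κ_{j+1} ≥ m_{j+1} - m_j`, and these differences telescope.
Truncated subtraction only helps, so no monotonicity is assumed. -/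
theorem coord_le_psum_relabel {k : ℕ} (m : Fin n → ℕ) {i : ℕ} (hi : i < k) :
    coord m i ≤ psum (relabel p r k m) (i + 1) := by
  induction i with
  | zero =>
    rw [psum_succ]
    unfold coord
    split_ifs with h
    · rw [relabel, if_pos hi]
      have : prev m 0 = 0 := rfl
      simp only [this, Nat.sub_zero]
      have h2 : m ⟨0, h⟩ ≤ (p (Fin.castSucc ⟨0, h⟩) : ℕ) * m ⟨0, h⟩ :=
        Nat.le_mul_of_pos_left _ (p _).pos
      omega
    · exact Nat.zero_le _
  | succ i ih =>
    have ih := ih (by omega)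
    rw [psum_succ]
    by_cases h : i + 1 < n
    · rw [coord, coord, dif_pos h, dif_pos h, relabel, if_pos hi]
      have h1 : prev m (i + 1) = coord m i := by
        rw [prev, if_neg (Nat.succ_ne_zero i), Nat.add_sub_cancel]
      simp only [h1]
      have h2 : m ⟨i + 1, h⟩ - coord m i
          ≤ (p (Fin.castSucc ⟨i + 1, h⟩) : ℕ) * (m ⟨i + 1, h⟩ - coord m i) :=
        Nat.le_mul_of_pos_left _ (p _).pos
      omega
    · rw [coord, dif_neg h]
      exact Nat.zero_le _

/-- On the intersection of `V_k` and `V_{k+1}` the entries increase weakly up to `m_{k+1}` and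
decrease strictly after it. -/
theorem tot_le_mul {k : ℕ} (hk : k < n) {m : Fin n → ℕ} (h1 : InV k m) (h2 : InV (k + 1) m) :
    tot m ≤ n * m ⟨k, hk⟩ := by
  have h3 : ∀ j : Fin n, m j ≤ m ⟨k, hk⟩ := fun j => by
    rcases le_or_gt j.val k with h | h
    · exact h2.1 j ⟨k, hk⟩ h (Nat.lt_succ_self k)
    · exact (h1.2 ⟨k, hk⟩ j le_rfl h).le
  calc tot m ≤ ∑ _j : Fin n, m ⟨k, hk⟩ := Finset.sum_le_sum fun j _ => h3 j
    _ = _ := by simp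

/-- Where both are nonzero, consecutive representations almost agree on words of degree zero. -/
theorem norm_cornerRep_succ_sub_le (hp : Pairwise fun i j => (p i).Coprime (p j))
    (hq : q ∈ Set.Ioo (0 : ℝ) 1) {k : ℕ} (hk : k < n) {m : Fin n → ℕ} (h1 : InV k m)
    (h2 : InV (k + 1) m) {w : List (Gen n)} (hw : wdeg (sharp p) w = 0) :
    q ^ w.length * ‖cornerRep p r hq ⟨k + 1, by omega⟩ (word q w) (ket m)
      - cornerRep p r hq ⟨k, by omega⟩ (word q w) (ket m)‖ ≤ (w.length + 1) * q ^ m ⟨k, hk⟩ := by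
  have hq0 : ∀ j, 0 ≤ q ^ j := fun j => pow_nonneg hq.1.le j
  set κ := relabel p r (k + 1) m with hκ
  set κ' := relabel p r k m with hκ'
  have hdecay : q ^ psum κ (k + 1) ≤ q ^ m ⟨k, hk⟩ := by
    refine pow_le_pow_of_le_one hq.1.le hq.2.le ?_
    have := coord_le_psum_relabel p r m (Nat.lt_succ_self k)
    rwa [coord, dif_pos hk] at this
  have hcorner1 := cornerRep_word_ket p r hq ⟨k + 1, by omega⟩ h2 w
  have hcorner2 := cornerRep_word_ket p r hq ⟨k, by omega⟩ h1 w
  simp only at hcorner1 hcorner2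
  have hopR : ∀ (j : ℕ) (x : Fin n → ℕ), ‖opR p r j (ket x)‖ ≤ 1 := by
    intro j x
    refine ((opR p r j).le_opNorm (ket x)).trans ?_
    rw [norm_ket, mul_one, opR, wcomp]
    exact LinearMap.mkContinuous_norm_le _ zero_le_one _
  rw [hcorner1, hcorner2]
  by_cases hw1 : ∃ g ∈ w, k < g.idx
  · rw [coef_eq_zero hw1 κ', Complex.ofReal_zero, zero_smul, sub_zero, norm_smul,
      Complex.norm_real, Real.norm_eq_abs]
    -- Either some letter has index above `k + 1` and `π_{k+1}` kills the word as well, or there is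
    -- a letter of index exactly `k + 1`, which makes the coefficient decay.
    have h3 : q ^ w.length * |coef q (k + 1) w κ| ≤ q ^ psum κ (k + 1) := by
      by_cases hw2 : ∃ g ∈ w, k + 1 < g.idx
      · rw [coef_eq_zero hw2 κ, abs_zero, mul_zero]
        exact hq0 _
      · obtain ⟨g, hg, hgk⟩ := hw1
        push Not at hw2
        have := hw2 g hg
        exact pow_mul_coef_le hq ⟨g, hg, by omega⟩ κ
    calc q ^ w.length * (|coef q (k + 1) w κ| * ‖opR p r (k + 1) (ket (endpt (k + 1) w κ))‖)
        ≤ q ^ w.length * (|coef q (k + 1) w κ| * 1) := by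
          have := hopR (k + 1) (endpt (k + 1) w κ)
          have := hq0 w.length
          gcongr
      _ ≤ q ^ m ⟨k, hk⟩ := by rw [mul_one]; exact h3.trans hdecay
      _ ≤ _ := by nlinarith [hq0 (m ⟨k, hk⟩), Nat.cast_nonneg (α := ℝ) w.length]
  · push Not at hw1
    have hagree : ∀ j : Fin n, j.val < k → κ j = κ' j := fun j hj => by
      rw [hκ, hκ', relabel, relabel, if_pos hj, if_pos (by omega)]
    have hdiff := pow_mul_coef_sub_le hq hw1 hagree
    suffices h3 : ‖(coef q (k + 1) w κ : ℂ) • opR p r (k + 1) (ket (endpt (k + 1) w κ))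
        - (coef q k w κ' : ℂ) • opR p r k (ket (endpt k w κ'))‖
        ≤ |coef q (k + 1) w κ - coef q k w κ'| by
      have h4 := mul_le_mul_of_nonneg_left h3 (hq0 w.length)
      have h5 := mul_le_mul_of_nonneg_left hdecay (Nat.cast_nonneg (α := ℝ) w.length)
      nlinarith [hq0 (m ⟨k, hk⟩)]
    -- The endpoints are known to be relabelled multi-indices only where the coefficients are
    -- nonzero. If one coefficient vanishes, it is enough that `opR` is a contraction.
    by_cases hA : coef q (k + 1) w κ = 0
    · rw [hA, Complex.ofReal_zero, zero_smul, zero_sub, zero_sub, norm_neg, abs_neg, norm_smul,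
        Complex.norm_real, Real.norm_eq_abs]
      exact mul_le_of_le_one_right (abs_nonneg _) (hopR _ _)
    by_cases hB : coef q k w κ' = 0
    · rw [hB, Complex.ofReal_zero, zero_smul, sub_zero, sub_zero, norm_smul,
        Complex.norm_real, Real.norm_eq_abs]
      exact mul_le_of_le_one_right (abs_nonneg _) (hopR _ _)
    obtain ⟨m₁, hm₁, he₁⟩ := exists_relabel_endpt p r hp hq ⟨k + 1, by omega⟩ h2 hw hA
    obtain ⟨m₂, hm₂, he₂⟩ := exists_relabel_endpt p r hp hq ⟨k, by omega⟩ h1 hw hB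
    simp only at hm₁ he₁ hm₂ he₂
    -- The displacements can differ only in the entry `m_{k+1}`, where `π_{k+1}` adds a sum that
    -- vanishes in degree zero.
    have hm : m₁ = m₂ := by
      funext j
      have h3 := displacement p r h2 hm₁ hA he₁ j
      have h4 := displacement p r h1 hm₂ hB he₂ j
      rw [← Nat.cast_inj (R := ℝ), h3, h4]
      congr 1
      rcases lt_trichotomy j.val k with h | h | h
      · rw [if_pos h, if_pos (by omega)]
      · rw [if_pos (by omega), if_neg (by omega), h]
        exact sum_fexpo_of_idx_le p hk.le hw hw1
      · rw [if_neg (by omega), if_neg (by omega)]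
    rw [← he₁, ← he₂, opR_ket p r hm₁, opR_ket p r hm₂, hm, ← sub_smul, norm_smul, norm_ket,
      mul_one, ← Complex.ofReal_sub, Complex.norm_real, Real.norm_eq_abs]

/-- Basis vectors in `V_k` are in exactly one other of these spaces, the preceding or the
following one. -/
theorem exists_InV_succ (hn : 1 ≤ n) {j : ℕ} (hj : j ≤ n) {m : Fin n → ℕ} (hm : InV j m) :
    ∃ k, k < n ∧ InV k m ∧ InV (k + 1) m := by
  -- If `m_j ≤ m_{j+1}`, or if `j = 0`, the neighbour is `V_{j+1}`. If `m_j > m_{j+1}`, or if `j =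
  -- n`, it is `V_{j-1}`.
  by_cases h : ∃ hj' : j < n, 0 < j → coord m (j - 1) ≤ m ⟨j, hj'⟩
  · obtain ⟨hj', h⟩ := h
    refine ⟨j, hj', hm, fun a b hab hb => ?_, fun a b ha hab => hm.2 a b (by omega) hab⟩
    rcases Nat.lt_succ_iff_lt_or_eq.1 hb with hb' | hb'
    · exact hm.1 a b hab hb'
    · have hb2 : b = ⟨j, hj'⟩ := Fin.ext hb'
      rcases (show a.val ≤ b.val from hab).lt_or_eq with h1 | h1
      · have h2 := h (by omega)
        rw [coord, dif_pos (by omega)] at h2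
        rw [hb2]
        exact (hm.1 a ⟨j - 1, by omega⟩ (by rw [Fin.le_def]; simp only; omega)
          (by simp only; omega)).trans h2
      · rw [Fin.ext h1]
  · push Not at h
    have hj0 : 0 < j := by
      by_contra hj0
      have h1 := (h (by omega)).1
      omega
    refine ⟨j - 1, by omega, ⟨fun a b hab hb => hm.1 a b hab (by omega), fun a b ha hab => ?_⟩, ?_⟩
    · have hab' : a.val < b.val := hab
      rcases Nat.lt_or_ge a.val j with ha' | ha'
      · have h1 := (h (by omega)).2
        have h2 : coord m (j - 1) = m a := by
          rw [coord, dif_pos (by omega)]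
          congr 1
          ext
          simp only
          omega
        rw [h2] at h1
        rcases Nat.lt_or_ge j b.val with hb | hb
        · exact (hm.2 ⟨j, by omega⟩ b le_rfl hb).trans h1
        · have : b = ⟨j, by omega⟩ := Fin.ext (by simp only; omega)
          rwa [this]
      · exact hm.2 a b ha' hab
    · rwa [Nat.sub_add_cancel hj0]

/-- The sum of the `cornerRep` whose number is congruent to `s` modulo two. -/
def cornerPar (hq : q ∈ Set.Ioo (0 : ℝ) 1) (s : ℕ) : QSphere n q →ₗ[ℂ] Op (Fin n → ℕ) :=
  ∑ k : Fin (n + 1) with k.val % 2 = s, cornerRep p r hq k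

/-- Working with linear maps on the whole sphere algebra lets an invariant element be split into
words without carrying membership proofs. -/
theorem piPar_eq_cornerPar (hp : Pairwise fun i j => (p i).Coprime (p j))
    (hq : q ∈ Set.Ioo (0 : ℝ) 1) (s : ℕ) (a : QLens q (∏ i, (p i : ℕ)) (sharp p)) :
    piPar p r hp hq s a = cornerPar p r hq s (a : QSphere n q) := by
  rw [cornerPar, LinearMap.sum_apply]
  rfl

/-- Spaces `V_i`, `V_j` whose numbers differ by at least two intersect trivially on basis vectors,
so only one term of the given parity survives. -/
theorem cornerPar_ket (hq : q ∈ Set.Ioo (0 : ℝ) 1) {k : ℕ} (hk : k < n) {m : Fin n → ℕ}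
    (h1 : InV k m) (h2 : InV (k + 1) m) (a : QSphere n q) {i : ℕ} (hi : i < n + 1)
    (hik : i = k ∨ i = k + 1) :
    cornerPar p r hq (i % 2) a (ket m) = cornerRep p r hq ⟨i, hi⟩ a (ket m) := by
  rw [cornerPar, LinearMap.sum_apply, sum_apply]
  refine Finset.sum_eq_single_of_mem _ (by simp) fun j hj hji => ?_
  refine cornerRep_ket_of_not p r hq j (fun hm => ?_) a
  have hj2 : j.val % 2 = i % 2 := (Finset.mem_filter.1 hj).2
  have hne : j.val ≠ i := fun h => hji (Fin.ext h)
  have hjn := j.isLt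
  rcases Nat.lt_or_ge j.val k with h | h
  · exact h2.not_of_add_two_le (by omega) (by omega) hm
  · exact hm.not_of_add_two_le (by omega) (show k + 2 ≤ j.val by omega) h1

theorem isBoundedMulNumberOp_cornerPar_word (hn : 1 ≤ n)
    (hp : Pairwise fun i j => (p i).Coprime (p j))
    (hq : q ∈ Set.Ioo (0 : ℝ) 1) {w : List (Gen n)} (hw : wdeg (sharp p) w = 0) :
    IsBoundedMulNumberOp (cornerPar p r hq 0 (word q w) - cornerPar p r hq 1 (word q w)) := by
  have hn0 : (n : ℝ) ≠ 0 := by positivity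
  -- The decay `q^m_{k+1}` becomes `t^‖m‖₁` because `‖m‖₁ ≤ n m_{k+1}`.
  set t : ℝ := q ^ ((n : ℝ)⁻¹) with ht
  have ht0 : 0 ≤ t := Real.rpow_nonneg hq.1.le _
  have ht1 : t < 1 := Real.rpow_lt_one hq.1.le hq.2 (by positivity)
  have htn : t ^ n = q := Real.rpow_inv_natCast_pow hq.1.le (by omega)
  have hql : 0 < q ^ w.length := pow_pos hq.1 _
  refine isBoundedMulNumberOp_of_decay hn (C := (w.length + 1) / q ^ w.length) ht0 ht1 fun m => ?_
  by_cases hm : ∃ j ≤ n, InV j m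
  · obtain ⟨j, hj, hm⟩ := hm
    obtain ⟨k, hk, h1, h2⟩ := exists_InV_succ hn hj hm
    have h3 := norm_cornerRep_succ_sub_le p r hp hq hk h1 h2 hw
    have h4 := cornerPar_ket p r hq hk h1 h2 (word q w) (i := k) (by omega) (Or.inl rfl)
    have h5 := cornerPar_ket p r hq hk h1 h2 (word q w) (i := k + 1) (by omega) (Or.inr rfl)
    have h6 : ‖(cornerPar p r hq 0 (word q w) - cornerPar p r hq 1 (word q w)) (ket m)‖
        = ‖cornerRep p r hq ⟨k + 1, by omega⟩ (word q w) (ket m)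
          - cornerRep p r hq ⟨k, by omega⟩ (word q w) (ket m)‖ := by
      rw [sub_apply, ← h4, ← h5]
      rcases Nat.mod_two_eq_zero_or_one k with h | h
      · rw [h, show (k + 1) % 2 = 1 by omega, norm_sub_rev]
      · rw [h, show (k + 1) % 2 = 0 by omega]
    have h7 : q ^ m ⟨k, hk⟩ ≤ t ^ tot m := by
      calc q ^ m ⟨k, hk⟩ = t ^ (n * m ⟨k, hk⟩) := by rw [pow_mul, htn]
        _ ≤ t ^ tot m := pow_le_pow_of_le_one ht0 ht1.le (tot_le_mul hk h1 h2)
    rw [h6, div_mul_eq_mul_div, le_div_iff₀ hql, mul_comm]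
    exact h3.trans (mul_le_mul_of_nonneg_left h7 (by positivity))
  · have h1 : ∀ s, cornerPar p r hq s (word q w) (ket m) = 0 := fun s => by
      rw [cornerPar, LinearMap.sum_apply, sum_apply]
      refine Finset.sum_eq_zero fun j _ => ?_
      exact cornerRep_ket_of_not p r hq j
        (fun h => hm ⟨j, Nat.lt_succ_iff.1 j.isLt, h⟩) _
    rw [sub_apply, h1, h1, sub_zero, norm_zero]
    positivity

theorem hasBoundedCommutator_cornerPar_word (hp : Pairwise fun i j => (p i).Coprime (p j))
    (hq : q ∈ Set.Ioo (0 : ℝ) 1) (s : ℕ) {w : List (Gen n)} (hw : wdeg (sharp p) w = 0) :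
    HasBoundedCommutator (cornerPar p r hq s (word q w)) := by
  rw [cornerPar, LinearMap.sum_apply]
  exact Finset.sum_induction _ _ (fun _ _ => HasBoundedCommutator.add) HasBoundedCommutator.zero
    fun k _ => hasBoundedCommutator_cornerRep_word p r hp hq k hw

theorem cornerPar_commutators (hn : 1 ≤ n) (hp : Pairwise fun i j => (p i).Coprime (p j))
    (hq : q ∈ Set.Ioo (0 : ℝ) 1) {a : QSphere n q} (ha : a ∈ QProj q (sharp p)) :
    (∀ s, HasBoundedCommutator (cornerPar p r hq s a)) ∧
      IsBoundedMulNumberOp (cornerPar p r hq 0 a - cornerPar p r hq 1 a) := by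
  have h1 := mem_span_word_of_mem_QProj ha
  clear ha
  induction h1 using Submodule.span_induction with
  | mem x hx =>
    obtain ⟨w, hw, rfl⟩ := hx
    exact ⟨fun s => hasBoundedCommutator_cornerPar_word p r hp hq s hw,
      isBoundedMulNumberOp_cornerPar_word p r hn hp hq hw⟩
  | zero =>
    simp only [map_zero, sub_zero]
    exact ⟨fun _ => HasBoundedCommutator.zero, IsBoundedMulNumberOp.zero⟩
  | add x y _ _ hx hy =>
    simp only [map_add, add_sub_add_comm]
    exact ⟨fun s => (hx.1 s).add (hy.1 s), hx.2.add hy.2⟩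
  | smul c x _ hx =>
    simp only [map_smul, ← smul_sub]
    exact ⟨fun s => (hx.1 s).smul c, hx.2.smul c⟩

end wordsPiK

end QWP

theorem mainTheorem7 (n : ℕ) (hn : 1 ≤ n) (q : ℝ) (hq : q ∈ Set.Ioo (0 : ℝ) 1)
    (p : Fin (n + 1) → ℕ+) (hp : Pairwise fun i j => (p i).Coprime (p j))
    (r : ∀ i : Fin n, Fin (p i.castSucc)) :
    QWP.IsEvenSpectralTriple (QWP.piProj p r hp hq) (QWP.dirac n) QWP.grading ∧
      QWP.HasMetricDimension (QWP.dirac n) n ∧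
      ∀ s : ℝ, QWP.AbsPowNegTraceClass (QWP.dirac n) s ↔ (n : ℝ) < s := by
  refine ⟨⟨QWP.dense_dirac, QWP.isSelfAdjoint_dirac, fun μ hμ => QWP.compact_resolvent_dirac hμ,
    fun a => ?_, QWP.isSelfAdjoint_grading, QWP.grading_mul_grading,
    fun a => QWP.grading_mul_blockDiag _ _, QWP.grading_anticomm_dirac⟩,
    QWP.hasMetricDimension_dirac hn, QWP.absPowNegTraceClass_dirac_iff hn⟩
  obtain ⟨h1, h2⟩ := QWP.cornerPar_commutators p r hn hp hq a.2
  -- Only the commutator condition involves the algebra; it is reduced here to the two linear maps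
  -- controlled by `cornerPar_commutators`.
  have h3 : QWP.piProj p r hp hq a = QWP.blockDiag (QWP.cornerPar p r hq 0 (a : QWP.QSphere n q))
      (QWP.cornerPar p r hq 1 (a : QWP.QSphere n q)) := by
    rw [← QWP.piPar_eq_cornerPar p r hp hq 0 ⟨a.1, QWP.QProj_le_QLens _ _ _ a.2⟩,
      ← QWP.piPar_eq_cornerPar p r hp hq 1 ⟨a.1, QWP.QProj_le_QLens _ _ _ a.2⟩]
    rfl
  rw [h3]
  exact QWP.exists_commutator_dirac (h1 0) (h1 1) h2

end
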